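/- Let $n\ge 4$ and $W=\mathbb{C}^n$ with its standard basis $y_1,\dots,y_n$, let $x_1,\dots,x_n$ be the dual basis of $W^*$, and let $S_n$ act on $V=W^*\oplus W$ by ${}^{\sigma}x_i=x_{\sigma(i)}$, ${}^{\sigma}y_i=y_{\sigma(i)}$. Write $V^g=\{v\in V: {}^g v=v\}$, $x_{i,k}=x_i+x_k$, $x_{[n]}=\sum_l x_l$, and likewise for $y$. A linear (resp. constant) $2$-cochain is a sum $\kappa^L=\sum_{g\in S_n}\kappa^L_g\, g$ (resp. $\kappa^C=\sum_{g}\kappa^C_g\, g$) with alternating bilinear components $\kappa^L_g:V\times V\to V$ (resp. $\kappa^C_g:V\times V\to\mathbb{C}$). For $\kappa=\kappa^L+\kappa^C$ put $$\mathcal H_\kappa=T(V)\#S_n/\langle vw-wv-\kappa^L(v,w)-\kappa^C(v,w)\mid v,w\in V\rangle ,$$ filtered by giving $V$ degree one and $S_n$ degree zero. It is called a Drinfeld orbifold algebra if its associated graded algebra is isomorphic, as a graded algebra, to $S(V)\#S_n$. In that case $$\mathcal H_{\kappa,t}=T(V)\#S_n[t]/\langle vw-wv-\kappa^L(v,w)t-\kappa^C(v,w)t^2\mid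 v,w\in V\rangle$$ is called a Drinfeld orbifold algebra over $\mathbb{C}[t]$; note $\mathcal H_{\kappa,1}=\mathcal H_\kappa$. For $a,a^\perp,b,b^\perp,c,\alpha,\beta\in\mathbb{C}$ consider, for $1\le i\ne j\le n$, the values $$\kappa^L(x_i,x_j)=0,\qquad \kappa^L(y_i,y_j)=0,$$ $$\kappa^L(x_i,y_i)=\sum_{k\ne i}\bigl((a-a^\perp)x_{i,k}+a^\perp x_{[n]}+(b-b^\perp)y_{i,k}+b^\perp y_{[n]}\bigr)\otimes(i\,k),$$ $$\kappa^L(x_i,y_j)=-\bigl((a-a^\perp)x_{i,j}+a^\perp x_{[n]}+(b-b^\perp)y_{i,j}+b^\perp y_{[n]}\bigr)\otimes(i\,j),$$ $$\kappa^C(x_i,x_j)=(b-b^\perp)^2\sum_{k\ne i,j}\bigl((i\,j\,k)-(k\,j\,i)\bigr),\qquad \kappa^C(y_i,y_j)=(a-a^\perp)^2\sum_{k\ne i,j}\bigl((i\,j\,k)-(k\,j\,i)\bigr),$$ $$\kappa^C(x_i,y_i)=\alpha+c\sum_{k\ne i}(i\,k),\qquad \kappa^C(x_i,y_j)=\beta-c\,(i\,j)-(a-a^\perp)(b-b^\perp)\sum_{k\ne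 i,j}\bigl((i\,j\,k)-(k\,j\,i)\bigr),$$ and the conditions $$\alpha a+\beta(a+(n-2)a^\perp)=0,\qquad \alpha a^\perp+\beta(2a+(n-3)a^\perp)=0,$$ $$\alpha b+\beta(b+(n-2)b^\perp)=0,\qquad \alpha b^\perp+\beta(2b+(n-3)b^\perp)=0.\tag{$*$}$$ (1) For all parameters there are a unique linear $2$-cochain $\kappa^L$ and a unique constant $2$-cochain $\kappa^C$ with these values. (2) If $(*)$ holds, then for $\kappa=\kappa^L+\kappa^C$ the quotient of $T(V)\#S_n[t]$ by the ideal generated by $\{uv-vu-\kappa^L(u,v)t-\kappa^C(u,v)t^2\mid u,v\in\{x_1,\dots,x_n,y_1,\dots,y_n\}\}$ is the Drinfeld orbifold algebra $\mathcal H_{\kappa,t}$ over $\mathbb{C}[t]$; in particular $\mathcal H_\kappa$ is a Drinfeld orbifold algebra. (3) The algebras $\mathcal H_{\kappa,1}$ so obtained are precisely the Drinfeld orbifold algebras $\mathcal H_\kappa$ with $\operatorname{im}\kappa^L_g\subseteq V^g$ for every $g\in S_n$ and with $\kappa^L$ supported only off the identity (that is, $\kappa^L_1=0$): for a linear $2$-cochain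 $\kappa^L$ and a constant $2$-cochain $\kappa^C$, the algebra $\mathcal H_{\kappa^L+\kappa^C}$ is a Drinfeld orbifold algebra with these two properties if and only if there are parameters satisfying $(*)$ for which $\kappa^L$ and $\kappa^C$ have the values above. -/

import Mathlib

open scoped DirectSum Polynomial

noncomputable section

namespace DrinfeldOrbifold

/-! ### Skew group algebras of a representation -/

section SkewGroupAlgebras

variable {G V : Type*} [Group G] [AddCommGroup V] [Module ℂ V]

/-- The tensor algebra `T(V)` of the underlying space of `ρ`, remembering the action `ρ`. -/
def TensorAlg (_ρ : Representation ℂ G V) : Type _ := TensorAlgebra ℂ V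

/-- The symmetric algebra `S(V)` of the underlying space of `ρ`, remembering the action `ρ`. -/
def SymAlg (_ρ : Representation ℂ G V) : Type _ := SymmetricAlgebra ℂ V

variable (ρ : Representation ℂ G V)

instance : Ring (TensorAlg ρ) := inferInstanceAs (Ring (TensorAlgebra ℂ V))
instance : Algebra ℂ (TensorAlg ρ) := inferInstanceAs (Algebra ℂ (TensorAlgebra ℂ V))
instance : CommRing (SymAlg ρ) := inferInstanceAs (CommRing (SymmetricAlgebra ℂ V))
instance : Algebra ℂ (SymAlg ρ) := inferInstanceAs (Algebra ℂ (SymmetricAlgebra ℂ V))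

/-- The inclusion `V → T(V)`. -/
def tι : V →ₗ[ℂ] TensorAlg ρ := TensorAlgebra.ι ℂ

/-- The inclusion `V → S(V)`. -/
def sι : V →ₗ[ℂ] SymAlg ρ := SymmetricAlgebra.ι ℂ V

/-- The algebra endomorphism of `T(V)` extending `ρ g`. -/
def tensorAct (g : G) : TensorAlg ρ →ₐ[ℂ] TensorAlg ρ :=
  TensorAlgebra.lift ℂ (tι ρ ∘ₗ ρ g)

/-- The algebra endomorphism of `S(V)` extending `ρ g`. -/
def symAct (g : G) : SymAlg ρ →ₐ[ℂ] SymAlg ρ :=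
  SymmetricAlgebra.lift (sι ρ ∘ₗ ρ g)

theorem tensorAct_ι (g : G) (v : V) : tensorAct ρ g (tι ρ v) = tι ρ (ρ g v) :=
  TensorAlgebra.lift_ι_apply (A := TensorAlg ρ) (tι ρ ∘ₗ ρ g) v

theorem symAct_ι (g : G) (v : V) : symAct ρ g (sι ρ v) = sι ρ (ρ g v) :=
  SymmetricAlgebra.lift_ι_apply (A := SymAlg ρ) (sι ρ ∘ₗ ρ g) v

theorem tensorAlg_hom_ext {B : Type*} [Semiring B] [Algebra ℂ B] {f f' : TensorAlg ρ →ₐ[ℂ] B}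
    (h : ∀ v, f (tι ρ v) = f' (tι ρ v)) : f = f' :=
  TensorAlgebra.hom_ext (f := f) (g := f') (LinearMap.ext h)

theorem symAlg_hom_ext {B : Type*} [CommSemiring B] [Algebra ℂ B] {f f' : SymAlg ρ →ₐ[ℂ] B}
    (h : ∀ v, f (sι ρ v) = f' (sι ρ v)) : f = f' :=
  SymmetricAlgebra.algHom_ext (F := f) (G := f') (LinearMap.ext h)

theorem tensorAct_one : tensorAct ρ 1 = AlgHom.id ℂ (TensorAlg ρ) :=
  tensorAlg_hom_ext ρ fun v => by rw [tensorAct_ι]; simp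

theorem tensorAct_mul (g h : G) : tensorAct ρ (g * h) = (tensorAct ρ g).comp (tensorAct ρ h) :=
  tensorAlg_hom_ext ρ fun v => by
    rw [AlgHom.comp_apply, tensorAct_ι, tensorAct_ι, tensorAct_ι]; simp

theorem symAct_one : symAct ρ 1 = AlgHom.id ℂ (SymAlg ρ) :=
  symAlg_hom_ext ρ fun v => by rw [symAct_ι]; simp

theorem symAct_mul (g h : G) : symAct ρ (g * h) = (symAct ρ g).comp (symAct ρ h) :=
  symAlg_hom_ext ρ fun v => by
    rw [AlgHom.comp_apply, symAct_ι, symAct_ι, symAct_ι]; simp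

/-- `G` acts on `T(V)` by algebra automorphisms extending its action on `V`. -/
instance : MulSemiringAction G (TensorAlg ρ) where
  smul g t := tensorAct ρ g t
  one_smul t := by change tensorAct ρ 1 t = t; rw [tensorAct_one]; rfl
  mul_smul g h t := by
    change tensorAct ρ (g * h) t = tensorAct ρ g (tensorAct ρ h t); rw [tensorAct_mul]; rfl
  smul_zero g := map_zero (tensorAct ρ g)
  smul_add g := map_add (tensorAct ρ g)
  smul_one g := map_one (tensorAct ρ g)
  smul_mul g := map_mul (tensorAct ρ g)

/-- `G` acts on `S(V)` by algebra automorphisms extending its action on `V`. -/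
instance : MulSemiringAction G (SymAlg ρ) where
  smul g t := symAct ρ g t
  one_smul t := by change symAct ρ 1 t = t; rw [symAct_one]; rfl
  mul_smul g h t := by
    change symAct ρ (g * h) t = symAct ρ g (symAct ρ h t); rw [symAct_mul]; rfl
  smul_zero g := map_zero (symAct ρ g)
  smul_add g := map_add (symAct ρ g)
  smul_one g := map_one (symAct ρ g)
  smul_mul g := map_mul (symAct ρ g)

instance : SMulCommClass G ℂ (TensorAlg ρ) := ⟨fun g c t => map_smul (tensorAct ρ g) c t⟩
instance : SMulCommClass G ℂ (SymAlg ρ) := ⟨fun g c t => map_smul (symAct ρ g) c t⟩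

/-- The skew group algebra `T(V) # G`; `single g t` is `t ⊗ g`, and
`(s ⊗ g) (t ⊗ h) = s (g • t) ⊗ g h`. -/
abbrev TensorSkew : Type _ := SkewMonoidAlgebra (TensorAlg ρ) G

/-- The skew group algebra `S(V) # G`. -/
abbrev SymSkew : Type _ := SkewMonoidAlgebra (SymAlg ρ) G

end SkewGroupAlgebras

/-! ### The associated graded algebra of a filtered algebra -/

section AssociatedGraded

variable {A : Type*} [Ring A] [Algebra ℂ A] (F : ℕ → Submodule ℂ A)

/-- The preceding step of a filtration, with `F₋₁ = 0`. -/
def prevStep : ℕ → Submodule ℂ A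
  | 0 => ⊥
  | d + 1 => F d

/-- The graded piece `F_d / F_{d-1}`. -/
abbrev GrPiece (d : ℕ) : Type _ := F d ⧸ (prevStep F d).comap (F d).subtype

/-- The class in `F_d / F_{d-1}` of an element of `F_d`. -/
abbrev grMk (d : ℕ) : F d →ₗ[ℂ] GrPiece F d := Submodule.mkQ _

theorem grMk_congr {i j : ℕ} (h : i = j) {x : F i} {y : F j} (hxy : x.1 = y.1) :
    GradedMonoid.mk (A := GrPiece F) i (grMk F i x) = GradedMonoid.mk j (grMk F j y) := by
  subst h
  rw [Subtype.ext hxy]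

variable [SetLike.GradedMonoid F]

theorem mul_mem_prevStep_left {i j : ℕ} {x y : A} (hx : x ∈ prevStep F i) (hy : y ∈ F j) :
    x * y ∈ prevStep F (i + j) := by
  cases i with
  | zero =>
    have h0 : x = 0 := hx
    simp [h0]
  | succ i =>
    have h : i + 1 + j = i + j + 1 := by omega
    rw [h]
    exact SetLike.GradedMul.mul_mem (A := F) hx hy

theorem mul_mem_prevStep_right {i j : ℕ} {x y : A} (hx : x ∈ F i) (hy : y ∈ prevStep F j) :
    x * y ∈ prevStep F (i + j) := by
  cases j with
  | zero =>
    have h0 : y = 0 := hy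
    simp [h0]
  | succ j => exact SetLike.GradedMul.mul_mem (A := F) hx hy

/-- Multiplication `F_i × F_j → F_{i+j}`. -/
def stepMul (i j : ℕ) : F i →ₗ[ℂ] F j →ₗ[ℂ] F (i + j) :=
  LinearMap.mk₂ ℂ (fun x y => ⟨x.1 * y.1, SetLike.GradedMul.mul_mem x.2 y.2⟩)
    (fun _ _ _ => Subtype.ext (add_mul _ _ _)) (fun _ _ _ => Subtype.ext (smul_mul_assoc _ _ _))
    (fun _ _ _ => Subtype.ext (mul_add _ _ _)) (fun _ _ _ => Subtype.ext (mul_smul_comm _ _ _))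

/-- The multiplication `F_i/F_{i-1} × F_j/F_{j-1} → F_{i+j}/F_{i+j-1}` induced by that of `A`. -/
def grMul (i j : ℕ) : GrPiece F i →ₗ[ℂ] GrPiece F j →ₗ[ℂ] GrPiece F (i + j) :=
  Submodule.liftQ _
    { toFun := fun x => Submodule.liftQ _ ((grMk F (i + j)).comp (stepMul F i j x)) (by
        intro y hy
        exact (Submodule.Quotient.mk_eq_zero _).2 (mul_mem_prevStep_right F x.2 hy))
      map_add' := fun x y => by
        refine Submodule.linearMap_qext _ (LinearMap.ext fun z => ?_)
        change grMk F (i + j) (stepMul F i j (x + y) z) =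
          grMk F (i + j) (stepMul F i j x z) + grMk F (i + j) (stepMul F i j y z)
        rw [map_add, LinearMap.add_apply, map_add]
      map_smul' := fun c x => by
        refine Submodule.linearMap_qext _ (LinearMap.ext fun z => ?_)
        change grMk F (i + j) (stepMul F i j (c • x) z) =
          c • grMk F (i + j) (stepMul F i j x z)
        rw [map_smul, LinearMap.smul_apply, map_smul] }
    (by
      intro x hx
      refine Submodule.linearMap_qext _ (LinearMap.ext fun y => ?_)
      exact (Submodule.Quotient.mk_eq_zero _).2 (mul_mem_prevStep_left F hx y.2))

theorem grMul_mk {i j : ℕ} (x : F i) (y : F j) :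
    grMul F i j (grMk F i x) (grMk F j y) =
      grMk F (i + j) ⟨x.1 * y.1, SetLike.GradedMul.mul_mem x.2 y.2⟩ := rfl

instance : GradedMonoid.GMul (GrPiece F) where
  mul {i j} x y := grMul F i j x y

instance : GradedMonoid.GOne (GrPiece F) where
  one := grMk F 0 ⟨1, SetLike.GradedOne.one_mem⟩

instance : GradedMonoid.GMonoid (GrPiece F) where
  one_mul := by
    rintro ⟨i, x⟩
    obtain ⟨x, rfl⟩ := Submodule.mkQ_surjective _ x
    exact grMk_congr F (zero_add i) (one_mul x.1)
  mul_one := by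
    rintro ⟨i, x⟩
    obtain ⟨x, rfl⟩ := Submodule.mkQ_surjective _ x
    exact grMk_congr F (add_zero i) (mul_one x.1)
  mul_assoc := by
    rintro ⟨i, x⟩ ⟨j, y⟩ ⟨k, z⟩
    obtain ⟨x, rfl⟩ := Submodule.mkQ_surjective _ x
    obtain ⟨y, rfl⟩ := Submodule.mkQ_surjective _ y
    obtain ⟨z, rfl⟩ := Submodule.mkQ_surjective _ z
    exact grMk_congr F (add_assoc i j k) (mul_assoc x.1 y.1 z.1)

instance : DirectSum.GSemiring (GrPiece F) where
  __ := (inferInstance : GradedMonoid.GMonoid (GrPiece F))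
  mul_zero {i j} x := map_zero (grMul F i j x)
  zero_mul {i j} y := by
    change grMul F i j 0 y = 0
    rw [map_zero]; rfl
  mul_add {i j} x y z := map_add (grMul F i j x) y z
  add_mul {i j} x y z := by
    change grMul F i j (x + y) z = grMul F i j x z + grMul F i j y z
    rw [map_add]; rfl
  natCast m := m • grMk F 0 ⟨1, SetLike.GradedOne.one_mem⟩
  natCast_zero := zero_smul ℕ _
  natCast_succ m := succ_nsmul _ m

instance : DirectSum.GAlgebra ℂ (GrPiece F) where
  toFun := (LinearMap.toSpanSingleton ℂ (GrPiece F 0)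
    (grMk F 0 ⟨1, SetLike.GradedOne.one_mem⟩)).toAddMonoidHom
  map_one := by
    change (1 : ℂ) • grMk F 0 ⟨1, SetLike.GradedOne.one_mem⟩ = grMk F 0 _
    exact one_smul ℂ _
  map_mul r s := by
    refine grMk_congr F (zero_add 0).symm (x := (r * s) • ⟨1, SetLike.GradedOne.one_mem⟩)
      (y := stepMul F 0 0 (r • ⟨1, SetLike.GradedOne.one_mem⟩)
        (s • ⟨1, SetLike.GradedOne.one_mem⟩)) ?_
    change (r * s) • (1 : A) = (r • (1 : A)) * (s • (1 : A))
    rw [smul_mul_smul_comm, mul_one]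
  commutes := by
    rintro r ⟨i, x⟩
    obtain ⟨x, rfl⟩ := Submodule.mkQ_surjective _ x
    refine grMk_congr F (add_comm 0 i)
      (x := stepMul F 0 i (r • ⟨1, SetLike.GradedOne.one_mem⟩) x)
      (y := stepMul F i 0 x (r • ⟨1, SetLike.GradedOne.one_mem⟩)) ?_
    change (r • (1 : A)) * x.1 = x.1 * (r • (1 : A))
    simp
  smul_def := by
    rintro r ⟨i, x⟩
    obtain ⟨x, rfl⟩ := Submodule.mkQ_surjective _ x
    refine grMk_congr F (zero_add i).symm (x := r • x)
      (y := stepMul F 0 i (r • ⟨1, SetLike.GradedOne.one_mem⟩) x) ?_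
    change r • x.1 = (r • (1 : A)) * x.1
    simp

/-- The associated graded algebra `⨁_d F_d / F_{d-1}`. -/
abbrev AssocGraded : Type _ := ⨁ d, GrPiece F d

end AssociatedGraded

/-! ### Drinfeld orbifold algebras -/

section DrinfeldOrbifoldAlgebras

variable {G V : Type*} [Group G] [AddCommGroup V] [Module ℂ V]

variable (G V) in
/-- Linear `2`-cochains `κᴸ = ∑ g, κᴸ_g g` with components `κᴸ_g : ⋀² V → V`. -/
abbrev LinCochain : Type _ := G → V [⋀^Fin 2]→ₗ[ℂ] V

variable (G V) in
/-- Constant `2`-cochains `κᶜ = ∑ g, κᶜ_g g` with components `κᶜ_g : ⋀² V → ℂ`. -/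
abbrev ConstCochain : Type _ := G → V [⋀^Fin 2]→ₗ[ℂ] ℂ

variable (ρ : Representation ℂ G V)

/-- The image of `v : V` in `T(V) # G`. -/
def vec (v : V) : TensorSkew ρ := SkewMonoidAlgebra.single 1 (tι ρ v)

/-- The span of the elements `t ⊗ g` of `T(V) # G` with `t` of tensor degree at most `d`. -/
def tensorDegLE (d : ℕ) : Submodule ℂ (TensorSkew ρ) :=
  Submodule.span ℂ {x | ∃ (g : G) (i : ℕ) (t : TensorAlg ρ), i ≤ d ∧
    t ∈ LinearMap.range (tι ρ) ^ i ∧ x = SkewMonoidAlgebra.single g t}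

/-- The degree `d` component of the graded algebra `S(V) # G`, spanned by the `s ⊗ g` with `s`
homogeneous of degree `d`. -/
def symDeg (d : ℕ) : Submodule ℂ (SymSkew ρ) :=
  Submodule.span ℂ {x | ∃ (g : G) (s : SymAlg ρ),
    s ∈ LinearMap.range (sι ρ) ^ d ∧ x = SkewMonoidAlgebra.single g s}

theorem smul_mem_range_pow (g : G) {i : ℕ} {t : TensorAlg ρ}
    (ht : t ∈ LinearMap.range (tι ρ) ^ i) : g • t ∈ LinearMap.range (tι ρ) ^ i := by
  have h : (LinearMap.range (tι ρ)).map (tensorAct ρ g).toLinearMap ≤ LinearMap.range (tι ρ) := by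
    rintro _ ⟨_, ⟨v, rfl⟩, rfl⟩
    exact ⟨ρ g v, (tensorAct_ι ρ g v).symm⟩
  have h' := Submodule.mem_map_of_mem (f := (tensorAct ρ g).toLinearMap) ht
  rw [Submodule.map_pow] at h'
  exact pow_le_pow_left' h i h'

theorem tensorDegLE_mul {i j : ℕ} {x y : TensorSkew ρ} (hx : x ∈ tensorDegLE ρ i)
    (hy : y ∈ tensorDegLE ρ j) : x * y ∈ tensorDegLE ρ (i + j) := by
  have key : tensorDegLE ρ i * tensorDegLE ρ j ≤ tensorDegLE ρ (i + j) := by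
    rw [tensorDegLE, tensorDegLE, Submodule.span_mul_span]
    refine Submodule.span_le.2 ?_
    rintro _ ⟨_, ⟨g, k, s, hk, hs, rfl⟩, _, ⟨h, l, t, hl, ht, rfl⟩, rfl⟩
    refine Submodule.subset_span ⟨g * h, k + l, s * g • t, add_le_add hk hl, ?_, ?_⟩
    · rw [pow_add]
      exact Submodule.mul_mem_mul hs (smul_mem_range_pow ρ g ht)
    · exact SkewMonoidAlgebra.single_mul_single
  exact key (Submodule.mul_mem_mul hx hy)

/-- The quotient of `A` by the two-sided ideal generated by `S`. -/
abbrev QuotBy {A : Type*} [Ring A] (S : Set A) : Type _ :=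
  RingQuot fun p q : A => p ∈ S ∧ q = 0

variable [Fintype G]

/-- The element `∑ g, κᴸ_g(v, w) ⊗ g` of `T(V) # G`. -/
def linVal (κL : LinCochain G V) (v w : V) : TensorSkew ρ :=
  ∑ g, SkewMonoidAlgebra.single g (tι ρ (κL g ![v, w]))

/-- The element `∑ g, κᶜ_g(v, w) g` of `T(V) # G`. -/
def constVal (κC : ConstCochain G V) (v w : V) : TensorSkew ρ :=
  ∑ g, SkewMonoidAlgebra.single g (algebraMap ℂ (TensorAlg ρ) (κC g ![v, w]))

variable (κL : LinCochain G V) (κC : ConstCochain G V)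

/-- The relators `v w - w v - κᴸ(v, w) - κᶜ(v, w)`. -/
def relators : Set (TensorSkew ρ) :=
  {p | ∃ v w : V, p = vec ρ v * vec ρ w - vec ρ w * vec ρ v - linVal ρ κL v w - constVal ρ κC v w}

/-- `H_κ = T(V) # G / ⟨v w - w v - κᴸ(v, w) - κᶜ(v, w) ∣ v, w ∈ V⟩`. -/
abbrev HAlg : Type _ := QuotBy (relators ρ κL κC)

/-- The quotient map `T(V) # G → H_κ`. -/
def toH : TensorSkew ρ →ₐ[ℂ] HAlg ρ κL κC := RingQuot.mkAlgHom ℂ _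

/-- The filtration of `H_κ` by degree: the image of the filtration of `T(V) # G` in which `V` has
degree one and `G` has degree zero. -/
def filtH (d : ℕ) : Submodule ℂ (HAlg ρ κL κC) :=
  (tensorDegLE ρ d).map (toH ρ κL κC).toLinearMap

instance : SetLike.GradedMonoid (filtH ρ κL κC) where
  one_mem := by
    refine ⟨1, Submodule.subset_span ⟨1, 0, 1, le_rfl, ?_, rfl⟩, map_one (toH ρ κL κC)⟩
    rw [pow_zero]
    exact Submodule.one_le.1 le_rfl
  mul_mem := by
    rintro i j _ _ ⟨x, hx, rfl⟩ ⟨y, hy, rfl⟩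
    exact ⟨x * y, tensorDegLE_mul ρ hx hy, map_mul (toH ρ κL κC) x y⟩

theorem filtH_mono : Monotone (filtH ρ κL κC) := fun _ _ h =>
  Submodule.map_mono (Submodule.span_mono fun _ ⟨g, k, t, hk, ht, e⟩ => ⟨g, k, t, hk.trans h, ht, e⟩)

/-- `H_κ` is a Drinfeld orbifold algebra: the PBW condition `gr H_κ ≅ S(V) # G` holds, as an
isomorphism of graded algebras. -/
def IsDrinfeldOrbifoldAlgebra : Prop :=
  ∃ θ : AssocGraded (filtH ρ κL κC) ≃ₐ[ℂ] SymSkew ρ,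
    ∀ (d : ℕ) (x : GrPiece (filtH ρ κL κC) d),
      θ (DirectSum.of (GrPiece (filtH ρ κL κC)) d x) ∈ symDeg ρ d

/-- The element `v w - w v - κᴸ(v, w) t - κᶜ(v, w) t²` of `(T(V) # G)[t]`. -/
def polyRelator (v w : V) : (TensorSkew ρ)[X] :=
  Polynomial.C (vec ρ v * vec ρ w - vec ρ w * vec ρ v)
    - Polynomial.C (linVal ρ κL v w) * Polynomial.X
    - Polynomial.C (constVal ρ κC v w) * Polynomial.X ^ 2

/-- The quotient of `(T(V) # G)[t]` by the two-sided ideal generated by the elements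
`v w - w v - κᴸ(v, w) t - κᶜ(v, w) t²` with `v, w ∈ B`. -/
abbrev HPolyOn (B : Set V) : Type _ :=
  QuotBy {p : (TensorSkew ρ)[X] | ∃ v ∈ B, ∃ w ∈ B, p = polyRelator ρ κL κC v w}

attribute [local instance] Polynomial.algebra in
/-- The `ℂ[t]`-algebra structure of the quotient `HPolyOn`. -/
instance (B : Set V) : Algebra ℂ[X] (HPolyOn ρ κL κC B) := RingQuot.instAlgebra _

/-- `H_{κ,t}`, where all `v, w ∈ V` are used. -/
abbrev HPoly : Type _ := HPolyOn ρ κL κC Set.univ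

/-- The `ℂ[t]`-algebra `A` is the Drinfeld orbifold algebra over `ℂ[t]` with parameter map `κ`:
`H_κ` is a Drinfeld orbifold algebra and `A ≅ H_{κ,t}`. -/
def IsDrinfeldOrbifoldAlgebraOver (A : Type*) [Ring A] [Algebra ℂ[X] A] : Prop :=
  IsDrinfeldOrbifoldAlgebra ρ κL κC ∧ Nonempty (A ≃ₐ[ℂ[X]] HPoly ρ κL κC)

end DrinfeldOrbifoldAlgebras

/-! ### The doubled permutation representation of the symmetric group -/

section DoubledPermutation

variable (n : ℕ)

/-- The natural permutation representation `W = ℂⁿ`. -/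
def permRep : Representation ℂ (Equiv.Perm (Fin n)) (Fin n → ℂ) where
  toFun σ := LinearMap.funLeft ℂ ℂ ⇑σ⁻¹
  map_one' := rfl
  map_mul' _ _ := rfl

/-- The space `V = W* ⊕ W`. -/
abbrev DoubledSpace : Type := Module.Dual ℂ (Fin n → ℂ) × (Fin n → ℂ)

/-- The doubled permutation representation on `V = W* ⊕ W`. -/
def doubledRep : Representation ℂ (Equiv.Perm (Fin n)) (DoubledSpace n) :=
  (permRep n).dual.prod (permRep n)

variable {n}

/-- The vector `x_i` of the basis of `W*` dual to `y_1, …, y_n`. -/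
def xv (i : Fin n) : DoubledSpace n := (LinearMap.proj i, 0)

/-- The standard basis vector `y_i` of `W`. -/
def yv (i : Fin n) : DoubledSpace n := (0, Pi.single i 1)

theorem doubledRep_xv (σ : Equiv.Perm (Fin n)) (i : Fin n) :
    doubledRep n σ (xv i) = xv (σ i) := by
  refine Prod.ext (LinearMap.ext fun w => ?_) ?_
  · change w ((σ⁻¹)⁻¹ i) = w (σ i)
    rw [inv_inv]
  · simp [doubledRep, xv]

theorem doubledRep_yv (σ : Equiv.Perm (Fin n)) (i : Fin n) :
    doubledRep n σ (yv i) = yv (σ i) := by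
  refine Prod.ext ?_ (funext fun j => ?_)
  · simp [doubledRep, yv]
  · change (Pi.single i (1 : ℂ) : Fin n → ℂ) (σ⁻¹ j) = (Pi.single (σ i) (1 : ℂ) : Fin n → ℂ) j
    simp only [Pi.single_apply, Equiv.Perm.inv_eq_iff_eq]

variable (n) in
/-- The basis `{x_1, …, x_n, y_1, …, y_n}` of `V`. -/
def basisSet : Set (DoubledSpace n) := Set.range xv ∪ Set.range yv

/-- The `3`-cycle `(i j k)`, sending `i ↦ j ↦ k ↦ i`. -/
def cyc (i j k : Fin n) : Equiv.Perm (Fin n) := Equiv.swap i j * Equiv.swap j k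

/-- `(p - p') v_{i,k} + p' v_{[n]}` for `v = x` with `p = a`, plus the same for `v = y` with
`p = b`, where `v_{i,k} = v_i + v_k` and `v_{[n]} = v_1 + ⋯ + v_n`. -/
def reflVec (a a' b b' : ℂ) (i k : Fin n) : DoubledSpace n :=
  (a - a') • (xv i + xv k) + a' • ∑ l, xv l + (b - b') • (yv i + yv k) + b' • ∑ l, yv l

/-- `∑_{k ≠ i, j} ((i j k) - (k j i))`, as a function on the group. -/
def triSum (i j : Fin n) : Equiv.Perm (Fin n) → ℂ :=
  ∑ k ∈ Finset.univ \ {i, j}, (Pi.single (cyc i j k) 1 - Pi.single (cyc k j i) 1)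

/-- The linear cochain `κᴸ` has the prescribed values on basis vectors; an element
`∑ g, u_g ⊗ g` is recorded as the function `g ↦ u_g`. -/
structure IsLinPart (a a' b b' : ℂ) (κL : LinCochain (Equiv.Perm (Fin n)) (DoubledSpace n)) :
    Prop where
  xx : ∀ i j, i ≠ j → (fun g => κL g ![xv i, xv j]) = 0
  yy : ∀ i j, i ≠ j → (fun g => κL g ![yv i, yv j]) = 0
  xy_same : ∀ i, (fun g => κL g ![xv i, yv i]) =
    ∑ k ∈ Finset.univ.erase i, Pi.single (Equiv.swap i k) (reflVec a a' b b' i k)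
  xy_ne : ∀ i j, i ≠ j → (fun g => κL g ![xv i, yv j]) =
    -Pi.single (Equiv.swap i j) (reflVec a a' b b' i j)

/-- The constant cochain `κᶜ` has the prescribed values on basis vectors; an element
`∑ g, u_g g` of the group algebra is recorded as the function `g ↦ u_g`. -/
structure IsConstPart (a a' b b' c α β : ℂ)
    (κC : ConstCochain (Equiv.Perm (Fin n)) (DoubledSpace n)) : Prop where
  xx : ∀ i j, i ≠ j → (fun g => κC g ![xv i, xv j]) = (b - b') ^ 2 • triSum i j
  yy : ∀ i j, i ≠ j → (fun g => κC g ![yv i, yv j]) = (a - a') ^ 2 • triSum i j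
  xy_same : ∀ i, (fun g => κC g ![xv i, yv i]) =
    Pi.single 1 α + c • ∑ k ∈ Finset.univ.erase i, Pi.single (Equiv.swap i k) 1
  xy_ne : ∀ i j, i ≠ j → (fun g => κC g ![xv i, yv j]) =
    Pi.single 1 β - c • Pi.single (Equiv.swap i j) 1 - ((a - a') * (b - b')) • triSum i j

/-- The four quadratic conditions on the parameters. -/
structure ParamConditions (n : ℕ) (a a' b b' α β : ℂ) : Prop where
  a_first : α * a + β * (a + (n - 2) * a') = 0
  a_second : α * a' + β * (2 * a + (n - 3) * a') = 0
  b_first : α * b + β * (b + (n - 2) * b') = 0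
  b_second : α * b' + β * (2 * b + (n - 3) * b') = 0

end DoubledPermutation

end DrinfeldOrbifold

end

/-! The first half is a PBW theorem for an arbitrary finite group `G` and finite-dimensional `V`. A
graded isomorphism of gr H_κ with S(V)#G exists exactly when every relation of degree at most d is
already produced by relators without leaving degree d (`IsPBW`). Sorting words shows that an element
with zero symbol always dies in the associated graded algebra. Since filtration steps are finite
dimensional, even an abstract graded isomorphism forces the converse, by counting dimensions
(`IsDrinfeldOrbifoldAlgebra.isPBW`). A diamond-lemma argument (`isPBW_of_jacobi`) reduces `IsPBW` to
two checks: κ is `G`-invariant, and the cyclic sum of the commutators [κ(v₁,v₂),v₃] follows from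
relators in degree two. Split by degree and by group element, these become the invariance,
quadratic, linear and constant identities of `PBWConditions` (`isDrinfeldOrbifoldAlgebra_iff`).

The second half solves these identities for S_n. Let ω_ij be the form `om i j`, and let c_ij be the
cyclic sum of ω_ij(v₁,v₂)v₃ (`cycVec`). The vector c_ij is fixed by (i j), because the two
functionals whose wedge is ω_ij vanish on it. This gives the quadratic identity, and it removes the
transposition part of κᶜ from the linear one, so c is free. When κᴸ is composed with itself, only
transpositions sharing exactly one index interact (`om_reflVec`). Their products are 3-cycles, and
the 3-cycle part of κᶜ is exactly what cancels them (`reflVec_triForm`). In the constant identity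
the 3-cycle forms vanish on reflection vectors (`triForm_reflVec`), and the transposition forms
cancel cyclically (`cycSum_ell_eq_zero`). What remains is the identity component evaluated at a
reflection vector and c_ij (`linPart_const_sum`); it vanishes under (∗).

Conversely, test the quadratic identity against g-invariant functionals. The resulting scalar forms
φ have vanishing cyclic sum of φ(v₁,v₂)(g v₃ - v₃). For g ≠ 1 such a form is zero unless g is a
transposition (p q), and then it is a multiple of ω_pq (`alt_eq_zero_of_cyclic`,
`alt_eq_om_of_cyclic`). As κᴸ_g takes values in V^g, invariant functionals detect it. So κᴸ lives on
transpositions, and equivariance leaves four parameters. Given κᴸ, the linear identity fixes κᶜ up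
to forms φ of the same kind, which accounts for c, together with an invariant form at the identity,
which accounts for α and β. The constant identity, evaluated on basis vectors, is (∗). -/

noncomputable section

namespace DrinfeldOrbifold

/-! ### Words as a basis of T(V)#G, and the degree filtration. -/

section SkewBasics

variable {G V : Type*} [Group G] [AddCommGroup V] [Module ℂ V] (ρ : Representation ℂ G V)

/-- The image of `g : G` in `T(V) # G`. -/
def grp (g : G) : TensorSkew ρ := SkewMonoidAlgebra.single g 1

theorem single_mul_single' (g h : G) (s t : TensorAlg ρ) :
    (SkewMonoidAlgebra.single g s : TensorSkew ρ) * SkewMonoidAlgebra.single h t =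
      SkewMonoidAlgebra.single (g * h) (s * tensorAct ρ g t) :=
  SkewMonoidAlgebra.single_mul_single

theorem sym_single_mul_single (g h : G) (s t : SymAlg ρ) :
    (SkewMonoidAlgebra.single g s : SymSkew ρ) * SkewMonoidAlgebra.single h t =
      SkewMonoidAlgebra.single (g * h) (s * symAct ρ g t) :=
  SkewMonoidAlgebra.single_mul_single

theorem grp_mul_grp (g h : G) : grp ρ g * grp ρ h = grp ρ (g * h) := by
  rw [grp, grp, single_mul_single', map_one, mul_one, grp]

theorem single_one_mul_grp (g : G) (t : TensorAlg ρ) :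
    (SkewMonoidAlgebra.single 1 t : TensorSkew ρ) * grp ρ g = SkewMonoidAlgebra.single g t := by
  rw [grp, single_mul_single', map_one, mul_one, one_mul]

theorem vec_mul_grp (v : V) (g : G) :
    vec ρ v * grp ρ g = SkewMonoidAlgebra.single g (tι ρ v) := single_one_mul_grp ρ g _

theorem grp_mul_vec (g : G) (v : V) : grp ρ g * vec ρ v = vec ρ (ρ g v) * grp ρ g := by
  rw [vec_mul_grp, grp, vec, single_mul_single', tensorAct_ι, mul_one, one_mul]

theorem single_algebraMap (g : G) (c : ℂ) :
    (SkewMonoidAlgebra.single g (algebraMap ℂ (TensorAlg ρ) c) : TensorSkew ρ) = c • grp ρ g := by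
  rw [grp, SkewMonoidAlgebra.smul_single, Algebra.algebraMap_eq_smul_one]

/-- The inclusion `V → T(V) # G` as a linear map. -/
def vecL : V →ₗ[ℂ] TensorSkew ρ where
  toFun := vec ρ
  map_add' v w := by rw [vec, map_add, SkewMonoidAlgebra.single_add]; rfl
  map_smul' c v := by rw [vec, map_smul, ← SkewMonoidAlgebra.smul_single]; rfl

theorem vec_add (v w : V) : vec ρ (v + w) = vec ρ v + vec ρ w := map_add (vecL ρ) v w
theorem vec_sub (v w : V) : vec ρ (v - w) = vec ρ v - vec ρ w := map_sub (vecL ρ) v w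
theorem vec_neg (v : V) : vec ρ (-v) = -vec ρ v := map_neg (vecL ρ) v
theorem vec_zero : vec ρ (0 : V) = 0 := map_zero (vecL ρ)
theorem vec_smul (c : ℂ) (v : V) : vec ρ (c • v) = c • vec ρ v := map_smul (vecL ρ) c v
theorem vec_sum {κ : Type*} (s : Finset κ) (f : κ → V) :
    vec ρ (∑ i ∈ s, f i) = ∑ i ∈ s, vec ρ (f i) := map_sum (vecL ρ) f s

/-! ### Words -/

variable {ι : Type*} (b : Module.Basis ι ℂ V)

/-- The product in `T(V) # G` of the basis vectors indexed by the letters of a word. -/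
def mon (w : List ι) : TensorSkew ρ := (w.map fun i => vec ρ (b i)).prod

theorem mon_nil : mon ρ b [] = 1 := rfl

theorem mon_cons (i : ι) (w : List ι) : mon ρ b (i :: w) = vec ρ (b i) * mon ρ b w := by
  simp [mon]

theorem mon_append (u w : List ι) : mon ρ b (u ++ w) = mon ρ b u * mon ρ b w := by
  simp [mon]

/-- The basis of `T(V)` formed by words. -/
def tensorBasis : Module.Basis (FreeMonoid ι) ℂ (TensorAlg ρ) := b.tensorAlgebra

theorem tensorBasis_apply (w : FreeMonoid ι) :
    tensorBasis ρ b w = (w.toList.map fun i => tι ρ (b i)).prod := by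
  induction w using FreeMonoid.recOn with
  | one =>
    change (TensorAlgebra.equivFreeAlgebra b).symm ((FreeAlgebra.basisFreeMonoid ℂ ι) 1) = 1
    rw [show (FreeAlgebra.basisFreeMonoid ℂ ι) 1 = 1 from by
      simp [FreeAlgebra.basisFreeMonoid, FreeAlgebra.equivMonoidAlgebraFreeMonoid], map_one]
  | of_mul i w ih =>
    have h : (FreeAlgebra.basisFreeMonoid ℂ ι) (FreeMonoid.of i * w) =
        FreeAlgebra.ι ℂ i * (FreeAlgebra.basisFreeMonoid ℂ ι) w := by
      simp [FreeAlgebra.basisFreeMonoid, FreeAlgebra.equivMonoidAlgebraFreeMonoid, map_mul]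
    have h2 : tensorBasis ρ b (FreeMonoid.of i * w) = tι ρ (b i) * tensorBasis ρ b w := by
      change (TensorAlgebra.equivFreeAlgebra b).symm
        ((FreeAlgebra.basisFreeMonoid ℂ ι) (FreeMonoid.of i * w)) = _
      rw [h]
      refine (map_mul (TensorAlgebra.equivFreeAlgebra b).symm _ _).trans ?_
      rw [TensorAlgebra.equivFreeAlgebra_symm_ι]
      rfl
    rw [h2, ih, FreeMonoid.toList_of_mul, List.map_cons, List.prod_cons]

theorem single_one_prod (l : List (TensorAlg ρ)) :
    (SkewMonoidAlgebra.single 1 l.prod : TensorSkew ρ) =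
      (l.map fun t => (SkewMonoidAlgebra.single 1 t : TensorSkew ρ)).prod := by
  induction l with
  | nil => rfl
  | cons t l ih =>
    rw [List.prod_cons, List.map_cons, List.prod_cons, ← ih, single_mul_single', tensorAct_one,
      one_mul, AlgHom.id_apply]

/-- The basis of `T(V) # G` formed by the elements `w g`, for words `w` and `g ∈ G`. -/
def wordBasis : Module.Basis (G × List ι) ℂ (TensorSkew ρ) :=
  (((Finsupp.basis fun _ : G => tensorBasis ρ b).map
    (SkewMonoidAlgebra.coeffLinearEquiv (S := ℂ) (k := TensorAlg ρ) (G := G)).symm).reindex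
    ((Equiv.sigmaEquivProd G (FreeMonoid ι)).trans
      (Equiv.prodCongr (Equiv.refl G) FreeMonoid.toList)))

theorem wordBasis_apply (g : G) (w : List ι) :
    wordBasis ρ b (g, w) = mon ρ b w * grp ρ g := by
  have h : wordBasis ρ b (g, w) =
      SkewMonoidAlgebra.single g (tensorBasis ρ b (FreeMonoid.ofList w)) := by
    rw [wordBasis, Module.Basis.reindex_apply, Module.Basis.map_apply]
    change (SkewMonoidAlgebra.coeffLinearEquiv (S := ℂ) (k := TensorAlg ρ) (G := G)).symm
      ((Finsupp.basis fun _ : G => tensorBasis ρ b) ⟨g, FreeMonoid.ofList w⟩) = _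
    rw [Finsupp.coe_basis]
    rfl
  rw [h, tensorBasis_apply, ← single_one_mul_grp, single_one_prod, mon, List.map_map]
  rfl

/-! ### The degree filtration -/

theorem tensorDegLE_mono {d e : ℕ} (h : d ≤ e) : tensorDegLE ρ d ≤ tensorDegLE ρ e :=
  Submodule.span_mono fun _ ⟨g, i, t, hi, ht, hx⟩ => ⟨g, i, t, hi.trans h, ht, hx⟩

theorem prevStep_le (d : ℕ) : prevStep (tensorDegLE ρ) d ≤ tensorDegLE ρ d := by
  cases d with
  | zero => exact bot_le
  | succ d => exact tensorDegLE_mono ρ d.le_succ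

theorem mul_mem_of_le {i j d : ℕ} (h : i + j ≤ d) {x y : TensorSkew ρ}
    (hx : x ∈ tensorDegLE ρ i) (hy : y ∈ tensorDegLE ρ j) : x * y ∈ tensorDegLE ρ d :=
  tensorDegLE_mono ρ h (tensorDegLE_mul ρ hx hy)

theorem grp_mem (g : G) : grp ρ g ∈ tensorDegLE ρ 0 :=
  Submodule.subset_span ⟨g, 0, 1, le_rfl, by rw [pow_zero]; exact Submodule.one_le.1 le_rfl, rfl⟩

theorem one_mem_tensorDegLE (d : ℕ) : (1 : TensorSkew ρ) ∈ tensorDegLE ρ d :=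
  tensorDegLE_mono ρ (Nat.zero_le d) (grp_mem ρ 1)

theorem vec_mem (v : V) : vec ρ v ∈ tensorDegLE ρ 1 :=
  Submodule.subset_span ⟨1, 1, tι ρ v, le_rfl, by rw [pow_one]; exact ⟨v, rfl⟩, rfl⟩

theorem mul_grp_mem {d : ℕ} {x : TensorSkew ρ} (hx : x ∈ tensorDegLE ρ d) (g : G) :
    x * grp ρ g ∈ tensorDegLE ρ d := by
  have h := tensorDegLE_mul ρ hx (grp_mem ρ g)
  rwa [add_zero] at h

theorem mon_mem (w : List ι) : mon ρ b w ∈ tensorDegLE ρ w.length := by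
  induction w with
  | nil => exact one_mem_tensorDegLE ρ 0
  | cons i w ih =>
    rw [mon_cons, List.length_cons, add_comm]
    exact tensorDegLE_mul ρ (vec_mem ρ _) ih

theorem single_mem_span_words {i : ℕ} {t : TensorAlg ρ} (ht : t ∈ LinearMap.range (tι ρ) ^ i)
    (g : G) : (SkewMonoidAlgebra.single g t : TensorSkew ρ) ∈
      Submodule.span ℂ {x | ∃ w : List ι, w.length = i ∧ x = mon ρ b w * grp ρ g} := by
  induction ht using Submodule.pow_induction_on_left' with
  | algebraMap c =>
    rw [single_algebraMap]
    exact Submodule.smul_mem _ _ (Submodule.subset_span ⟨[], rfl, by rw [mon_nil, one_mul]⟩)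
  | add x y i hx hy ihx ihy =>
    rw [SkewMonoidAlgebra.single_add]
    exact add_mem ihx ihy
  | mem_mul m hm i x hx ih =>
    obtain ⟨v, rfl⟩ := hm
    have h : (SkewMonoidAlgebra.single g (tι ρ v * x) : TensorSkew ρ) =
        LinearMap.mulLeft ℂ (vec ρ v) (SkewMonoidAlgebra.single g x) := by
      rw [LinearMap.mulLeft_apply, vec, single_mul_single', tensorAct_one, one_mul,
        AlgHom.id_apply]
    rw [h, ← b.linearCombination_repr v, Finsupp.linearCombination_apply, Finsupp.sum]
    rw [LinearMap.mulLeft_apply, vec_sum, Finset.sum_mul]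
    refine Submodule.sum_mem _ fun k _ => ?_
    rw [vec_smul, smul_mul_assoc]
    refine Submodule.smul_mem _ _ ?_
    have h2 := Submodule.mem_map_of_mem (f := LinearMap.mulLeft ℂ (vec ρ (b k))) ih
    rw [Submodule.map_span] at h2
    refine Submodule.span_mono ?_ h2
    rintro _ ⟨_, ⟨w, hw, rfl⟩, rfl⟩
    exact ⟨k :: w, by simp [hw], by rw [LinearMap.mulLeft_apply, mon_cons, mul_assoc]⟩

/-- Expanding each tensor factor in a basis of `V` turns tensors of degree i into words of length i,
so claims about the filtration can be checked on words. -/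
theorem tensorDegLE_eq_span (d : ℕ) : tensorDegLE ρ d =
    Submodule.span ℂ {x | ∃ (g : G) (w : List ι), w.length ≤ d ∧ x = mon ρ b w * grp ρ g} := by
  refine le_antisymm (Submodule.span_le.2 ?_) (Submodule.span_le.2 ?_)
  · rintro _ ⟨g, i, t, hi, ht, rfl⟩
    refine Submodule.span_mono ?_ (single_mem_span_words ρ b ht g)
    rintro _ ⟨w, hw, rfl⟩
    exact ⟨g, w, hw ▸ hi, rfl⟩
  · rintro _ ⟨g, w, hw, rfl⟩
    exact mul_grp_mem ρ (tensorDegLE_mono ρ hw (mon_mem ρ b w)) g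

theorem exists_mem_tensorDegLE (z : TensorSkew ρ) : ∃ d, z ∈ tensorDegLE ρ d := by
  let b := Module.Basis.ofVectorSpace ℂ V
  have h : z ∈ Submodule.span ℂ (Set.range (wordBasis ρ b)) := by
    rw [Module.Basis.span_eq]; trivial
  induction h using Submodule.span_induction with
  | mem x hx =>
    obtain ⟨⟨g, w⟩, rfl⟩ := hx
    exact ⟨w.length, by rw [wordBasis_apply]; exact mul_grp_mem ρ (mon_mem ρ b w) g⟩
  | zero => exact ⟨0, zero_mem _⟩
  | add x y _ _ hx hy =>
    obtain ⟨d, hd⟩ := hx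
    obtain ⟨e, he⟩ := hy
    exact ⟨max d e, add_mem (tensorDegLE_mono ρ (le_max_left _ _) hd)
      (tensorDegLE_mono ρ (le_max_right _ _) he)⟩
  | smul c x _ hx =>
    obtain ⟨d, hd⟩ := hx
    exact ⟨d, Submodule.smul_mem _ _ hd⟩

/-- There are finitely many words of bounded length in a finite alphabet. This finiteness is what
allows an abstract graded isomorphism to be exploited by counting dimensions. -/
instance finiteDimensional_tensorDegLE [Finite G] [FiniteDimensional ℂ V] (d : ℕ) :
    FiniteDimensional ℂ (tensorDegLE ρ d) := by
  rw [tensorDegLE_eq_span ρ (Module.finBasis ℂ V) d]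
  refine FiniteDimensional.span_of_finite ℂ ?_
  have h : (Set.univ ×ˢ {w : List (Fin (Module.finrank ℂ V)) | w.length ≤ d} :
      Set (G × List (Fin (Module.finrank ℂ V)))).Finite :=
    Set.finite_univ.prod (List.finite_length_le _ d)
  refine (h.image fun p => mon ρ (Module.finBasis ℂ V) p.2 * grp ρ p.1).subset ?_
  rintro _ ⟨g, w, hw, rfl⟩
  exact ⟨(g, w), ⟨trivial, hw⟩, rfl⟩

end SkewBasics

/-! ### Monomials in S(V)#G, and symbols of elements of T(V)#G. -/

section Symbols

variable {G V : Type*} [Group G] [AddCommGroup V] [Module ℂ V] (ρ : Representation ℂ G V)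
variable {ι : Type*} (b : Module.Basis ι ℂ V)

/-! ### The graded algebra `S(V) # G` -/

theorem symmetricAlgebra_basis_cons [DecidableEq ι] (i : ι) (μ : Multiset ι) :
    b.symmetricAlgebra (Multiset.toFinsupp (i ::ₘ μ)) =
      SymmetricAlgebra.ι ℂ V (b i) * b.symmetricAlgebra (Multiset.toFinsupp μ) := by
  change (SymmetricAlgebra.equivMvPolynomial b).symm (MvPolynomial.basisMonomials ι ℂ _) =
    _ * (SymmetricAlgebra.equivMvPolynomial b).symm (MvPolynomial.basisMonomials ι ℂ _)
  rw [← SymmetricAlgebra.equivMvPolynomial_symm_X, ← map_mul]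
  congr 1
  rw [MvPolynomial.coe_basisMonomials, MvPolynomial.X, MvPolynomial.monomial_mul, mul_one,
    ← Multiset.singleton_add, map_add, Multiset.toFinsupp_singleton]

/-- The basis of `S(V)` formed by monomials. -/
def monomialBasis : Module.Basis (ι →₀ ℕ) ℂ (SymAlg ρ) := b.symmetricAlgebra

theorem monomialBasis_toFinsupp [DecidableEq ι] (μ : Multiset ι) :
    monomialBasis ρ b (Multiset.toFinsupp μ) = (μ.map fun i => sι ρ (b i)).prod := by
  induction μ using Multiset.induction with
  | empty =>
    rw [Multiset.map_zero, Multiset.prod_zero, map_zero]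
    change (SymmetricAlgebra.equivMvPolynomial b).symm (MvPolynomial.basisMonomials ι ℂ 0) = _
    rw [MvPolynomial.coe_basisMonomials]
    exact map_one (SymmetricAlgebra.equivMvPolynomial b).symm
  | cons i μ ih =>
    rw [Multiset.map_cons, Multiset.prod_cons, ← ih]
    exact symmetricAlgebra_basis_cons b i μ

/-- The basis of `S(V) # G` formed by the elements `m g` for monomials `m` and `g ∈ G`. -/
def symBasis : Module.Basis (G × Multiset ι) ℂ (SymSkew ρ) :=
  letI := Classical.decEq ι
  (((Finsupp.basis fun _ : G => monomialBasis ρ b).map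
    (SkewMonoidAlgebra.coeffLinearEquiv (S := ℂ) (k := SymAlg ρ) (G := G)).symm).reindex
    ((Equiv.sigmaEquivProd G (ι →₀ ℕ)).trans
      (Equiv.prodCongr (Equiv.refl G) Multiset.toFinsupp.symm.toEquiv)))

theorem symBasis_apply (g : G) (μ : Multiset ι) :
    symBasis ρ b (g, μ) = SkewMonoidAlgebra.single g (μ.map fun i => sι ρ (b i)).prod := by
  let := Classical.decEq ι
  rw [← monomialBasis_toFinsupp, symBasis, Module.Basis.reindex_apply, Module.Basis.map_apply]
  change (SkewMonoidAlgebra.coeffLinearEquiv (S := ℂ) (k := SymAlg ρ) (G := G)).symm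
    ((Finsupp.basis fun _ : G => monomialBasis ρ b) ⟨g, Multiset.toFinsupp μ⟩) = _
  rw [Finsupp.coe_basis]
  rfl

/-- The projection of `S(V) # G` onto its component of degree `d`. -/
def symProj (d : ℕ) : SymSkew ρ →ₗ[ℂ] SymSkew ρ :=
  let b := Module.Basis.ofVectorSpace ℂ V
  (symBasis ρ b).constr ℂ fun p => if p.2.card = d then symBasis ρ b p else 0

theorem single_mem_span_monomials {i : ℕ} {t : SymAlg ρ}
    (ht : t ∈ LinearMap.range (sι ρ) ^ i) (g : G) :
    (SkewMonoidAlgebra.single g t : SymSkew ρ) ∈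
      Submodule.span ℂ {x | ∃ μ : Multiset ι, μ.card = i ∧ x = symBasis ρ b (g, μ)} := by
  induction ht using Submodule.pow_induction_on_left' with
  | algebraMap c =>
    rw [Algebra.algebraMap_eq_smul_one, ← SkewMonoidAlgebra.smul_single]
    exact Submodule.smul_mem _ _ (Submodule.subset_span ⟨0, rfl, by
      rw [symBasis_apply, Multiset.map_zero, Multiset.prod_zero]⟩)
  | add x y i hx hy ihx ihy =>
    rw [SkewMonoidAlgebra.single_add]
    exact add_mem ihx ihy
  | mem_mul m hm i x hx ih =>
    obtain ⟨v, rfl⟩ := hm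
    have key : ∀ (u : V) (y : SymAlg ρ), (SkewMonoidAlgebra.single g (sι ρ u * y) : SymSkew ρ) =
        LinearMap.mulLeft ℂ (SkewMonoidAlgebra.single 1 (sι ρ u))
          (SkewMonoidAlgebra.single g y) := by
      intro u y
      rw [LinearMap.mulLeft_apply, sym_single_mul_single, symAct_one, one_mul, AlgHom.id_apply]
    rw [← b.linearCombination_repr v, Finsupp.linearCombination_apply, Finsupp.sum, map_sum,
      Finset.sum_mul]
    have hs : ∀ f : ι → SymAlg ρ, ∀ s : Finset ι,
        (SkewMonoidAlgebra.single g (∑ k ∈ s, f k) : SymSkew ρ) =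
          ∑ k ∈ s, SkewMonoidAlgebra.single g (f k) :=
      fun f s => map_sum (SkewMonoidAlgebra.singleAddHom g) f s
    rw [hs]
    refine Submodule.sum_mem _ fun k _ => ?_
    rw [map_smul, smul_mul_assoc, ← SkewMonoidAlgebra.smul_single]
    refine Submodule.smul_mem _ _ ?_
    rw [key]
    have h2 := Submodule.mem_map_of_mem (f := LinearMap.mulLeft ℂ
      (SkewMonoidAlgebra.single 1 (sι ρ (b k)) : SymSkew ρ)) ih
    rw [Submodule.map_span] at h2
    refine Submodule.span_mono ?_ h2
    rintro _ ⟨_, ⟨w, hw, rfl⟩, rfl⟩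
    refine ⟨k ::ₘ w, by simp [hw], ?_⟩
    rw [symBasis_apply, symBasis_apply, ← key, Multiset.map_cons, Multiset.prod_cons]

theorem symDeg_eq_span (d : ℕ) : symDeg ρ d = Submodule.span ℂ
    {x | ∃ (g : G) (μ : Multiset ι), μ.card = d ∧ x = symBasis ρ b (g, μ)} := by
  refine le_antisymm (Submodule.span_le.2 ?_) (Submodule.span_le.2 ?_)
  · rintro _ ⟨g, s, hs, rfl⟩
    refine Submodule.span_mono ?_ (single_mem_span_monomials ρ b hs g)
    rintro _ ⟨μ, hμ, rfl⟩
    exact ⟨g, μ, hμ, rfl⟩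
  · rintro _ ⟨g, μ, hμ, rfl⟩
    refine Submodule.subset_span ⟨g, _, ?_, symBasis_apply ρ b g μ⟩
    subst hμ
    induction μ using Multiset.induction with
    | empty =>
      rw [Multiset.card_zero, pow_zero, Multiset.map_zero, Multiset.prod_zero]
      exact Submodule.one_le.1 le_rfl
    | cons i μ ih =>
      rw [Multiset.map_cons, Multiset.prod_cons, Multiset.card_cons, pow_succ']
      exact Submodule.mul_mem_mul ⟨b i, rfl⟩ ih

/-- The projection is defined through a chosen basis of `V`, but each homogeneous component is
spanned by the basis monomials of that degree, so the choice is invisible here. -/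
theorem symProj_of_mem {d e : ℕ} {y : SymSkew ρ} (hy : y ∈ symDeg ρ e) :
    symProj ρ d y = if e = d then y else 0 := by
  rw [symDeg_eq_span ρ (Module.Basis.ofVectorSpace ℂ V)] at hy
  induction hy using Submodule.span_induction with
  | mem x hx =>
    obtain ⟨g, μ, hμ, rfl⟩ := hx
    rw [symProj, Module.Basis.constr_basis, hμ]
  | zero => simp
  | add x y _ _ hx hy => rw [map_add, hx, hy]; split_ifs <;> simp
  | smul c x _ hx => rw [map_smul, hx]; split_ifs <;> simp

theorem symProj_self {d : ℕ} {y : SymSkew ρ} (hy : y ∈ symDeg ρ d) : symProj ρ d y = y := by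
  rw [symProj_of_mem ρ hy, if_pos rfl]

theorem symProj_ne {d e : ℕ} (h : e ≠ d) {y : SymSkew ρ} (hy : y ∈ symDeg ρ e) :
    symProj ρ d y = 0 := by
  rw [symProj_of_mem ρ hy, if_neg h]

theorem symProj_mem (d : ℕ) (y : SymSkew ρ) : symProj ρ d y ∈ symDeg ρ d := by
  let b := Module.Basis.ofVectorSpace ℂ V
  have h : y ∈ Submodule.span ℂ (Set.range (symBasis ρ b)) := by
    rw [Module.Basis.span_eq]; trivial
  induction h using Submodule.span_induction with
  | mem x hx =>
    obtain ⟨p, rfl⟩ := hx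
    rw [symProj, Module.Basis.constr_basis]
    split_ifs with hp
    · rw [symDeg_eq_span ρ b]
      exact Submodule.subset_span ⟨p.1, p.2, hp, rfl⟩
    · exact zero_mem _
  | zero => rw [map_zero]; exact zero_mem _
  | add x y _ _ hx hy => rw [map_add]; exact add_mem hx hy
  | smul c x _ hx => rw [map_smul]; exact Submodule.smul_mem _ _ hx

theorem symAct_mem_pow (g : G) {i : ℕ} {t : SymAlg ρ}
    (ht : t ∈ LinearMap.range (sι ρ) ^ i) : symAct ρ g t ∈ LinearMap.range (sι ρ) ^ i := by
  have h : (LinearMap.range (sι ρ)).map (symAct ρ g).toLinearMap ≤ LinearMap.range (sι ρ) := by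
    rintro _ ⟨_, ⟨v, rfl⟩, rfl⟩
    exact ⟨ρ g v, (symAct_ι ρ g v).symm⟩
  have h' := Submodule.mem_map_of_mem (f := (symAct ρ g).toLinearMap) ht
  rw [Submodule.map_pow] at h'
  exact pow_le_pow_left' h i h'

theorem symDeg_mul {i j : ℕ} {x y : SymSkew ρ} (hx : x ∈ symDeg ρ i) (hy : y ∈ symDeg ρ j) :
    x * y ∈ symDeg ρ (i + j) := by
  have key : symDeg ρ i * symDeg ρ j ≤ symDeg ρ (i + j) := by
    rw [symDeg, symDeg, Submodule.span_mul_span]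
    refine Submodule.span_le.2 ?_
    rintro _ ⟨_, ⟨g, s, hs, rfl⟩, _, ⟨h, t, ht, rfl⟩, rfl⟩
    refine Submodule.subset_span ⟨g * h, s * symAct ρ g t, ?_, sym_single_mul_single ρ g h s t⟩
    rw [pow_add]
    exact Submodule.mul_mem_mul hs (symAct_mem_pow ρ g ht)
  exact key (Submodule.mul_mem_mul hx hy)

/-! ### The symbol of an element of `T(V) # G` -/

/-- The quotient map `T(V) → S(V)`. -/
def tensorToSym : TensorAlg ρ →ₐ[ℂ] SymAlg ρ := TensorAlgebra.lift ℂ (sι ρ)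

theorem tensorToSym_ι (v : V) : tensorToSym ρ (tι ρ v) = sι ρ v :=
  TensorAlgebra.lift_ι_apply (A := SymAlg ρ) (sι ρ) v

theorem tensorToSym_act (g : G) (t : TensorAlg ρ) :
    tensorToSym ρ (tensorAct ρ g t) = symAct ρ g (tensorToSym ρ t) := by
  have h : (tensorToSym ρ).comp (tensorAct ρ g) = (symAct ρ g).comp (tensorToSym ρ) :=
    tensorAlg_hom_ext ρ fun v => by
      rw [AlgHom.comp_apply, AlgHom.comp_apply, tensorAct_ι, tensorToSym_ι, tensorToSym_ι,
        symAct_ι]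
  exact DFunLike.congr_fun h t

theorem tensorToSym_mem_pow {i : ℕ} {t : TensorAlg ρ} (ht : t ∈ LinearMap.range (tι ρ) ^ i) :
    tensorToSym ρ t ∈ LinearMap.range (sι ρ) ^ i := by
  have h : (LinearMap.range (tι ρ)).map (tensorToSym ρ).toLinearMap ≤
      LinearMap.range (sι ρ) := by
    rintro _ ⟨_, ⟨v, rfl⟩, rfl⟩
    exact ⟨v, (tensorToSym_ι ρ v).symm⟩
  have h' := Submodule.mem_map_of_mem (f := (tensorToSym ρ).toLinearMap) ht
  rw [Submodule.map_pow] at h'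
  exact pow_le_pow_left' h i h'

/-- The inclusion `S(V) → S(V) # G`. -/
def symSingleOne : SymAlg ρ →ₐ[ℂ] SymSkew ρ where
  __ := SkewMonoidAlgebra.singleOneRingHom (k := SymAlg ρ) (G := G)
  commutes' _ := rfl

/-- The quotient map `T(V) # G → S(V) # G`. -/
def skewToSym : TensorSkew ρ →ₐ[ℂ] SymSkew ρ :=
  SkewMonoidAlgebra.liftNCAlgHom ((symSingleOne ρ).comp (tensorToSym ρ))
    (SkewMonoidAlgebra.of (SymAlg ρ) G) (by
      intro t g
      change (SkewMonoidAlgebra.single 1 (tensorToSym ρ (tensorAct ρ g t)) : SymSkew ρ) *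
        SkewMonoidAlgebra.single g 1 = SkewMonoidAlgebra.single g 1 *
          SkewMonoidAlgebra.single 1 (tensorToSym ρ t)
      rw [sym_single_mul_single, sym_single_mul_single, tensorToSym_act, map_one, one_mul, mul_one,
        one_mul, mul_one])

theorem skewToSym_single (g : G) (t : TensorAlg ρ) :
    skewToSym ρ (SkewMonoidAlgebra.single g t) =
      SkewMonoidAlgebra.single g (tensorToSym ρ t) := by
  have h : skewToSym ρ (SkewMonoidAlgebra.single g t) =
      (SkewMonoidAlgebra.single 1 (tensorToSym ρ t) : SymSkew ρ) *
        SkewMonoidAlgebra.single g 1 :=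
    SkewMonoidAlgebra.liftNC_single _ _ _ _
  rw [h, sym_single_mul_single, map_one, mul_one, one_mul]

/-- The component of degree `d` of the image in `S(V) # G` of an element of `T(V) # G`. -/
def symbol (d : ℕ) : TensorSkew ρ →ₗ[ℂ] SymSkew ρ :=
  (symProj ρ d).comp (skewToSym ρ).toLinearMap

theorem symbol_apply (d : ℕ) (z : TensorSkew ρ) :
    symbol ρ d z = symProj ρ d (skewToSym ρ z) := rfl

theorem symbol_mem (d : ℕ) (z : TensorSkew ρ) : symbol ρ d z ∈ symDeg ρ d := symProj_mem ρ d _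

theorem skewToSym_mem {i : ℕ} {t : TensorAlg ρ} (ht : t ∈ LinearMap.range (tι ρ) ^ i) (g : G) :
    skewToSym ρ (SkewMonoidAlgebra.single g t) ∈ symDeg ρ i :=
  Submodule.subset_span ⟨g, _, tensorToSym_mem_pow ρ ht, skewToSym_single ρ g t⟩

theorem symbol_eq_zero {d e : ℕ} (h : e < d) {z : TensorSkew ρ} (hz : z ∈ tensorDegLE ρ e) :
    symbol ρ d z = 0 := by
  induction hz using Submodule.span_induction with
  | mem x hx =>
    obtain ⟨g, i, t, hi, ht, rfl⟩ := hx
    exact symProj_ne ρ (by omega) (skewToSym_mem ρ ht g)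
  | zero => exact map_zero _
  | add x y _ _ hx hy => rw [map_add, hx, hy, add_zero]
  | smul c x _ hx => rw [map_smul, hx, smul_zero]

theorem symbol_eq_zero_of_prevStep {d : ℕ} {z : TensorSkew ρ}
    (hz : z ∈ prevStep (tensorDegLE ρ) d) : symbol ρ d z = 0 := by
  cases d with
  | zero =>
    have h : z = 0 := hz
    rw [h, map_zero]
  | succ d => exact symbol_eq_zero ρ d.lt_succ_self hz

/-- T(V)#G → S(V)#G is a graded homomorphism, so only the top components of the factors reach degree
i + j. This makes the symbol maps assemble to an algebra map on the associated graded algebra. -/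
theorem symbol_mul {i j : ℕ} {x y : TensorSkew ρ} (hx : x ∈ tensorDegLE ρ i)
    (hy : y ∈ tensorDegLE ρ j) : symbol ρ (i + j) (x * y) = symbol ρ i x * symbol ρ j y := by
  induction hx using Submodule.span_induction with
  | mem x hx =>
    obtain ⟨g, k, s, hk, hs, rfl⟩ := hx
    induction hy using Submodule.span_induction with
    | mem y hy =>
      obtain ⟨h, l, t, hl, ht, rfl⟩ := hy
      have h1 := skewToSym_mem ρ hs g
      have h2 := skewToSym_mem ρ ht h
      rw [symbol_apply, symbol_apply, symbol_apply, map_mul, symProj_of_mem ρ h1,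
        symProj_of_mem ρ h2, symProj_of_mem ρ (symDeg_mul ρ h1 h2)]
      by_cases h3 : k = i
      · by_cases h4 : l = j
        · rw [if_pos h3, if_pos h4, if_pos (by omega)]
        · rw [if_neg h4, if_neg (by omega), mul_zero]
      · rw [if_neg h3, if_neg (by omega), zero_mul]
    | zero => rw [mul_zero, map_zero, map_zero, mul_zero]
    | add x y _ _ hx hy => rw [mul_add, map_add, map_add, hx, hy, mul_add]
    | smul c x _ hx => rw [mul_smul_comm, map_smul, map_smul, hx, mul_smul_comm]
  | zero => rw [zero_mul, map_zero, map_zero, zero_mul]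
  | add x y _ _ hx hy => rw [add_mul, map_add, map_add, hx, hy, add_mul]
  | smul c x _ hx => rw [smul_mul_assoc, map_smul, map_smul, hx, smul_mul_assoc]

theorem skewToSym_mon_mul_grp (g : G) (w : List ι) :
    skewToSym ρ (mon ρ b w * grp ρ g) = symBasis ρ b (g, (w : Multiset ι)) := by
  induction w with
  | nil =>
    rw [mon_nil, one_mul, grp, skewToSym_single, map_one, symBasis_apply]
    rfl
  | cons i w ih =>
    rw [mon_cons, mul_assoc, map_mul, ih, vec, skewToSym_single, symBasis_apply, symBasis_apply,
      sym_single_mul_single, symAct_one, one_mul, tensorToSym_ι, ← Multiset.cons_coe,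
      Multiset.map_cons, Multiset.prod_cons]
    rfl

theorem symbol_mon_mul_grp (d : ℕ) (g : G) (w : List ι) :
    symbol ρ d (mon ρ b w * grp ρ g) =
      if w.length = d then symBasis ρ b (g, (w : Multiset ι)) else 0 := by
  rw [symbol_apply, skewToSym_mon_mul_grp]
  refine symProj_of_mem ρ ?_
  rw [symDeg_eq_span ρ b]
  exact Submodule.subset_span ⟨g, w, rfl, rfl⟩

theorem exists_symbol_eq {d : ℕ} {y : SymSkew ρ} (hy : y ∈ symDeg ρ d) :
    ∃ z ∈ tensorDegLE ρ d, symbol ρ d z = y := by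
  let b := Module.Basis.ofVectorSpace ℂ V
  have h : symDeg ρ d ≤ (tensorDegLE ρ d).map (symbol ρ d) := by
    rw [symDeg_eq_span ρ b, Submodule.span_le]
    rintro _ ⟨g, μ, hμ, rfl⟩
    refine ⟨mon ρ b μ.toList * grp ρ g, mul_grp_mem ρ ?_ g, ?_⟩
    · rw [← hμ, ← Multiset.length_toList]
      exact mon_mem ρ b _
    · rw [symbol_mon_mul_grp, Multiset.length_toList, if_pos hμ, Multiset.coe_toList]
  exact h hy

end Symbols

/-! ### The ideal of relations, filtered by visible degree, and its symbols. -/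

section PBWSymbols

variable {G V : Type*} [Group G] [AddCommGroup V] [Module ℂ V] [Fintype G]
variable (ρ : Representation ℂ G V) (κL : LinCochain G V) (κC : ConstCochain G V)

/-! ### The relators -/

theorem linVal_eq (v w : V) :
    linVal ρ κL v w = ∑ g, vec ρ (κL g ![v, w]) * grp ρ g :=
  Finset.sum_congr rfl fun _ _ => (vec_mul_grp ρ _ _).symm

theorem constVal_eq (v w : V) : constVal ρ κC v w = ∑ g, κC g ![v, w] • grp ρ g :=
  Finset.sum_congr rfl fun _ _ => single_algebraMap ρ _ _

/-- An alternating map in two variables, as a bilinear map. -/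
def altBilin {N : Type*} [AddCommGroup N] [Module ℂ N] (f : V [⋀^Fin 2]→ₗ[ℂ] N) :
    V →ₗ[ℂ] V →ₗ[ℂ] N :=
  have h0 : ∀ u v w : V, Function.update ![u, w] 0 v = ![v, w] := fun u v w => by
    ext i; fin_cases i <;> rfl
  have h1 : ∀ u v w : V, Function.update ![u, w] 1 v = ![u, v] := fun u v w => by
    ext i; fin_cases i <;> rfl
  LinearMap.mk₂ ℂ (fun v w => f ![v, w])
    (fun u v w => by simpa only [h0] using f.map_update_add ![u, w] 0 u v)
    (fun c v w => by simpa only [h0] using f.map_update_smul ![v, w] 0 c v)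
    (fun v u w => by simpa only [h1] using f.map_update_add ![v, u] 1 u w)
    (fun c v w => by simpa only [h1] using f.map_update_smul ![v, w] 1 c w)

theorem altBilin_apply {N : Type*} [AddCommGroup N] [Module ℂ N] (f : V [⋀^Fin 2]→ₗ[ℂ] N)
    (v w : V) : altBilin f v w = f ![v, w] := rfl

theorem alt_self {N : Type*} [AddCommGroup N] [Module ℂ N] (f : V [⋀^Fin 2]→ₗ[ℂ] N) (v : V) :
    f ![v, v] = 0 := f.map_eq_zero_of_eq ![v, v] (i := 0) (j := 1) rfl (by decide)

theorem alt_swap {N : Type*} [AddCommGroup N] [Module ℂ N] (f : V [⋀^Fin 2]→ₗ[ℂ] N) (v w : V) :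
    f ![v, w] = -f ![w, v] := by
  have h := alt_self f (v + w)
  rw [← altBilin_apply] at h
  simp only [map_add, LinearMap.add_apply, altBilin_apply, alt_self, zero_add, add_zero] at h
  exact eq_neg_of_add_eq_zero_right h

/-- The value `κᴸ(v, w) + κᶜ(v, w)` of the parameter map, as a bilinear map to `T(V) # G`. -/
def kap : V →ₗ[ℂ] V →ₗ[ℂ] TensorSkew ρ :=
  ∑ g, ((altBilin (κL g)).compr₂ ((LinearMap.mulRight ℂ (grp ρ g)).comp (vecL ρ)) +
    (altBilin (κC g)).compr₂ (LinearMap.toSpanSingleton ℂ _ (grp ρ g)))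

theorem kap_apply (v w : V) : kap ρ κL κC v w =
    ∑ g, (vec ρ (κL g ![v, w]) * grp ρ g + κC g ![v, w] • grp ρ g) := by
  rw [kap, LinearMap.sum_apply, LinearMap.sum_apply]
  rfl

theorem kap_eq (v w : V) : kap ρ κL κC v w = linVal ρ κL v w + constVal ρ κC v w := by
  rw [kap_apply, linVal_eq, constVal_eq, Finset.sum_add_distrib]

theorem kap_mem (v w : V) : kap ρ κL κC v w ∈ tensorDegLE ρ 1 := by
  rw [kap_apply]
  refine Submodule.sum_mem _ fun g _ => add_mem (mul_grp_mem ρ (vec_mem ρ _) g) ?_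
  exact Submodule.smul_mem _ _ (tensorDegLE_mono ρ (Nat.zero_le 1) (grp_mem ρ g))

theorem kap_swap (v w : V) : kap ρ κL κC v w = -kap ρ κL κC w v := by
  rw [kap_apply, kap_apply, ← Finset.sum_neg_distrib]
  refine Finset.sum_congr rfl fun g _ => ?_
  rw [alt_swap (κL g), alt_swap (κC g), vec_neg, neg_mul, neg_smul, neg_add]

theorem kap_self (v : V) : kap ρ κL κC v v = 0 := by
  rw [kap_apply]
  refine Finset.sum_eq_zero fun g _ => ?_
  rw [alt_self, alt_self, vec_zero, zero_mul, zero_smul, add_zero]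

/-- The relator `v w - w v - κᴸ(v, w) - κᶜ(v, w)`. -/
def rel (v w : V) : TensorSkew ρ :=
  vec ρ v * vec ρ w - vec ρ w * vec ρ v - kap ρ κL κC v w

theorem mem_relators (v w : V) : rel ρ κL κC v w ∈ relators ρ κL κC :=
  ⟨v, w, by rw [rel, kap_eq, sub_add_eq_sub_sub]⟩

theorem eq_rel_of_mem {p : TensorSkew ρ} (hp : p ∈ relators ρ κL κC) :
    ∃ v w, p = rel ρ κL κC v w := by
  obtain ⟨v, w, rfl⟩ := hp
  exact ⟨v, w, by rw [rel, kap_eq, sub_add_eq_sub_sub]⟩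

theorem rel_mem (v w : V) : rel ρ κL κC v w ∈ tensorDegLE ρ 2 :=
  sub_mem (sub_mem (mul_mem_of_le ρ one_add_one_eq_two.le (vec_mem ρ v) (vec_mem ρ w))
    (mul_mem_of_le ρ one_add_one_eq_two.le (vec_mem ρ w) (vec_mem ρ v)))
    (tensorDegLE_mono ρ one_le_two (kap_mem ρ κL κC v w))

/-- The part of the ideal of relations which is visibly of degree at most `d`. -/
def relSpan (d : ℕ) : Submodule ℂ (TensorSkew ρ) :=
  Submodule.span ℂ {z | ∃ (i j : ℕ) (x y : TensorSkew ρ) (v w : V), i + 2 + j ≤ d ∧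
    x ∈ tensorDegLE ρ i ∧ y ∈ tensorDegLE ρ j ∧ z = x * rel ρ κL κC v w * y}

theorem mul_rel_mul_mem {d i j : ℕ} (h : i + 2 + j ≤ d) {x y : TensorSkew ρ}
    (hx : x ∈ tensorDegLE ρ i) (hy : y ∈ tensorDegLE ρ j) (v w : V) :
    x * rel ρ κL κC v w * y ∈ relSpan ρ κL κC d :=
  Submodule.subset_span ⟨i, j, x, y, v, w, h, hx, hy, rfl⟩

theorem relSpan_mono {d e : ℕ} (h : d ≤ e) : relSpan ρ κL κC d ≤ relSpan ρ κL κC e :=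
  Submodule.span_mono fun _ ⟨i, j, x, y, v, w, hd, hz⟩ => ⟨i, j, x, y, v, w, hd.trans h, hz⟩

theorem mul_mem_relSpan {d i j e : ℕ} (h : i + d + j ≤ e) {x z y : TensorSkew ρ}
    (hx : x ∈ tensorDegLE ρ i) (hz : z ∈ relSpan ρ κL κC d) (hy : y ∈ tensorDegLE ρ j) :
    x * z * y ∈ relSpan ρ κL κC e := by
  induction hz using Submodule.span_induction with
  | mem z hz =>
    obtain ⟨k, l, s, t, v, w, hd, hs, ht, rfl⟩ := hz
    have := mul_rel_mul_mem ρ κL κC (show (i + k) + 2 + (l + j) ≤ e by omega)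
      (tensorDegLE_mul ρ hx hs) (tensorDegLE_mul ρ ht hy) v w
    simpa only [mul_assoc] using this
  | zero => rw [mul_zero, zero_mul]; exact zero_mem _
  | add a b _ _ ha hb => rw [mul_add, add_mul]; exact add_mem ha hb
  | smul c a _ ha => rw [mul_smul_comm, smul_mul_assoc]; exact Submodule.smul_mem _ _ ha

theorem relSpan_le (d : ℕ) : relSpan ρ κL κC d ≤ tensorDegLE ρ d := by
  refine Submodule.span_le.2 ?_
  rintro _ ⟨i, j, x, y, v, w, h, hx, hy, rfl⟩
  exact tensorDegLE_mono ρ h (tensorDegLE_mul ρ (tensorDegLE_mul ρ hx (rel_mem ρ κL κC v w)) hy)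

theorem relSpan_eq_bot {d : ℕ} (h : d < 2) : relSpan ρ κL κC d = ⊥ := by
  refine Submodule.span_eq_bot.2 ?_
  rintro _ ⟨i, j, _, _, _, _, h', _⟩
  omega

theorem toH_rel (v w : V) : toH ρ κL κC (rel ρ κL κC v w) = 0 := by
  have h := RingQuot.mkAlgHom_rel ℂ
    (s := fun p q : TensorSkew ρ => p ∈ relators ρ κL κC ∧ q = 0)
    ⟨mem_relators ρ κL κC v w, rfl⟩
  rw [toH, h, map_zero]

theorem toH_of_mem_relSpan {d : ℕ} {z : TensorSkew ρ} (hz : z ∈ relSpan ρ κL κC d) :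
    toH ρ κL κC z = 0 := by
  induction hz using Submodule.span_induction with
  | mem z hz =>
    obtain ⟨k, l, s, t, v, w, hd, hs, ht, rfl⟩ := hz
    rw [map_mul, map_mul, toH_rel, mul_zero, zero_mul]
  | zero => exact map_zero _
  | add a b _ _ ha hb => rw [map_add, ha, hb, add_zero]
  | smul c a _ ha => rw [map_smul, ha, smul_zero]

/-- The two-sided ideal of relations. -/
def relIdeal : TwoSidedIdeal (TensorSkew ρ) :=
  TwoSidedIdeal.mk' {z | ∃ d, z ∈ relSpan ρ κL κC d}
    ⟨0, zero_mem _⟩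
    (by
      rintro x y ⟨d, hd⟩ ⟨e, he⟩
      exact ⟨max d e, add_mem (relSpan_mono ρ κL κC (le_max_left _ _) hd)
        (relSpan_mono ρ κL κC (le_max_right _ _) he)⟩)
    (by rintro x ⟨d, hd⟩; exact ⟨d, neg_mem hd⟩)
    (by
      rintro x y ⟨d, hd⟩
      obtain ⟨i, hi⟩ := exists_mem_tensorDegLE ρ x
      refine ⟨i + d + 0, ?_⟩
      have := mul_mem_relSpan ρ κL κC le_rfl hi hd (one_mem_tensorDegLE ρ 0)
      rwa [mul_one] at this)
    (by
      rintro x y ⟨d, hd⟩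
      obtain ⟨i, hi⟩ := exists_mem_tensorDegLE ρ y
      refine ⟨0 + d + i, ?_⟩
      have := mul_mem_relSpan ρ κL κC le_rfl (one_mem_tensorDegLE ρ 0) hd hi
      rwa [one_mul] at this)

theorem mem_relIdeal {z : TensorSkew ρ} :
    z ∈ relIdeal ρ κL κC ↔ ∃ d, z ∈ relSpan ρ κL κC d :=
  TwoSidedIdeal.mem_mk' _ _ _ _ _ _ _

/-- The spaces `relSpan d` exhaust a two-sided ideal containing the relators, so the quotient by
that ideal factors through `RingQuot`, and the kernel is no larger than expected. The degree d
needed may exceed the degree of z; controlling it is the PBW problem. -/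
theorem toH_eq_zero_iff {z : TensorSkew ρ} :
    toH ρ κL κC z = 0 ↔ ∃ d, z ∈ relSpan ρ κL κC d := by
  refine ⟨fun h => ?_, fun ⟨d, hd⟩ => toH_of_mem_relSpan ρ κL κC hd⟩
  have hf : ∀ ⦃x y : TensorSkew ρ⦄, (x ∈ relators ρ κL κC ∧ y = 0) →
      (relIdeal ρ κL κC).ringCon.mk' x = (relIdeal ρ κL κC).ringCon.mk' y := by
    rintro x y ⟨hx, rfl⟩
    obtain ⟨v, w, rfl⟩ := eq_rel_of_mem ρ κL κC hx
    rw [map_zero]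
    refine (RingCon.eq _).2 ((TwoSidedIdeal.mem_iff _ _).1 ((mem_relIdeal ρ κL κC).2 ⟨2, ?_⟩))
    have := mul_rel_mul_mem ρ κL κC (show 0 + 2 + 0 ≤ 2 by omega) (one_mem_tensorDegLE ρ 0)
      (one_mem_tensorDegLE ρ 0) v w
    rwa [one_mul, mul_one] at this
  have h2 := congrArg (RingQuot.lift ⟨(relIdeal ρ κL κC).ringCon.mk', hf⟩) h
  have h3 : toH ρ κL κC z = RingQuot.mkRingHom _ z :=
    DFunLike.congr_fun (RingQuot.mkAlgHom_coe ℂ _) z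
  rw [h3, RingQuot.lift_mkRingHom_apply, map_zero,
    ← map_zero (relIdeal ρ κL κC).ringCon.mk'] at h2
  exact (mem_relIdeal ρ κL κC).1 ((TwoSidedIdeal.mem_iff _ _).2 ((RingCon.eq _).1 h2))

/-! ### Symbols of relations -/

omit [Fintype G] in
theorem symbol_linear {v : V} : symbol ρ 1 (vec ρ v) = SkewMonoidAlgebra.single 1 (sι ρ v) := by
  rw [symbol_apply, vec, skewToSym_single, tensorToSym_ι]
  exact symProj_self ρ (Submodule.subset_span ⟨1, _, by rw [pow_one]; exact ⟨v, rfl⟩, rfl⟩)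

omit [Fintype G] in
theorem symbol_vec_mul_vec (v w : V) : symbol ρ 2 (vec ρ v * vec ρ w) =
    SkewMonoidAlgebra.single 1 (sι ρ v * sι ρ w) := by
  rw [symbol_mul ρ (vec_mem ρ v) (vec_mem ρ w) (i := 1) (j := 1), symbol_linear, symbol_linear,
    sym_single_mul_single, symAct_one, one_mul, AlgHom.id_apply]

theorem symbol_rel (v w : V) : symbol ρ 2 (rel ρ κL κC v w) = 0 := by
  rw [rel, map_sub, map_sub, symbol_vec_mul_vec, symbol_vec_mul_vec, mul_comm,
    symbol_eq_zero ρ one_lt_two (kap_mem ρ κL κC v w), sub_self, sub_zero]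

/-- The leading part vw - wv of a relator vanishes in the symmetric algebra, while κ has degree at
most one. -/
theorem symbol_of_mem_relSpan {d : ℕ} {z : TensorSkew ρ} (hz : z ∈ relSpan ρ κL κC d) :
    symbol ρ d z = 0 := by
  induction hz using Submodule.span_induction with
  | mem z hz =>
    obtain ⟨k, l, s, t, v, w, hd, hs, ht, rfl⟩ := hz
    have h1 := tensorDegLE_mul ρ hs (rel_mem ρ κL κC v w)
    rcases hd.lt_or_eq with hd | rfl
    · exact symbol_eq_zero ρ hd (tensorDegLE_mul ρ h1 ht)
    · rw [symbol_mul ρ h1 ht, symbol_mul ρ hs (rel_mem ρ κL κC v w), symbol_rel, mul_zero,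
        zero_mul]
  | zero => exact map_zero _
  | add a b _ _ ha hb => rw [map_add, ha, hb, add_zero]
  | smul c a _ ha => rw [map_smul, ha, smul_zero]

variable {ι : Type*} (b : Module.Basis ι ℂ V)

theorem mem_relSpan_sup_of_lt {d e : ℕ} (h : e < d) {z : TensorSkew ρ}
    (hz : z ∈ tensorDegLE ρ e) : z ∈ relSpan ρ κL κC d ⊔ prevStep (tensorDegLE ρ) d := by
  cases d with
  | zero => omega
  | succ d => exact Submodule.mem_sup_right (tensorDegLE_mono ρ (by omega) hz)

/-- An adjacent transposition of letters costs one relator and a κ-term with one letter fewer;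
adjacent transpositions generate all rearrangements. -/
theorem mul_mon_sub_mon_mul_mem {w w' : List ι} (hw : w.Perm w') :
    ∀ {d i j : ℕ} {x y : TensorSkew ρ}, i + w.length + j ≤ d → x ∈ tensorDegLE ρ i →
      y ∈ tensorDegLE ρ j → x * (mon ρ b w - mon ρ b w') * y ∈
        relSpan ρ κL κC d ⊔ prevStep (tensorDegLE ρ) d := by
  induction hw with
  | nil => intros; rw [sub_self, mul_zero, zero_mul]; exact zero_mem _
  | cons k h ih =>
    intro d i j x y hd hx hy
    rw [mon_cons, mon_cons, ← mul_sub, ← mul_assoc]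
    refine ih ?_ (tensorDegLE_mul ρ hx (vec_mem ρ _)) hy
    rw [List.length_cons] at hd
    omega
  | swap k l w =>
    intro d i j x y hd hx hy
    rw [List.length_cons, List.length_cons] at hd
    have h1 : x * (mon ρ b (l :: k :: w) - mon ρ b (k :: l :: w)) * y =
        x * rel ρ κL κC (b l) (b k) * (mon ρ b w * y) +
          x * kap ρ κL κC (b l) (b k) * (mon ρ b w * y) := by
      simp only [mon_cons, rel]
      noncomm_ring
    have h2 := tensorDegLE_mul ρ (mon_mem ρ b w) hy
    rw [h1]
    refine add_mem (Submodule.mem_sup_left (mul_rel_mul_mem ρ κL κC ?_ hx h2 _ _)) ?_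
    · omega
    · exact mem_relSpan_sup_of_lt ρ κL κC (by omega)
        (tensorDegLE_mul ρ (tensorDegLE_mul ρ hx (kap_mem ρ κL κC _ _)) h2)
  | trans h1 h2 ih1 ih2 =>
    intro d i j x y hd hx hy
    have := add_mem (ih1 hd hx hy) (ih2 (h1.length_eq ▸ hd) hx hy)
    rwa [← add_mul, ← mul_add, sub_add_sub_cancel] at this

/-- Modulo relations and lower degree, an element of degree d depends only on its symbol. This half
of PBW holds for every κ. -/
theorem mem_sup_of_symbol_eq_zero {d : ℕ} {z : TensorSkew ρ} (hz : z ∈ tensorDegLE ρ d)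
    (h : symbol ρ d z = 0) : z ∈ relSpan ρ κL κC d ⊔ prevStep (tensorDegLE ρ) d := by
  let b := Module.Basis.ofVectorSpace ℂ V
  let N := relSpan ρ κL κC d ⊔ prevStep (tensorDegLE ρ) d
  -- A linear inverse of the symbol modulo `N`: each monomial goes to the class of an arbitrary
  -- ordering of its letters.
  let σ : SymSkew ρ →ₗ[ℂ] TensorSkew ρ ⧸ N :=
    (symBasis ρ b).constr ℂ fun p => N.mkQ (mon ρ b p.2.toList * grp ρ p.1)
  have key : ∀ z ∈ tensorDegLE ρ d, σ (symbol ρ d z) = N.mkQ z := by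
    intro z hz
    rw [tensorDegLE_eq_span ρ b] at hz
    induction hz using Submodule.span_induction with
    | mem z hz =>
      obtain ⟨g, w, hw, rfl⟩ := hz
      rw [symbol_mon_mul_grp]
      split_ifs with hd
      · rw [Module.Basis.constr_basis, ← sub_eq_zero, ← map_sub, Submodule.mkQ_apply,
          Submodule.Quotient.mk_eq_zero]
        have hp : (w : Multiset _).toList.Perm w := Multiset.coe_eq_coe.1 (by simp)
        have := mul_mon_sub_mon_mul_mem ρ κL κC b hp (d := d)
          (by rw [hp.length_eq, hd, zero_add]; exact le_of_eq (add_zero d))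
          (one_mem_tensorDegLE ρ 0) (grp_mem ρ g)
        rwa [one_mul, sub_mul] at this
      · rw [map_zero, eq_comm, Submodule.mkQ_apply, Submodule.Quotient.mk_eq_zero]
        exact mem_relSpan_sup_of_lt ρ κL κC (by omega) (mul_grp_mem ρ (mon_mem ρ b w) g)
    | zero => simp
    | add x y _ _ hx hy => rw [map_add, map_add, hx, hy, map_add]
    | smul c x _ hx => rw [map_smul, map_smul, hx, map_smul]
  have h2 := key z hz
  rw [h, map_zero] at h2
  exact (Submodule.Quotient.mk_eq_zero N).1 h2.symm

end PBWSymbols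

/-! ### The PBW property as a statement about the ideal of relations. -/

section PBWCriterion

variable {G V : Type*} [Group G] [AddCommGroup V] [Module ℂ V] [Fintype G]
variable (ρ : Representation ℂ G V) (κL : LinCochain G V) (κC : ConstCochain G V)

/-- Every relation of filtration degree at most `d` follows from relators in degree at most `d`. -/
def IsPBW : Prop :=
  ∀ (d : ℕ) (z : TensorSkew ρ), z ∈ tensorDegLE ρ d → toH ρ κL κC z = 0 → z ∈ relSpan ρ κL κC d

theorem toH_mem_filtH {d : ℕ} {z : TensorSkew ρ} (hz : z ∈ tensorDegLE ρ d) :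
    toH ρ κL κC z ∈ filtH ρ κL κC d := ⟨z, hz, rfl⟩

/-- The quotient map from the elements of degree at most `d` of `T(V) # G` to the component of
degree `d` of the associated graded algebra. -/
def toGr (d : ℕ) : tensorDegLE ρ d →ₗ[ℂ] GrPiece (filtH ρ κL κC) d :=
  (grMk (filtH ρ κL κC) d).comp
    ((toH ρ κL κC).toLinearMap.submoduleMap (tensorDegLE ρ d))

theorem toGr_apply {d : ℕ} (z : tensorDegLE ρ d) : toGr ρ κL κC d z =
    grMk (filtH ρ κL κC) d ⟨toH ρ κL κC z, toH_mem_filtH ρ κL κC z.2⟩ := rfl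

theorem toGr_surjective (d : ℕ) : Function.Surjective (toGr ρ κL κC d) :=
  (Submodule.mkQ_surjective _).comp (LinearMap.submoduleMap_surjective _ _)

theorem toGr_eq_zero_iff {d : ℕ} (z : tensorDegLE ρ d) :
    toGr ρ κL κC d z = 0 ↔ toH ρ κL κC z ∈ prevStep (filtH ρ κL κC) d :=
  Submodule.Quotient.mk_eq_zero _

theorem mem_prevStep_filtH {d : ℕ} {x : HAlg ρ κL κC} :
    x ∈ prevStep (filtH ρ κL κC) d ↔ ∃ z ∈ prevStep (tensorDegLE ρ) d, toH ρ κL κC z = x := by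
  cases d with
  | zero =>
    refine ⟨fun h => ⟨0, zero_mem _, ?_⟩, ?_⟩
    · rw [map_zero]; exact (show x = 0 from h).symm
    · rintro ⟨z, hz, rfl⟩
      rw [show z = 0 from hz, map_zero]
      exact zero_mem _
  | succ d => exact Iff.rfl

theorem toGr_eq_zero_of_symbol {d : ℕ} {z : tensorDegLE ρ d} (h : symbol ρ d z = 0) :
    toGr ρ κL κC d z = 0 := by
  rw [toGr_eq_zero_iff, mem_prevStep_filtH]
  obtain ⟨x, hx, y, hy, hxy⟩ := Submodule.mem_sup.1 (mem_sup_of_symbol_eq_zero ρ κL κC z.2 h)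
  exact ⟨y, hy, by rw [← hxy, map_add, toH_of_mem_relSpan ρ κL κC hx, zero_add]⟩

variable {ρ κL κC}

theorem IsPBW.symbol_eq_zero (h : IsPBW ρ κL κC) {d : ℕ} {z : tensorDegLE ρ d}
    (hz : toGr ρ κL κC d z = 0) : symbol ρ d z = 0 := by
  rw [toGr_eq_zero_iff, mem_prevStep_filtH] at hz
  obtain ⟨y, hy, hyz⟩ := hz
  have h1 := h d (z - y) (sub_mem z.2 (prevStep_le ρ d hy)) (by rw [map_sub, hyz, sub_self])
  have h2 := symbol_of_mem_relSpan ρ κL κC h1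
  rwa [map_sub, symbol_eq_zero_of_prevStep ρ hy, sub_zero] at h2

/-- A relation of degree d has zero symbol, so it is a sum of visible relations and a remainder of
degree d - 1; the remainder is again a relation, and one inducts. -/
theorem isPBW_of_symbol_eq_zero
    (h : ∀ (d : ℕ) (z : tensorDegLE ρ d), toGr ρ κL κC d z = 0 → symbol ρ d z = 0) :
    IsPBW ρ κL κC := by
  intro d
  induction d with
  | zero =>
    intro z hz h0
    have h1 := h 0 ⟨z, hz⟩ ((toGr_eq_zero_iff _ _ _ _).2 h0)
    have h2 := mem_sup_of_symbol_eq_zero ρ κL κC hz h1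
    rwa [show prevStep (tensorDegLE ρ) 0 = ⊥ from rfl, sup_bot_eq] at h2
  | succ d ih =>
    intro z hz h0
    have h1 := h (d + 1) ⟨z, hz⟩ ((toGr_eq_zero_iff _ _ _ _).2 (by
      change toH ρ κL κC z ∈ _
      rw [h0]; exact zero_mem _))
    obtain ⟨x, hx, y, hy, rfl⟩ :=
      Submodule.mem_sup.1 (mem_sup_of_symbol_eq_zero ρ κL κC hz h1)
    rw [map_add, toH_of_mem_relSpan ρ κL κC hx, zero_add] at h0
    exact add_mem hx (relSpan_mono ρ κL κC d.le_succ (ih y hy h0))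

theorem symProj_algEquiv (θ : AssocGraded (filtH ρ κL κC) →ₗ[ℂ] SymSkew ρ)
    (hθ : ∀ (d : ℕ) (x : GrPiece (filtH ρ κL κC) d),
      θ (DirectSum.of (GrPiece (filtH ρ κL κC)) d x) ∈ symDeg ρ d)
    (x : AssocGraded (filtH ρ κL κC)) (d : ℕ) :
    symProj ρ d (θ x) = θ (DirectSum.of (GrPiece (filtH ρ κL κC)) d (x d)) := by
  classical
  induction x using DirectSum.induction_on with
  | zero => simp
  | of e x =>
    by_cases h : e = d
    · subst h
      rw [DirectSum.of_eq_same, symProj_self ρ (hθ e x)]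
    · rw [DirectSum.of_eq_of_ne _ _ _ (Ne.symm h), symProj_ne ρ h (hθ e x), map_zero, map_zero]
  | add x y hx hy => rw [map_add, map_add, hx, hy, DirectSum.add_apply, map_add, map_add]

/-- The isomorphism θ is not assumed compatible with the symbol maps, so it is used only through
dimensions. It gives dim S(V)#G in degree d ≤ dim gr_d. Both spaces are quotients of the same
finite-dimensional space, and the kernel of the symbol lies in the kernel of `toGr`, so the kernels
agree. -/
theorem IsDrinfeldOrbifoldAlgebra.isPBW [FiniteDimensional ℂ V]
    (h : IsDrinfeldOrbifoldAlgebra ρ κL κC) : IsPBW ρ κL κC := by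
  obtain ⟨θ, hθ⟩ := h
  refine isPBW_of_symbol_eq_zero fun d z hz => ?_
  let S : tensorDegLE ρ d →ₗ[ℂ] symDeg ρ d :=
    ((symbol ρ d).comp (tensorDegLE ρ d).subtype).codRestrict (symDeg ρ d)
      fun z => symbol_mem ρ d z
  have hS : Function.Surjective S := by
    rintro ⟨y, hy⟩
    obtain ⟨z, hz, rfl⟩ := exists_symbol_eq ρ hy
    exact ⟨⟨z, hz⟩, rfl⟩
  let Θ : GrPiece (filtH ρ κL κC) d →ₗ[ℂ] symDeg ρ d :=
    (θ.toLinearMap.comp (DirectSum.lof ℂ ℕ (GrPiece (filtH ρ κL κC)) d)).codRestrict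
      (symDeg ρ d) fun x => hθ d x
  have hΘ : Function.Surjective Θ := by
    rintro ⟨y, hy⟩
    -- Only the degree d component of the preimage matters, since θ preserves degrees and y is
    -- homogeneous.
    refine ⟨θ.symm y d, Subtype.ext ?_⟩
    have h := symProj_algEquiv θ.toLinearMap hθ (θ.symm y) d
    rw [AlgEquiv.toLinearMap_apply, AlgEquiv.apply_symm_apply, symProj_self ρ hy] at h
    exact h.symm
  have : FiniteDimensional ℂ (GrPiece (filtH ρ κL κC) d) :=
    Module.Finite.of_surjective _ (toGr_surjective ρ κL κC d)
  have : FiniteDimensional ℂ (symDeg ρ d) := Module.Finite.of_surjective _ hS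
  have h1 := LinearMap.finrank_le_finrank_of_surjective hΘ
  have h2 := (toGr ρ κL κC d).finrank_range_add_finrank_ker
  have h3 := S.finrank_range_add_finrank_ker
  rw [LinearMap.range_eq_top.2 (toGr_surjective ρ κL κC d), finrank_top] at h2
  rw [LinearMap.range_eq_top.2 hS, finrank_top] at h3
  have h4 : LinearMap.ker S ≤ LinearMap.ker (toGr ρ κL κC d) := fun w hw =>
    toGr_eq_zero_of_symbol ρ κL κC (congrArg Subtype.val (show S w = 0 from hw))
  have h5 := Submodule.eq_of_le_of_finrank_le h4 (by omega)
  have h6 : z ∈ LinearMap.ker S := by rw [h5]; exact hz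
  exact congrArg Subtype.val (show S z = 0 from h6)

/-- The symbol map on the component of degree `d` of the associated graded algebra. -/
def grSymbol (h : IsPBW ρ κL κC) (d : ℕ) : GrPiece (filtH ρ κL κC) d →ₗ[ℂ] SymSkew ρ :=
  ((LinearMap.ker (toGr ρ κL κC d)).liftQ ((symbol ρ d).comp (tensorDegLE ρ d).subtype)
    fun _ hz => h.symbol_eq_zero hz).comp
  ((toGr ρ κL κC d).quotKerEquivOfSurjective (toGr_surjective ρ κL κC d)).symm.toLinearMap

theorem grSymbol_toGr (h : IsPBW ρ κL κC) {d : ℕ} (z : tensorDegLE ρ d) :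
    grSymbol h d (toGr ρ κL κC d z) = symbol ρ d z := by
  have h1 : ((toGr ρ κL κC d).quotKerEquivOfSurjective (toGr_surjective ρ κL κC d)).symm
      (toGr ρ κL κC d z) = Submodule.Quotient.mk z :=
    (LinearEquiv.symm_apply_eq _).2 rfl
  rw [grSymbol, LinearMap.comp_apply, LinearEquiv.coe_coe, h1]
  rfl

theorem grSymbol_injective (h : IsPBW ρ κL κC) (d : ℕ) :
    Function.Injective (grSymbol h d) := by
  rw [injective_iff_map_eq_zero]
  intro x hx
  obtain ⟨z, rfl⟩ := toGr_surjective ρ κL κC d x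
  rw [grSymbol_toGr] at hx
  exact toGr_eq_zero_of_symbol ρ κL κC hx

omit [Fintype G] in
theorem symbol_zero_one : symbol ρ 0 1 = 1 := by
  rw [symbol_apply, map_one]
  refine symProj_self ρ (Submodule.subset_span ⟨1, 1, ?_, rfl⟩)
  rw [pow_zero]
  exact Submodule.one_le.1 le_rfl

/-- Under `IsPBW` the kernels of `toGr` and of the symbol coincide in each degree, so the symbol
descends to the associated graded algebra and is bijective degree by degree. -/
theorem IsPBW.isDrinfeldOrbifoldAlgebra (h : IsPBW ρ κL κC) :
    IsDrinfeldOrbifoldAlgebra ρ κL κC := by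
  classical
  let θ : AssocGraded (filtH ρ κL κC) →ₐ[ℂ] SymSkew ρ :=
    DirectSum.toAlgebra ℂ (GrPiece (filtH ρ κL κC)) (grSymbol h)
      (by
        refine Eq.trans ?_ ((grSymbol_toGr h ⟨1, one_mem_tensorDegLE ρ 0⟩).trans symbol_zero_one)
        refine congrArg (grSymbol h 0) (congrArg (grMk (filtH ρ κL κC) 0) (Subtype.ext ?_))
        exact (map_one (toH ρ κL κC)).symm) (by
        intro i j x y
        obtain ⟨x, rfl⟩ := toGr_surjective ρ κL κC i x
        obtain ⟨y, rfl⟩ := toGr_surjective ρ κL κC j y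
        rw [grSymbol_toGr, grSymbol_toGr, ← symbol_mul ρ x.2 y.2]
        refine Eq.trans ?_ (grSymbol_toGr h ⟨x.1 * y.1, tensorDegLE_mul ρ x.2 y.2⟩)
        refine congrArg (grSymbol h (i + j)) ?_
        change grMul _ i j _ _ = _
        rw [toGr_apply, toGr_apply, grMul_mk, toGr_apply]
        refine congrArg _ (Subtype.ext ?_)
        exact (map_mul (toH ρ κL κC) x.1 y.1).symm)
  have hof : ∀ (d : ℕ) (x : GrPiece (filtH ρ κL κC) d),
      θ (DirectSum.of (GrPiece (filtH ρ κL κC)) d x) = grSymbol h d x :=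
    fun d x =>
      DirectSum.toAddMonoid_of (fun i => (grSymbol h i).toAddMonoidHom) d x
  have hmem : ∀ (d : ℕ) (x : GrPiece (filtH ρ κL κC) d),
      θ (DirectSum.of (GrPiece (filtH ρ κL κC)) d x) ∈ symDeg ρ d := by
    intro d x
    rw [hof]
    obtain ⟨z, rfl⟩ := toGr_surjective ρ κL κC d x
    rw [grSymbol_toGr]
    exact symbol_mem ρ d _
  refine ⟨AlgEquiv.ofBijective θ ⟨?_, ?_⟩, hmem⟩
  · intro x y hxy
    refine DFinsupp.ext fun d => grSymbol_injective h d ?_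
    rw [← hof, ← hof]
    exact (symProj_algEquiv θ.toLinearMap hmem x d).symm.trans
      ((congrArg (symProj ρ d) hxy).trans (symProj_algEquiv θ.toLinearMap hmem y d))
  · have hr : ∀ d, symDeg ρ d ≤ LinearMap.range θ.toLinearMap := by
      intro d y hy
      obtain ⟨z, hz, rfl⟩ := exists_symbol_eq ρ hy
      exact ⟨DirectSum.of (GrPiece (filtH ρ κL κC)) d (toGr ρ κL κC d ⟨z, hz⟩),
        (hof d _).trans (grSymbol_toGr h ⟨z, hz⟩)⟩
    intro y
    let b := Module.Basis.ofVectorSpace ℂ V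
    have hy : y ∈ Submodule.span ℂ (Set.range (symBasis ρ b)) := by
      rw [Module.Basis.span_eq]; trivial
    have h2 : Submodule.span ℂ (Set.range (symBasis ρ b)) ≤ LinearMap.range θ.toLinearMap := by
      refine Submodule.span_le.2 ?_
      rintro _ ⟨p, rfl⟩
      refine hr p.2.card ?_
      rw [symDeg_eq_span ρ b]
      exact Submodule.subset_span ⟨p.1, p.2, rfl, rfl⟩
    exact h2 hy

theorem isDrinfeldOrbifoldAlgebra_iff_isPBW [FiniteDimensional ℂ V] :
    IsDrinfeldOrbifoldAlgebra ρ κL κC ↔ IsPBW ρ κL κC :=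
  ⟨fun h => h.isPBW, fun h => h.isDrinfeldOrbifoldAlgebra⟩

end PBWCriterion

/-! ### The diamond lemma: sorting words is confluent when the Jacobi condition holds. -/

section Confluence

variable {G V : Type*} [Group G] [AddCommGroup V] [Module ℂ V] [Fintype G]
variable (ρ : Representation ℂ G V) (κL : LinCochain G V) (κC : ConstCochain G V)

/-- The parameter map is invariant under the group. -/
def KapInvariant : Prop := ∀ (g : G) (v w : V),
  grp ρ g * kap ρ κL κC v w = kap ρ κL κC (ρ g v) (ρ g w) * grp ρ g

/-- The cyclic sum of commutators `∑ [κ(v₁, v₂), v₃]`. -/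
def jacobiator (v₁ v₂ v₃ : V) : TensorSkew ρ :=
  (kap ρ κL κC v₁ v₂ * vec ρ v₃ - vec ρ v₃ * kap ρ κL κC v₁ v₂) +
  (kap ρ κL κC v₂ v₃ * vec ρ v₁ - vec ρ v₁ * kap ρ κL κC v₂ v₃) +
  (kap ρ κL κC v₃ v₁ * vec ρ v₂ - vec ρ v₂ * kap ρ κL κC v₃ v₁)

variable {ρ κL κC}

theorem KapInvariant.grp_mul_rel (hinv : KapInvariant ρ κL κC) (g : G) (v w : V) :
    grp ρ g * rel ρ κL κC v w = rel ρ κL κC (ρ g v) (ρ g w) * grp ρ g := by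
  rw [rel, rel, mul_sub, mul_sub, hinv, ← mul_assoc, ← mul_assoc, grp_mul_vec, grp_mul_vec,
    mul_assoc, mul_assoc, grp_mul_vec, grp_mul_vec]
  simp only [sub_mul, mul_assoc]

variable {m : ℕ} (b : Module.Basis (Fin m) ℂ V)

/-- Invariance lets group elements to the left of a relator be pushed past it, and bilinearity
reduces relators to basis vectors. -/
theorem KapInvariant.relSpan_le_span (hinv : KapInvariant ρ κL κC) (d : ℕ) :
    relSpan ρ κL κC d ≤ Submodule.span ℂ {z | ∃ (u u' : List (Fin m)) (i j : Fin m) (g : G),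
      u.length + 2 + u'.length ≤ d ∧
        z = mon ρ b u * rel ρ κL κC (b i) (b j) * (mon ρ b u' * grp ρ g)} := by
  set S := Submodule.span ℂ {z | ∃ (u u' : List (Fin m)) (i j : Fin m) (g : G),
      u.length + 2 + u'.length ≤ d ∧
        z = mon ρ b u * rel ρ κL κC (b i) (b j) * (mon ρ b u' * grp ρ g)} with hS
  have h1 : ∀ (u : List (Fin m)) (v w : V) (k : ℕ) (y : TensorSkew ρ), u.length + 2 + k ≤ d →
      y ∈ tensorDegLE ρ k → mon ρ b u * rel ρ κL κC v w * y ∈ S := by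
    intro u v w k y hk hy
    rw [tensorDegLE_eq_span ρ b] at hy
    induction hy using Submodule.span_induction with
    | mem y hy =>
      obtain ⟨g, u', hu', rfl⟩ := hy
      let R : V →ₗ[ℂ] V →ₗ[ℂ] TensorSkew ρ :=
        (LinearMap.mul ℂ _).compl₁₂ (vecL ρ) (vecL ρ) -
          ((LinearMap.mul ℂ _).compl₁₂ (vecL ρ) (vecL ρ)).flip - kap ρ κL κC
      have hR : ∀ v w, rel ρ κL κC v w = R v w := fun v w => rfl
      rw [hR, ← b.linearCombination_repr v, ← b.linearCombination_repr w,
        Finsupp.linearCombination_apply, Finsupp.linearCombination_apply, Finsupp.sum, Finsupp.sum]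
      simp only [map_sum, LinearMap.sum_apply, map_smul, LinearMap.smul_apply, Finset.mul_sum,
        Finset.sum_mul, mul_smul_comm, smul_mul_assoc]
      refine Submodule.sum_mem _ fun i _ => Submodule.smul_mem _ _ (Submodule.sum_mem _ fun j _ =>
        Submodule.smul_mem _ _ (Submodule.subset_span ⟨u, u', j, i, g, ?_, rfl⟩))
      omega
    | zero => rw [mul_zero]; exact zero_mem _
    | add x y _ _ hx hy => rw [mul_add]; exact add_mem hx hy
    | smul c x _ hx => rw [mul_smul_comm]; exact Submodule.smul_mem _ _ hx
  refine Submodule.span_le.2 ?_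
  rintro _ ⟨k, l, x, y, v, w, hd, hx, hy, rfl⟩
  rw [tensorDegLE_eq_span ρ b] at hx
  rw [SetLike.mem_coe]
  induction hx using Submodule.span_induction with
  | mem x hx =>
    obtain ⟨g, u, hu, rfl⟩ := hx
    rw [mul_assoc (mon ρ b u), hinv.grp_mul_rel, ← mul_assoc, mul_assoc]
    exact h1 u _ _ (0 + l) _ (by omega) (tensorDegLE_mul ρ (grp_mem ρ g) hy)
  | zero => rw [zero_mul, zero_mul]; exact zero_mem _
  | add x y _ _ hx hy => rw [add_mul, add_mul]; exact add_mem hx hy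
  | smul c x _ hx => rw [smul_mul_assoc, smul_mul_assoc]; exact Submodule.smul_mem _ _ hx

/-- A weight of words which decreases when a descent is removed. -/
def wordWeight : List (Fin m) → ℕ
  | [] => 0
  | i :: w => i * w.length + wordWeight w

/-- Each letter is weighted by the number of letters after it, so moving the larger letter one place
to the right lowers the total by i - j. -/
theorem wordWeight_swap (u : List (Fin m)) {i j : Fin m} (h : j < i) (u' : List (Fin m)) :
    wordWeight (u ++ j :: i :: u') < wordWeight (u ++ i :: j :: u') := by
  induction u with
  | nil =>
    have h' : (j : ℕ) < i := h
    simp only [List.nil_append, wordWeight, List.length_cons]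
    nlinarith
  | cons k u ih =>
    simp only [List.cons_append, wordWeight, List.length_append, List.length_cons]
    omega

variable (ρ κL κC)

/-- The class in `T(V) # G` modulo `relSpan d` of the element `u x u' g`. -/
def sandwich (d : ℕ) (g : G) (u : List (Fin m)) (x : TensorSkew ρ) (u' : List (Fin m)) :
    TensorSkew ρ ⧸ relSpan ρ κL κC d :=
  (relSpan ρ κL κC d).mkQ (mon ρ b u * x * (mon ρ b u' * grp ρ g))

open Classical in
/-- The lower order terms which arise when a word is sorted by removing descents. -/
def sortTail (d : ℕ) (g : G) (p : List (Fin m)) : TensorSkew ρ ⧸ relSpan ρ κL κC d :=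
  if h : ∃ q : List (Fin m) × Fin m × Fin m × List (Fin m),
      p = q.1 ++ q.2.1 :: q.2.2.1 :: q.2.2.2 ∧ q.2.2.1 < q.2.1 then
    sortTail d g (h.choose.1 ++ h.choose.2.2.1 :: h.choose.2.1 :: h.choose.2.2.2) +
      sandwich ρ κL κC b d g h.choose.1
        (kap ρ κL κC (b h.choose.2.1) (b h.choose.2.2.1)) h.choose.2.2.2
  else 0
termination_by wordWeight p
decreasing_by
  conv_rhs => rw [h.choose_spec.1]
  exact wordWeight_swap _ h.choose_spec.2 _

/-- The recursion removes a descent picked by choice, not necessarily the displayed one.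
Independence of that choice is the content of the confluence lemmas. -/
theorem sortTail_exists (d : ℕ) (g : G) {u u' : List (Fin m)} {i j : Fin m} (hij : j < i) :
    ∃ (u₁ u₁' : List (Fin m)) (i₁ j₁ : Fin m), j₁ < i₁ ∧
      u ++ i :: j :: u' = u₁ ++ i₁ :: j₁ :: u₁' ∧
      sortTail ρ κL κC b d g (u ++ i :: j :: u') =
        sortTail ρ κL κC b d g (u₁ ++ j₁ :: i₁ :: u₁') +
          sandwich ρ κL κC b d g u₁ (kap ρ κL κC (b i₁) (b j₁)) u₁' := by
  have h : ∃ q : List (Fin m) × Fin m × Fin m × List (Fin m),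
      u ++ i :: j :: u' = q.1 ++ q.2.1 :: q.2.2.1 :: q.2.2.2 ∧ q.2.2.1 < q.2.1 :=
    ⟨(u, i, j, u'), rfl, hij⟩
  refine ⟨h.choose.1, h.choose.2.2.2, h.choose.2.1, h.choose.2.2.1, h.choose_spec.2,
    h.choose_spec.1, ?_⟩
  conv_lhs => rw [sortTail]
  rw [dif_pos h]

variable {ρ κL κC}

/-- The step removing a descent, as an equation for `sortTail`. -/
def SortStep (ρ : Representation ℂ G V) (κL : LinCochain G V) (κC : ConstCochain G V)
    (b : Module.Basis (Fin m) ℂ V) (d : ℕ) (g : G) (u : List (Fin m)) (i j : Fin m)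
    (u' : List (Fin m)) : Prop :=
  sortTail ρ κL κC b d g (u ++ i :: j :: u') =
    sortTail ρ κL κC b d g (u ++ j :: i :: u') +
      sandwich ρ κL κC b d g u (kap ρ κL κC (b i) (b j)) u'

/-- Both ways of sorting i > j > k reach the word k j i after three swaps. Their tails differ by the
jacobiator of the three letters, placed between `u` and `u'`. -/
theorem sortTail_overlap {d : ℕ} {g : G}
    (hjac : ∀ u v w, jacobiator ρ κL κC u v w ∈ relSpan ρ κL κC 2)
    {u u' : List (Fin m)} {i j k : Fin m} (hd : u.length + 3 + u'.length = d + 1)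
    (hij : j < i) (hjk : k < j)
    (ih : ∀ v a c v', c < a → (v ++ a :: c :: v').length = d + 1 →
      wordWeight (v ++ a :: c :: v') < wordWeight (u ++ i :: j :: k :: u') →
      SortStep ρ κL κC b d g v a c v') :
    sortTail ρ κL κC b d g (u ++ j :: i :: k :: u') +
        sandwich ρ κL κC b d g u (kap ρ κL κC (b i) (b j)) (k :: u') =
      sortTail ρ κL κC b d g (u ++ i :: k :: j :: u') +
        sandwich ρ κL κC b d g (u ++ [i]) (kap ρ κL κC (b j) (b k)) u' := by
  have hlen : ∀ x y z : Fin m, (u ++ x :: y :: z :: u').length = d + 1 := by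
    intro x y z
    simp only [List.length_append, List.length_cons]
    omega
  have e : ∀ x y z : Fin m, u ++ x :: y :: z :: u' = (u ++ [x]) ++ y :: z :: u' := by simp
  have w1 : wordWeight (u ++ j :: i :: k :: u') < wordWeight (u ++ i :: j :: k :: u') :=
    wordWeight_swap u hij _
  have w2 : wordWeight (u ++ j :: k :: i :: u') < wordWeight (u ++ j :: i :: k :: u') := by
    rw [e, e]; exact wordWeight_swap _ (hjk.trans hij) _
  have w3 : wordWeight (u ++ i :: k :: j :: u') < wordWeight (u ++ i :: j :: k :: u') := by
    rw [e, e]; exact wordWeight_swap _ hjk _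
  have w4 : wordWeight (u ++ k :: i :: j :: u') < wordWeight (u ++ i :: k :: j :: u') :=
    wordWeight_swap u (hjk.trans hij) _
  have s1 := ih (u ++ [j]) i k u' (hjk.trans hij) (by rw [← e]; exact hlen _ _ _)
    (by rw [← e]; exact w1)
  have s2 := ih u j k (i :: u') hjk (hlen _ _ _) (w2.trans w1)
  have s3 := ih u i k (j :: u') (hjk.trans hij) (hlen _ _ _) w3
  have s4 := ih (u ++ [k]) i j u' hij (by rw [← e]; exact hlen _ _ _)
    (by rw [← e]; exact w4.trans w3)
  rw [SortStep, ← e, ← e] at s1 s4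
  rw [SortStep] at s2 s3
  rw [s1, s2, s3, s4, ← sub_eq_zero]
  -- The word has length d + 1 and three letters are replaced by an element of `relSpan 2`, so the
  -- total degree is exactly d.
  have hz : mon ρ b u * jacobiator ρ κL κC (b i) (b j) (b k) * (mon ρ b u' * grp ρ g) ∈
      relSpan ρ κL κC d :=
    mul_mem_relSpan ρ κL κC (show u.length + 2 + u'.length ≤ d by omega) (mon_mem ρ b u)
      (hjac _ _ _) (mul_grp_mem ρ (mon_mem ρ b u') g)
  refine Eq.trans ?_ ((Submodule.Quotient.mk_eq_zero _).2 hz)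
  rw [← Submodule.mkQ_apply]
  simp only [sandwich, mon_append, mon_cons, mon_nil, jacobiator, mul_one]
  rw [kap_swap ρ κL κC (b k) (b i), add_assoc, add_assoc, add_assoc, add_assoc,
    add_sub_add_left_eq_sub]
  simp only [← map_add, ← map_sub]
  congr 1
  noncomm_ring

/-- Swaps at disjoint places commute up to replacing, in a κ-term of one swap, the other commutator
by its κ-value; that replacement is a relation of degree at most d. -/
theorem sortTail_disjoint {d : ℕ} {g : G} {u w u' : List (Fin m)} {i j k l : Fin m}
    (hd : u.length + w.length + 4 + u'.length = d + 1) (hij : j < i) (hkl : l < k)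
    (ih : ∀ v a c v', c < a → (v ++ a :: c :: v').length = d + 1 →
      wordWeight (v ++ a :: c :: v') < wordWeight (u ++ i :: j :: (w ++ k :: l :: u')) →
      SortStep ρ κL κC b d g v a c v') :
    sortTail ρ κL κC b d g (u ++ j :: i :: (w ++ k :: l :: u')) +
        sandwich ρ κL κC b d g u (kap ρ κL κC (b i) (b j)) (w ++ k :: l :: u') =
      sortTail ρ κL κC b d g (u ++ i :: j :: (w ++ l :: k :: u')) +
        sandwich ρ κL κC b d g (u ++ i :: j :: w) (kap ρ κL κC (b k) (b l)) u' := by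
  have hlen : ∀ x y z t : Fin m, (u ++ x :: y :: (w ++ z :: t :: u')).length = d + 1 := by
    intro x y z t
    simp only [List.length_append, List.length_cons]
    omega
  have e : ∀ x y z t : Fin m, u ++ x :: y :: (w ++ z :: t :: u') =
    (u ++ x :: y :: w) ++ z :: t :: u' := by simp
  have w1 : wordWeight (u ++ j :: i :: (w ++ k :: l :: u')) <
      wordWeight (u ++ i :: j :: (w ++ k :: l :: u')) := wordWeight_swap u hij _
  have w2 : wordWeight (u ++ i :: j :: (w ++ l :: k :: u')) <
      wordWeight (u ++ i :: j :: (w ++ k :: l :: u')) := by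
    rw [e, e]; exact wordWeight_swap _ hkl _
  have s1 := ih (u ++ j :: i :: w) k l u' hkl (by rw [← e]; exact hlen _ _ _ _)
    (by rw [← e]; exact w1)
  have s2 := ih u i j (w ++ l :: k :: u') hij (hlen _ _ _ _) w2
  rw [SortStep, ← e, ← e] at s1
  rw [SortStep] at s2
  rw [s1, s2, ← sub_eq_zero]
  have hw := mon_mem ρ b w
  have hu := mon_mem ρ b u
  have hu' := mul_grp_mem ρ (mon_mem ρ b u') g
  have hz1 : mon ρ b u * kap ρ κL κC (b i) (b j) * mon ρ b w * rel ρ κL κC (b k) (b l) *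
      (mon ρ b u' * grp ρ g) ∈ relSpan ρ κL κC d :=
    mul_rel_mul_mem ρ κL κC (show (u.length + 1 + w.length) + 2 + u'.length ≤ d by omega)
      (tensorDegLE_mul ρ (tensorDegLE_mul ρ hu (kap_mem ρ κL κC _ _)) hw) hu' _ _
  have hz2 : mon ρ b u * rel ρ κL κC (b i) (b j) * (mon ρ b w * (kap ρ κL κC (b k) (b l) *
      (mon ρ b u' * grp ρ g))) ∈ relSpan ρ κL κC d :=
    mul_rel_mul_mem ρ κL κC (show u.length + 2 + (w.length + (1 + u'.length)) ≤ d by omega)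
      hu (tensorDegLE_mul ρ hw (tensorDegLE_mul ρ (kap_mem ρ κL κC _ _) hu')) _ _
  refine Eq.trans ?_ ((Submodule.Quotient.mk_eq_zero _).2 (sub_mem hz1 hz2))
  rw [← Submodule.mkQ_apply]
  simp only [sandwich, mon_append, mon_cons, rel]
  rw [add_assoc, add_assoc, add_sub_add_left_eq_sub]
  simp only [← map_add, ← map_sub]
  congr 1
  noncomm_ring

theorem sortTail_confluent {d : ℕ} {g : G}
    (hjac : ∀ u v w, jacobiator ρ κL κC u v w ∈ relSpan ρ κL κC 2)
    {u₁ u₁' u₂ u₂' : List (Fin m)} {i₁ j₁ i₂ j₂ : Fin m} (h₁ : j₁ < i₁) (h₂ : j₂ < i₂)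
    (hp : u₁ ++ i₁ :: j₁ :: u₁' = u₂ ++ i₂ :: j₂ :: u₂') (hle : u₁.length ≤ u₂.length)
    (hd : (u₁ ++ i₁ :: j₁ :: u₁').length = d + 1)
    (ih : ∀ v a c v', c < a → (v ++ a :: c :: v').length = d + 1 →
      wordWeight (v ++ a :: c :: v') < wordWeight (u₁ ++ i₁ :: j₁ :: u₁') →
      SortStep ρ κL κC b d g v a c v') :
    sortTail ρ κL κC b d g (u₁ ++ j₁ :: i₁ :: u₁') +
        sandwich ρ κL κC b d g u₁ (kap ρ κL κC (b i₁) (b j₁)) u₁' =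
      sortTail ρ κL κC b d g (u₂ ++ j₂ :: i₂ :: u₂') +
        sandwich ρ κL κC b d g u₂ (kap ρ κL κC (b i₂) (b j₂)) u₂' := by
  -- The position of the second descent relative to the first: c empty means the same descent, one
  -- letter means an overlap, two or more letters mean disjoint places.
  have hex : ∃ c, u₂ = u₁ ++ c ∧ i₁ :: j₁ :: u₁' = c ++ i₂ :: j₂ :: u₂' := by
    rcases List.append_eq_append_iff.1 hp with ⟨c, h1, h2⟩ | ⟨c, h1, h2⟩
    · exact ⟨c, h1, h2⟩
    · have : c = [] := by
        have h3 := congrArg List.length h1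
        rw [List.length_append] at h3
        exact List.eq_nil_of_length_eq_zero (by omega)
      subst this
      exact ⟨[], by simpa using h1.symm, by simpa using h2.symm⟩
  obtain ⟨c, rfl, hc⟩ := hex
  rw [List.length_append, List.length_cons, List.length_cons] at hd
  match c, hc with
  | [], hc =>
    simp only [List.nil_append, List.cons.injEq] at hc
    obtain ⟨rfl, rfl, rfl⟩ := hc
    rw [List.append_nil]
  | [x], hc =>
    simp only [List.cons_append, List.nil_append, List.cons.injEq] at hc
    obtain ⟨rfl, rfl, rfl⟩ := hc
    rw [List.length_cons] at hd
    have := sortTail_overlap b hjac (by omega) h₁ h₂ ih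
    rw [this]
    simp
  | x :: y :: w, hc =>
    simp only [List.cons_append, List.cons.injEq] at hc
    obtain ⟨rfl, rfl, rfl⟩ := hc
    rw [List.length_append, List.length_cons, List.length_cons] at hd
    have := sortTail_disjoint b (by omega) h₁ h₂ ih
    rw [this]
    simp

theorem sortTail_step {d : ℕ} {g : G}
    (hjac : ∀ u v w, jacobiator ρ κL κC u v w ∈ relSpan ρ κL κC 2) (n : ℕ) :
    ∀ (u : List (Fin m)) (i j : Fin m) (u' : List (Fin m)), j < i →
      (u ++ i :: j :: u').length = d + 1 → wordWeight (u ++ i :: j :: u') = n →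
      SortStep ρ κL κC b d g u i j u' := by
  induction n using Nat.strong_induction_on with
  | _ n IH =>
    intro u i j u' hij hd hn
    have ih : ∀ v a c v', c < a → (v ++ a :: c :: v').length = d + 1 →
        wordWeight (v ++ a :: c :: v') < wordWeight (u ++ i :: j :: u') →
        SortStep ρ κL κC b d g v a c v' :=
      fun v a c v' h h' hw => IH _ (hn ▸ hw) v a c v' h h' rfl
    obtain ⟨u₁, u₁', i₁, j₁, h₁, hp, hs⟩ := sortTail_exists ρ κL κC b d g (u' := u') hij (u := u)
    rw [SortStep, hs]
    rcases le_total u₁.length u.length with hle | hle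
    · exact sortTail_confluent b hjac h₁ hij hp.symm hle (hp ▸ hd) (hp ▸ ih)
    · exact (sortTail_confluent b hjac hij h₁ hp hle hd ih).symm

/-- A linear map Θ is built which is the quotient by `relSpan d` in degree at most d and kills
`relSpan (d + 1)`. An element lying in both domains is then zero modulo `relSpan d`. -/
theorem relSpan_succ_inf_le [FiniteDimensional ℂ V] (hinv : KapInvariant ρ κL κC)
    (hjac : ∀ u v w, jacobiator ρ κL κC u v w ∈ relSpan ρ κL κC 2) (d : ℕ)
    {z : TensorSkew ρ} (hz : z ∈ relSpan ρ κL κC (d + 1)) (hzd : z ∈ tensorDegLE ρ d) :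
    z ∈ relSpan ρ κL κC d := by
  classical
  let b := Module.finBasis ℂ V
  -- On words of length d + 1 the map keeps only what is shed while sorting. The values on longer
  -- words play no role.
  let Θ : TensorSkew ρ →ₗ[ℂ] TensorSkew ρ ⧸ relSpan ρ κL κC d :=
    (wordBasis ρ b).constr ℂ fun p => if p.2.length = d + 1 then sortTail ρ κL κC b d p.1 p.2
      else (relSpan ρ κL κC d).mkQ (mon ρ b p.2 * grp ρ p.1)
  have hΘ : ∀ g w, Θ (mon ρ b w * grp ρ g) = if w.length = d + 1
      then sortTail ρ κL κC b d g w else (relSpan ρ κL κC d).mkQ (mon ρ b w * grp ρ g) := by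
    intro g w
    rw [← wordBasis_apply, Module.Basis.constr_basis, wordBasis_apply]
  have hlow : ∀ y ∈ tensorDegLE ρ d, Θ y = (relSpan ρ κL κC d).mkQ y := by
    intro y hy
    rw [tensorDegLE_eq_span ρ b] at hy
    induction hy using Submodule.span_induction with
    | mem y hy =>
      obtain ⟨g, w, hw, rfl⟩ := hy
      rw [hΘ, if_neg (by omega)]
    | zero => rw [map_zero, map_zero]
    | add x y _ _ hx hy => rw [map_add, map_add, hx, hy]
    | smul c x _ hx => rw [map_smul, map_smul, hx]
  have hstep : ∀ (u u' : List (Fin (Module.finrank ℂ V))) (i j : Fin (Module.finrank ℂ V))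
      (g : G), (u ++ i :: j :: u').length = d + 1 →
      SortStep ρ κL κC b d g u i j u' := by
    intro u u' i j g hd
    rcases lt_trichotomy j i with hij | rfl | hij
    · exact sortTail_step b hjac _ u i j u' hij hd rfl
    · rw [SortStep, sandwich, kap_self, mul_zero, zero_mul, map_zero, add_zero]
    -- An ascent is a descent read backwards, since κ is alternating.
    · have := sortTail_step b hjac (g := g) _ u j i u' hij
        (by simpa only [List.length_append, List.length_cons] using hd) rfl
      rw [SortStep] at this ⊢
      rw [this, kap_swap, sandwich, sandwich, mul_neg, neg_mul, map_neg, neg_add_cancel_right]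
  have hkill : Θ z = 0 := by
    have h1 := hinv.relSpan_le_span b (d + 1) hz
    clear hz hzd
    induction h1 using Submodule.span_induction with
    | mem y hy =>
      obtain ⟨u, u', i, j, g, hd, rfl⟩ := hy
      have hu' := mul_grp_mem ρ (mon_mem ρ b u') g
      rcases hd.lt_or_eq with hd | hd
      · have h2 := mul_rel_mul_mem ρ κL κC (show u.length + 2 + u'.length ≤ d by omega)
          (mon_mem ρ b u) hu' (b i) (b j)
        rw [hlow _ (relSpan_le ρ κL κC d h2)]
        exact (Submodule.Quotient.mk_eq_zero _).2 h2
      · have h2 : mon ρ b u * kap ρ κL κC (b i) (b j) * (mon ρ b u' * grp ρ g) ∈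
            tensorDegLE ρ d :=
          tensorDegLE_mono ρ (show u.length + 1 + u'.length ≤ d by omega)
            (tensorDegLE_mul ρ (tensorDegLE_mul ρ (mon_mem ρ b u) (kap_mem ρ κL κC _ _)) hu')
        have h3 : mon ρ b u * rel ρ κL κC (b i) (b j) * (mon ρ b u' * grp ρ g) =
            mon ρ b (u ++ i :: j :: u') * grp ρ g - mon ρ b (u ++ j :: i :: u') * grp ρ g -
              mon ρ b u * kap ρ κL κC (b i) (b j) * (mon ρ b u' * grp ρ g) := by
          simp only [mon_append, mon_cons, rel]
          noncomm_ring
        have h4 : ∀ x y, (u ++ x :: y :: u').length = d + 1 := by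
          intro x y
          simp only [List.length_append, List.length_cons]
          omega
        rw [h3, map_sub, map_sub, hΘ, hΘ, if_pos (h4 _ _), if_pos (h4 _ _), hlow _ h2,
          hstep u u' i j g (h4 _ _), sandwich, add_sub_cancel_left, sub_self]
    | zero => exact map_zero _
    | add x y _ _ hx hy => rw [map_add, hx, hy, add_zero]
    | smul c x _ hx => rw [map_smul, hx, smul_zero]
  rw [hlow z hzd] at hkill
  exact (Submodule.Quotient.mk_eq_zero _).1 hkill

/-- A relation lies in `relSpan` of some possibly large degree; the previous lemma lowers that
degree one unit at a time. -/
theorem isPBW_of_jacobi [FiniteDimensional ℂ V] (hinv : KapInvariant ρ κL κC)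
    (hjac : ∀ u v w, jacobiator ρ κL κC u v w ∈ relSpan ρ κL κC 2) : IsPBW ρ κL κC := by
  intro d z hz h
  obtain ⟨e, he⟩ := (toH_eq_zero_iff ρ κL κC).1 h
  have key : ∀ k, z ∈ relSpan ρ κL κC (d + k) → z ∈ relSpan ρ κL κC d := by
    intro k
    induction k with
    | zero => exact id
    | succ k ih => exact fun hk => ih (relSpan_succ_inf_le hinv hjac (d + k) hk
        (tensorDegLE_mono ρ (Nat.le_add_right d k) hz))
  exact key e (relSpan_mono ρ κL κC (Nat.le_add_left e d) he)

end Confluence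

/-! ### Invariance and Jacobi conditions, component by component. -/

section Components

variable {G V : Type*} [Group G] [AddCommGroup V] [Module ℂ V] [Fintype G]
variable {ρ : Representation ℂ G V} {κL : LinCochain G V} {κC : ConstCochain G V}

/-- Conjugating a relator by g and comparing it with the relator of the moved vectors yields a
relation of degree at most one, where `relSpan` is zero. -/
theorem IsPBW.kapInvariant (h : IsPBW ρ κL κC) : KapInvariant ρ κL κC := by
  intro g v w
  rw [← sub_eq_zero]
  have h0 : toH ρ κL κC
      (grp ρ g * kap ρ κL κC v w - kap ρ κL κC (ρ g v) (ρ g w) * grp ρ g) = 0 := by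
    have h1 : grp ρ g * kap ρ κL κC v w - kap ρ κL κC (ρ g v) (ρ g w) * grp ρ g =
        rel ρ κL κC (ρ g v) (ρ g w) * grp ρ g - grp ρ g * rel ρ κL κC v w := by
      rw [rel, rel, mul_sub, mul_sub, ← mul_assoc (grp ρ g), ← mul_assoc (grp ρ g), grp_mul_vec,
        grp_mul_vec, mul_assoc (vec ρ _) (grp ρ g), mul_assoc (vec ρ _) (grp ρ g), grp_mul_vec,
        grp_mul_vec]
      noncomm_ring
    rw [h1, map_sub, map_mul, map_mul, toH_rel, toH_rel, zero_mul, mul_zero, sub_zero]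
  have h2 : grp ρ g * kap ρ κL κC v w - kap ρ κL κC (ρ g v) (ρ g w) * grp ρ g ∈
      tensorDegLE ρ 1 :=
    sub_mem (mul_mem_of_le ρ (zero_add 1).le (grp_mem ρ g) (kap_mem ρ κL κC v w))
      (mul_grp_mem ρ (kap_mem ρ κL κC _ _) g)
  have h3 := h 1 _ h2 h0
  rwa [relSpan_eq_bot ρ κL κC one_lt_two] at h3

theorem jacobiator_mem (v₁ v₂ v₃ : V) : jacobiator ρ κL κC v₁ v₂ v₃ ∈ tensorDegLE ρ 2 := by
  have h : ∀ u v w : V, kap ρ κL κC u v * vec ρ w - vec ρ w * kap ρ κL κC u v ∈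
      tensorDegLE ρ 2 := fun u v w =>
    sub_mem (mul_mem_of_le ρ one_add_one_eq_two.le (kap_mem ρ κL κC u v) (vec_mem ρ w))
      (mul_mem_of_le ρ one_add_one_eq_two.le (vec_mem ρ w) (kap_mem ρ κL κC u v))
  exact add_mem (add_mem (h _ _ _) (h _ _ _)) (h _ _ _)

/-- The quadratic commutators satisfy the Jacobi identity in T(V)#G, so the jacobiator is a
combination of commutators with relators, yet its degree is only two. -/
theorem IsPBW.jacobi (h : IsPBW ρ κL κC) (v₁ v₂ v₃ : V) :
    jacobiator ρ κL κC v₁ v₂ v₃ ∈ relSpan ρ κL κC 2 := by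
  refine h 2 _ (jacobiator_mem v₁ v₂ v₃) ?_
  have h1 : jacobiator ρ κL κC v₁ v₂ v₃ =
      (vec ρ v₃ * rel ρ κL κC v₁ v₂ - rel ρ κL κC v₁ v₂ * vec ρ v₃) +
      (vec ρ v₁ * rel ρ κL κC v₂ v₃ - rel ρ κL κC v₂ v₃ * vec ρ v₁) +
      (vec ρ v₂ * rel ρ κL κC v₃ v₁ - rel ρ κL κC v₃ v₁ * vec ρ v₂) := by
    simp only [jacobiator, rel]
    noncomm_ring
  rw [h1]
  simp only [map_add, map_sub, map_mul, toH_rel, mul_zero, zero_mul, sub_zero, add_zero]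

/-! ### Reduction of elements of degree at most two -/

variable [DecidableEq G]

variable (κL κC) in
/-- Half of the parameter map, multiplied by `g` and recorded by its components. -/
def halfKap (g : G) : V →ₗ[ℂ] V →ₗ[ℂ] (G → V × ℂ) :=
  (1 / 2 : ℂ) • ∑ h, ((altBilin (κL h)).compr₂
      ((LinearMap.single ℂ (fun _ : G => V × ℂ) (h * g)).comp (LinearMap.inl ℂ V ℂ)) +
    (altBilin (κC h)).compr₂
      ((LinearMap.single ℂ (fun _ : G => V × ℂ) (h * g)).comp (LinearMap.inr ℂ V ℂ)))

theorem halfKap_apply (g : G) (v w : V) (x : G) : halfKap κL κC g v w x =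
    (1 / 2 : ℂ) • (κL (x * g⁻¹) ![v, w], κC (x * g⁻¹) ![v, w]) := by
  have h : halfKap κL κC g v w = (1 / 2 : ℂ) • ∑ h, Pi.single (M := fun _ : G => V × ℂ) (h * g)
      (κL h ![v, w], κC h ![v, w]) := by
    simp only [halfKap, LinearMap.smul_apply, LinearMap.sum_apply, LinearMap.add_apply,
      LinearMap.compr₂_apply, altBilin_apply]
    congr 1
    refine Finset.sum_congr rfl fun h _ => ?_
    change Pi.single (M := fun _ : G => V × ℂ) (h * g) (κL h ![v, w], 0) +
      Pi.single (h * g) (0, κC h ![v, w]) = _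
    rw [← Pi.single_add, Prod.mk_add_mk, add_zero, zero_add]
  rw [h, Pi.smul_apply, Finset.sum_apply, Finset.sum_eq_single (x * g⁻¹)]
  · rw [inv_mul_cancel_right, Pi.single_eq_same]
  · intro y _ hy
    refine Pi.single_eq_of_ne (fun hx => hy ?_) _
    rw [hx, mul_inv_cancel_right]
  · exact fun h => absurd (Finset.mem_univ _) h

theorem halfKap_swap (g : G) (v w : V) : halfKap κL κC g v w = -halfKap κL κC g w v := by
  funext x
  rw [Pi.neg_apply, halfKap_apply, halfKap_apply, alt_swap (κL _) v w, alt_swap (κC _) v w]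
  simp

variable (ρ κL κC) in
/-- The linear map which reduces products of two vectors to half of their commutator, and keeps
elements of degree at most one. -/
def reduce : TensorSkew ρ →ₗ[ℂ] (G → V × ℂ) :=
  let b := Module.Basis.ofVectorSpace ℂ V
  (wordBasis ρ b).constr ℂ fun p => match p.2 with
    | [] => Pi.single p.1 (0, 1)
    | [i] => Pi.single p.1 (b i, 0)
    | [i, j] => halfKap κL κC p.1 (b i) (b j)
    | _ => 0

theorem reduce_grp (g : G) : reduce ρ κL κC (grp ρ g) = Pi.single g (0, 1) := by
  have h := (wordBasis ρ (Module.Basis.ofVectorSpace ℂ V)).constr_basis ℂ (fun p => match p.2 with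
    | [] => Pi.single p.1 ((0 : V), (1 : ℂ))
    | [i] => Pi.single p.1 (Module.Basis.ofVectorSpace ℂ V i, 0)
    | [i, j] => halfKap κL κC p.1 (Module.Basis.ofVectorSpace ℂ V i)
        (Module.Basis.ofVectorSpace ℂ V j)
    | _ => 0) (g, [])
  rwa [wordBasis_apply, mon_nil, one_mul] at h

theorem reduce_vec_grp (v : V) (g : G) :
    reduce ρ κL κC (vec ρ v * grp ρ g) = Pi.single g (v, 0) := by
  let b := Module.Basis.ofVectorSpace ℂ V
  have h : (reduce ρ κL κC).comp ((LinearMap.mulRight ℂ (grp ρ g)).comp (vecL ρ)) =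
      (LinearMap.single ℂ (fun _ : G => V × ℂ) g).comp (LinearMap.inl ℂ V ℂ) := by
    refine b.ext fun i => ?_
    have h := (wordBasis ρ b).constr_basis ℂ (fun p => match p.2 with
      | [] => Pi.single p.1 ((0 : V), (1 : ℂ))
      | [i] => Pi.single p.1 (b i, 0)
      | [i, j] => halfKap κL κC p.1 (b i) (b j)
      | _ => 0) (g, [i])
    rw [wordBasis_apply, mon_cons, mon_nil, mul_one] at h
    exact h
  exact LinearMap.congr_fun h v

theorem reduce_vec_vec_grp (v w : V) (g : G) :
    reduce ρ κL κC (vec ρ v * vec ρ w * grp ρ g) = halfKap κL κC g v w := by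
  let b := Module.Basis.ofVectorSpace ℂ V
  have h : ((LinearMap.mul ℂ (TensorSkew ρ)).compl₁₂ (vecL ρ) (vecL ρ)).compr₂
      ((reduce ρ κL κC).comp (LinearMap.mulRight ℂ (grp ρ g))) = halfKap κL κC g := by
    refine b.ext fun i => b.ext fun j => ?_
    have h := (wordBasis ρ b).constr_basis ℂ (fun p => match p.2 with
      | [] => Pi.single p.1 ((0 : V), (1 : ℂ))
      | [i] => Pi.single p.1 (b i, 0)
      | [i, j] => halfKap κL κC p.1 (b i) (b j)
      | _ => 0) (g, [i, j])
    rw [wordBasis_apply, mon_cons, mon_cons, mon_nil, mul_one] at h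
    exact h
  exact LinearMap.congr_fun₂ h v w

/-- In degree at most one nothing is reduced, so the recorded components determine the element. -/
theorem eq_sum_reduce {z : TensorSkew ρ} (hz : z ∈ tensorDegLE ρ 1) :
    z = ∑ g, (vec ρ (reduce ρ κL κC z g).1 * grp ρ g + (reduce ρ κL κC z g).2 • grp ρ g) := by
  let b := Module.Basis.ofVectorSpace ℂ V
  rw [tensorDegLE_eq_span ρ b] at hz
  induction hz using Submodule.span_induction with
  | mem z hz =>
    obtain ⟨g, w, hw, rfl⟩ := hz
    match w, hw with
    | [], _ =>
      rw [mon_nil, one_mul, reduce_grp, Finset.sum_eq_single g]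
      · simp [vec_zero]
      · intro h _ hg
        rw [Pi.single_eq_of_ne hg]
        simp [vec_zero]
      · exact fun h => absurd (Finset.mem_univ _) h
    | [i], _ =>
      rw [mon_cons, mon_nil, mul_one, reduce_vec_grp, Finset.sum_eq_single g]
      · simp
      · intro h _ hg
        rw [Pi.single_eq_of_ne hg]
        simp [vec_zero]
      · exact fun h => absurd (Finset.mem_univ _) h
    | _ :: _ :: _, hw => simp at hw
  | zero => simp [vec_zero]
  | add x y _ _ hx hy =>
    conv_lhs => rw [hx, hy]
    rw [map_add, ← Finset.sum_add_distrib]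
    refine Finset.sum_congr rfl fun g _ => ?_
    rw [Pi.add_apply, Prod.fst_add, Prod.snd_add, vec_add, add_mul, add_smul]
    abel
  | smul c x _ hx =>
    conv_lhs => rw [hx]
    rw [map_smul, Finset.smul_sum]
    refine Finset.sum_congr rfl fun g _ => ?_
    rw [Pi.smul_apply, Prod.smul_fst, Prod.smul_snd, vec_smul, smul_add, smul_mul_assoc,
      smul_assoc]

theorem reduce_sum (f : G → V) (c : G → ℂ) (e : G ≃ G) (x : G) :
    reduce ρ κL κC (∑ g, (vec ρ (f g) * grp ρ (e g) + c g • grp ρ (e g))) x =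
      (f (e.symm x), c (e.symm x)) := by
  rw [map_sum, Finset.sum_apply, Finset.sum_eq_single (e.symm x)]
  · rw [map_add, map_smul, reduce_vec_grp, reduce_grp, Equiv.apply_symm_apply, Pi.add_apply,
      Pi.smul_apply, Pi.single_eq_same, Pi.single_eq_same]
    simp
  · intro g _ hg
    have h : x ≠ e g := fun h => hg (by rw [h, Equiv.symm_apply_apply])
    rw [map_add, map_smul, reduce_vec_grp, reduce_grp, Pi.add_apply, Pi.smul_apply,
      Pi.single_eq_of_ne h, Pi.single_eq_of_ne h]
    simp
  · exact fun h => absurd (Finset.mem_univ _) h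

omit [DecidableEq G] in
theorem kap_mul_grp (v w : V) (g : G) : kap ρ κL κC v w * grp ρ g =
    ∑ h, (vec ρ (κL h ![v, w]) * grp ρ (Equiv.mulRight g h) +
      κC h ![v, w] • grp ρ (Equiv.mulRight g h)) := by
  rw [kap_apply, Finset.sum_mul]
  refine Finset.sum_congr rfl fun h _ => ?_
  rw [add_mul, smul_mul_assoc, mul_assoc, grp_mul_grp]
  rfl

omit [DecidableEq G] in
theorem grp_mul_kap (v w : V) (g : G) : grp ρ g * kap ρ κL κC v w =
    ∑ h, (vec ρ (ρ g (κL h ![v, w])) * grp ρ (Equiv.mulLeft g h) +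
      κC h ![v, w] • grp ρ (Equiv.mulLeft g h)) := by
  rw [kap_apply, Finset.mul_sum]
  refine Finset.sum_congr rfl fun h _ => ?_
  rw [mul_add, mul_smul_comm, ← mul_assoc, grp_mul_vec, mul_assoc, grp_mul_grp]
  rfl

/-- Compare coefficients at gh: passing g across κ turns the component at h into the one at ghg⁻¹.
-/
theorem kapInvariant_iff : KapInvariant ρ κL κC ↔
    (∀ g h v w, ρ g (κL h ![v, w]) = κL (g * h * g⁻¹) ![ρ g v, ρ g w]) ∧
    (∀ g h v w, κC h ![v, w] = κC (g * h * g⁻¹) ![ρ g v, ρ g w]) := by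
  constructor
  · intro H
    have key : ∀ g h v w, (ρ g (κL h ![v, w]), κC h ![v, w]) =
        (κL (g * h * g⁻¹) ![ρ g v, ρ g w], κC (g * h * g⁻¹) ![ρ g v, ρ g w]) := by
      intro g h v w
      have h1 := congrFun (congrArg (reduce ρ κL κC) (H g v w)) (g * h)
      rw [grp_mul_kap, kap_mul_grp, reduce_sum, reduce_sum] at h1
      simpa using h1
    exact ⟨fun g h v w => congrArg Prod.fst (key g h v w),
      fun g h v w => congrArg Prod.snd (key g h v w)⟩
  · rintro ⟨hL, hC⟩ g v w
    rw [grp_mul_kap, kap_mul_grp]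
    refine Fintype.sum_equiv (MulAut.conj g).toEquiv _ _ fun h => ?_
    change _ = vec ρ (κL (g * h * g⁻¹) ![ρ g v, ρ g w]) * grp ρ (g * h * g⁻¹ * g) +
      κC (g * h * g⁻¹) ![ρ g v, ρ g w] • grp ρ (g * h * g⁻¹ * g)
    rw [← hL, ← hC, inv_mul_cancel_right]
    rfl

/-- The two halves contributed by vw and -wv add up to the value of κ which the relator subtracts.
-/
theorem reduce_rel_mul_grp (v w : V) (g : G) :
    reduce ρ κL κC (rel ρ κL κC v w * grp ρ g) = 0 := by
  funext x
  rw [rel, sub_mul, sub_mul, map_sub, map_sub, reduce_vec_vec_grp, reduce_vec_vec_grp,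
    halfKap_swap g w v, sub_neg_eq_add, kap_mul_grp, Pi.sub_apply, Pi.add_apply, reduce_sum,
    halfKap_apply, ← add_smul]
  norm_num

/-- One summand of the linear part of the reduced jacobiator. -/
def linTerm (ρ : Representation ℂ G V) (κL : LinCochain G V) (κC : ConstCochain G V)
    (g : G) (v₁ v₂ v₃ : V) : V :=
  (1 / 2 : ℂ) • ∑ y, κL (g * y⁻¹) ![κL y ![v₁, v₂], ρ y v₃ + v₃] +
    κC g ![v₁, v₂] • (ρ g v₃ - v₃)

/-- One summand of the constant part of the reduced jacobiator. -/
def constTerm (ρ : Representation ℂ G V) (κL : LinCochain G V) (κC : ConstCochain G V)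
    (g : G) (v₁ v₂ v₃ : V) : ℂ :=
  (1 / 2 : ℂ) • ∑ y, κC (g * y⁻¹) ![κL y ![v₁, v₂], ρ y v₃ + v₃]

omit [DecidableEq G] in
theorem kap_commutator (v₁ v₂ v₃ : V) :
    kap ρ κL κC v₁ v₂ * vec ρ v₃ - vec ρ v₃ * kap ρ κL κC v₁ v₂ =
      ∑ y, (vec ρ (κL y ![v₁, v₂]) * vec ρ (ρ y v₃) * grp ρ y -
        vec ρ v₃ * vec ρ (κL y ![v₁, v₂]) * grp ρ y +
        κC y ![v₁, v₂] • (vec ρ (ρ y v₃ - v₃) * grp ρ y)) := by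
  rw [kap_apply, Finset.sum_mul, Finset.mul_sum, ← Finset.sum_sub_distrib]
  refine Finset.sum_congr rfl fun y _ => ?_
  rw [add_mul, mul_add, mul_assoc, grp_mul_vec, smul_mul_assoc, mul_smul_comm, grp_mul_vec,
    vec_sub, sub_mul, smul_sub, ← mul_assoc, ← mul_assoc]
  abel

/-- Pulling the group element to the right gives κᴸ_y(v₁,v₂)·(y v₃) - v₃·κᴸ_y(v₁,v₂). Halved
commutators turn this difference of products into κ paired with the sum y v₃ + v₃. -/
theorem reduce_kap_commutator (v₁ v₂ v₃ : V) (g : G) :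
    reduce ρ κL κC (kap ρ κL κC v₁ v₂ * vec ρ v₃ - vec ρ v₃ * kap ρ κL κC v₁ v₂) g =
      (linTerm ρ κL κC g v₁ v₂ v₃, constTerm ρ κL κC g v₁ v₂ v₃) := by
  have h1 : ∑ y, reduce ρ κL κC (κC y ![v₁, v₂] • (vec ρ (ρ y v₃ - v₃) * grp ρ y)) g =
      (κC g ![v₁, v₂] • (ρ g v₃ - v₃), 0) := by
    rw [Finset.sum_eq_single g]
    · rw [map_smul, reduce_vec_grp, Pi.smul_apply, Pi.single_eq_same, Prod.smul_mk, smul_zero]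
    · intro y _ hy
      rw [map_smul, reduce_vec_grp, Pi.smul_apply, Pi.single_eq_of_ne hy.symm, smul_zero]
    · exact fun h => absurd (Finset.mem_univ _) h
  have h2 : ∀ y, halfKap κL κC y (κL y ![v₁, v₂]) (ρ y v₃) g -
      halfKap κL κC y v₃ (κL y ![v₁, v₂]) g =
      (1 / 2 : ℂ) • (κL (g * y⁻¹) ![κL y ![v₁, v₂], ρ y v₃ + v₃],
        κC (g * y⁻¹) ![κL y ![v₁, v₂], ρ y v₃ + v₃]) := by
    intro y
    rw [halfKap_swap y v₃, Pi.neg_apply, sub_neg_eq_add, ← Pi.add_apply, ← map_add,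
      halfKap_apply]
  rw [kap_commutator, map_sum, Finset.sum_apply]
  simp only [map_add, map_sub, Pi.add_apply, Pi.sub_apply, reduce_vec_vec_grp]
  rw [Finset.sum_add_distrib, h1, Finset.sum_congr rfl fun y _ => h2 y, linTerm, constTerm,
    ← Finset.smul_sum]
  ext1
  · rw [Prod.fst_add, Prod.smul_fst, Prod.fst_sum]
  · rw [Prod.snd_add, Prod.smul_snd, Prod.snd_sum, add_zero]

omit [DecidableEq G] in
theorem symbol_kap_commutator (v₁ v₂ v₃ : V) :
    symbol ρ 2 (kap ρ κL κC v₁ v₂ * vec ρ v₃ - vec ρ v₃ * kap ρ κL κC v₁ v₂) =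
      ∑ y, SkewMonoidAlgebra.single y
        (sι ρ (κL y ![v₁, v₂]) * (sι ρ (ρ y v₃) - sι ρ v₃)) := by
  rw [kap_commutator, map_sum]
  refine Finset.sum_congr rfl fun y _ => ?_
  have h1 : ∀ v w : V, symbol ρ 2 (vec ρ v * vec ρ w * grp ρ y) =
      SkewMonoidAlgebra.single y (sι ρ v * sι ρ w) := by
    intro v w
    rw [symbol_apply, map_mul (skewToSym ρ), map_mul (skewToSym ρ), vec, vec, grp, skewToSym_single, skewToSym_single,
      skewToSym_single, tensorToSym_ι, tensorToSym_ι, map_one, sym_single_mul_single,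
      sym_single_mul_single, map_one, symAct_one, AlgHom.id_apply, mul_one, mul_one, one_mul]
    refine symProj_self ρ (Submodule.subset_span ⟨y, _, ?_, rfl⟩)
    rw [pow_two]
    exact Submodule.mul_mem_mul ⟨v, rfl⟩ ⟨w, rfl⟩
  rw [map_add, map_sub, map_smul, h1, h1,
    symbol_eq_zero ρ one_lt_two (mul_grp_mem ρ (vec_mem ρ _) y), smul_zero, add_zero, mul_sub,
    mul_comm (sι ρ v₃)]
  exact (map_sub (SkewMonoidAlgebra.singleAddHom (k := SymAlg ρ) y) _ _).symm

/-- Zero symbol writes z as a visible relation plus a remainder of degree at most one. Reduction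
kills the first and is faithful on the second. -/
theorem mem_relSpan_two_iff (hinv : KapInvariant ρ κL κC) [FiniteDimensional ℂ V]
    {z : TensorSkew ρ} (hz : z ∈ tensorDegLE ρ 2) :
    z ∈ relSpan ρ κL κC 2 ↔ symbol ρ 2 z = 0 ∧ reduce ρ κL κC z = 0 := by
  have hred : ∀ y ∈ relSpan ρ κL κC 2, reduce ρ κL κC y = 0 := by
    intro y hy
    have h1 := hinv.relSpan_le_span (Module.finBasis ℂ V) 2 hy
    clear hy
    induction h1 using Submodule.span_induction with
    | mem y hy =>
      obtain ⟨u, u', i, j, g, hd, rfl⟩ := hy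
      have hu : u = [] := List.eq_nil_of_length_eq_zero (by omega)
      have hu' : u' = [] := List.eq_nil_of_length_eq_zero (by omega)
      subst hu hu'
      rw [mon_nil, one_mul, one_mul, reduce_rel_mul_grp]
    | zero => exact map_zero _
    | add x y _ _ hx hy => rw [map_add, hx, hy, add_zero]
    | smul c x _ hx => rw [map_smul, hx, smul_zero]
  refine ⟨fun h => ⟨symbol_of_mem_relSpan ρ κL κC h, hred z h⟩, fun ⟨h1, h2⟩ => ?_⟩
  obtain ⟨x, hx, y, hy, rfl⟩ := Submodule.mem_sup.1 (mem_sup_of_symbol_eq_zero ρ κL κC hz h1)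
  rw [map_add, hred x hx, zero_add] at h2
  have hy0 : y = 0 := by
    rw [eq_sum_reduce (κL := κL) (κC := κC) (show y ∈ tensorDegLE ρ 1 from hy), h2]
    simp [vec_zero]
  rwa [hy0, add_zero]

/-- The conditions on a parameter map which are equivalent to the PBW property. -/
structure PBWConditions (ρ : Representation ℂ G V) (κL : LinCochain G V)
    (κC : ConstCochain G V) : Prop where
  lin_inv : ∀ g h v w, ρ g (κL h ![v, w]) = κL (g * h * g⁻¹) ![ρ g v, ρ g w]
  const_inv : ∀ g h v w, κC h ![v, w] = κC (g * h * g⁻¹) ![ρ g v, ρ g w]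
  sym : ∀ g v₁ v₂ v₃, sι ρ (κL g ![v₁, v₂]) * (sι ρ (ρ g v₃) - sι ρ v₃) +
    sι ρ (κL g ![v₂, v₃]) * (sι ρ (ρ g v₁) - sι ρ v₁) +
    sι ρ (κL g ![v₃, v₁]) * (sι ρ (ρ g v₂) - sι ρ v₂) = 0
  lin : ∀ g v₁ v₂ v₃, linTerm ρ κL κC g v₁ v₂ v₃ + linTerm ρ κL κC g v₂ v₃ v₁ +
    linTerm ρ κL κC g v₃ v₁ v₂ = 0
  const : ∀ g v₁ v₂ v₃, constTerm ρ κL κC g v₁ v₂ v₃ + constTerm ρ κL κC g v₂ v₃ v₁ +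
    constTerm ρ κL κC g v₃ v₁ v₂ = 0

omit [DecidableEq G] in
theorem symbol_jacobiator_eq_zero_iff (v₁ v₂ v₃ : V) :
    symbol ρ 2 (jacobiator ρ κL κC v₁ v₂ v₃) = 0 ↔
      ∀ g, sι ρ (κL g ![v₁, v₂]) * (sι ρ (ρ g v₃) - sι ρ v₃) +
        sι ρ (κL g ![v₂, v₃]) * (sι ρ (ρ g v₁) - sι ρ v₁) +
        sι ρ (κL g ![v₃, v₁]) * (sι ρ (ρ g v₂) - sι ρ v₂) = 0 := by
  have hc : ∀ (f : G → SymAlg ρ) (g : G),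
      (∑ y, (SkewMonoidAlgebra.single y (f y) : SymSkew ρ)).coeff g = f g := by
    intro f g
    have h : (∑ y, (SkewMonoidAlgebra.single y (f y) : SymSkew ρ)).coeff =
        ∑ y, Finsupp.single y (f y) :=
      map_sum (SkewMonoidAlgebra.coeffLinearEquiv (S := ℂ) (k := SymAlg ρ) (G := G)) _ _
    rw [h, Finsupp.finsetSum_apply, Finset.sum_eq_single g]
    · exact Finsupp.single_eq_same
    · exact fun y _ hy => Finsupp.single_eq_of_ne hy.symm
    · exact fun h => absurd (Finset.mem_univ _) h
  rw [jacobiator, map_add, map_add, symbol_kap_commutator, symbol_kap_commutator,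
    symbol_kap_commutator, SkewMonoidAlgebra.ext_iff]
  refine forall_congr' fun g => ?_
  rw [SkewMonoidAlgebra.coeff_add, SkewMonoidAlgebra.coeff_add, Finsupp.add_apply,
    Finsupp.add_apply, hc, hc, hc]
  rfl

theorem reduce_jacobiator_eq_zero_iff (v₁ v₂ v₃ : V) :
    reduce ρ κL κC (jacobiator ρ κL κC v₁ v₂ v₃) = 0 ↔ ∀ g,
      linTerm ρ κL κC g v₁ v₂ v₃ + linTerm ρ κL κC g v₂ v₃ v₁ +
        linTerm ρ κL κC g v₃ v₁ v₂ = 0 ∧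
      constTerm ρ κL κC g v₁ v₂ v₃ + constTerm ρ κL κC g v₂ v₃ v₁ +
        constTerm ρ κL κC g v₃ v₁ v₂ = 0 := by
  rw [funext_iff]
  refine forall_congr' fun g => ?_
  rw [jacobiator, map_add, map_add, Pi.add_apply, Pi.add_apply, reduce_kap_commutator,
    reduce_kap_commutator, reduce_kap_commutator]
  exact Prod.ext_iff

theorem isDrinfeldOrbifoldAlgebra_iff [FiniteDimensional ℂ V] :
    IsDrinfeldOrbifoldAlgebra ρ κL κC ↔ PBWConditions ρ κL κC := by
  rw [isDrinfeldOrbifoldAlgebra_iff_isPBW]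
  constructor
  · intro h
    have hinv := h.kapInvariant
    have hj := fun v₁ v₂ v₃ =>
      (mem_relSpan_two_iff hinv (jacobiator_mem v₁ v₂ v₃)).1 (h.jacobi v₁ v₂ v₃)
    have hr := fun v₁ v₂ v₃ => (reduce_jacobiator_eq_zero_iff v₁ v₂ v₃).1 (hj v₁ v₂ v₃).2
    exact ⟨(kapInvariant_iff.1 hinv).1, (kapInvariant_iff.1 hinv).2,
      fun g v₁ v₂ v₃ => (symbol_jacobiator_eq_zero_iff v₁ v₂ v₃).1 (hj v₁ v₂ v₃).1 g,
      fun g v₁ v₂ v₃ => (hr v₁ v₂ v₃ g).1, fun g v₁ v₂ v₃ => (hr v₁ v₂ v₃ g).2⟩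
  · intro h
    have hinv : KapInvariant ρ κL κC := kapInvariant_iff.2 ⟨h.lin_inv, h.const_inv⟩
    refine isPBW_of_jacobi hinv fun v₁ v₂ v₃ =>
      (mem_relSpan_two_iff hinv (jacobiator_mem v₁ v₂ v₃)).2 ⟨?_, ?_⟩
    · exact (symbol_jacobiator_eq_zero_iff v₁ v₂ v₃).2 fun g => h.sym g v₁ v₂ v₃
    · exact (reduce_jacobiator_eq_zero_iff v₁ v₂ v₃).2
        fun g => ⟨h.lin g v₁ v₂ v₃, h.const g v₁ v₂ v₃⟩

end Components

/-! ### Relators of a spanning set suffice. -/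

section GeneratingSets

variable {G V : Type*} [Group G] [AddCommGroup V] [Module ℂ V] [Fintype G]
variable (ρ : Representation ℂ G V) (κL : LinCochain G V) (κC : ConstCochain G V)

/-- `polyRelator` as a bilinear map. -/
def polyRelatorBilin : V →ₗ[ℂ] V →ₗ[ℂ] (TensorSkew ρ)[X] :=
  LinearMap.mk₂ ℂ (polyRelator ρ κL κC)
    (fun u v w => by
      simp only [polyRelator, linVal_eq, constVal_eq, ← altBilin_apply, map_add, vec_add,
        LinearMap.add_apply, add_mul, mul_add, add_smul, Finset.sum_add_distrib, map_sub]
      abel)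
    (fun c v w => by
      simp only [polyRelator, linVal_eq, constVal_eq, ← altBilin_apply, map_smul, vec_smul,
        LinearMap.smul_apply, smul_mul_assoc, mul_smul_comm, ← Finset.smul_sum,
        smul_assoc, ← Polynomial.smul_C, smul_sub, map_sub])
    (fun u v w => by
      simp only [polyRelator, linVal_eq, constVal_eq, ← altBilin_apply, map_add, vec_add,
        add_mul, mul_add, add_smul, Finset.sum_add_distrib, map_sub]
      abel)
    (fun c v w => by
      simp only [polyRelator, linVal_eq, constVal_eq, ← altBilin_apply, map_smul, vec_smul,
        smul_mul_assoc, mul_smul_comm, ← Finset.smul_sum,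
        smul_assoc, ← Polynomial.smul_C, smul_sub, map_sub])

attribute [local instance] Polynomial.algebra in
/-- The relators of a generating set generate all relators. -/
theorem nonempty_algEquiv_HPoly {B : Set V} (hB : Submodule.span ℂ B = ⊤) :
    Nonempty (HPolyOn ρ κL κC B ≃ₐ[ℂ[X]] HPoly ρ κL κC) := by
  let r : (TensorSkew ρ)[X] → (TensorSkew ρ)[X] → Prop :=
    fun p q => p ∈ {p | ∃ v ∈ B, ∃ w ∈ B, p = polyRelator ρ κL κC v w} ∧ q = 0
  let s : (TensorSkew ρ)[X] → (TensorSkew ρ)[X] → Prop :=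
    fun p q => p ∈ {p | ∃ v ∈ Set.univ, ∃ w ∈ Set.univ, p = polyRelator ρ κL κC v w} ∧ q = 0
  have h1 : ∀ ⦃x y⦄, r x y → RingQuot.mkAlgHom ℂ[X] s x = RingQuot.mkAlgHom ℂ[X] s y := by
    rintro x y ⟨⟨v, _, w, _, rfl⟩, rfl⟩
    exact RingQuot.mkAlgHom_rel ℂ[X] (s := s) ⟨⟨v, trivial, w, trivial, rfl⟩, rfl⟩
  have h2 : ∀ v w, RingQuot.mkAlgHom ℂ[X] r (polyRelatorBilin ρ κL κC v w) = 0 := by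
    intro v w
    have hv : v ∈ Submodule.span ℂ B := hB ▸ Submodule.mem_top
    have hw : w ∈ Submodule.span ℂ B := hB ▸ Submodule.mem_top
    -- The quotient maps are used as ℂ[t]-algebra maps, so complex scalars are rewritten as
    -- multiplication by constants.
    have hsmul : ∀ (c : ℂ) (p : (TensorSkew ρ)[X]), c • p =
        Polynomial.C (algebraMap ℂ (TensorSkew ρ) c) * p := by
      intro c p
      rw [Polynomial.C_mul', algebraMap_smul]
    induction hv using Submodule.span_induction with
    | mem v hv =>
      induction hw using Submodule.span_induction with
      | mem w hw =>
        have := RingQuot.mkAlgHom_rel ℂ[X] (s := r) ⟨⟨v, hv, w, hw, rfl⟩, rfl⟩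
        rwa [map_zero] at this
      | zero => rw [map_zero, map_zero]
      | add x y _ _ hx hy => rw [map_add, map_add, hx, hy, add_zero]
      | smul c x _ hx => rw [map_smul, hsmul, map_mul, hx, mul_zero]
    | zero => rw [map_zero, LinearMap.zero_apply, map_zero]
    | add x y _ _ hx hy => rw [map_add, LinearMap.add_apply, map_add, hx, hy, add_zero]
    | smul c x _ hx => rw [map_smul, LinearMap.smul_apply, hsmul, map_mul, hx, mul_zero]
  have h3 : ∀ ⦃x y⦄, s x y → RingQuot.mkAlgHom ℂ[X] r x = RingQuot.mkAlgHom ℂ[X] r y := by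
    rintro x y ⟨⟨v, _, w, _, rfl⟩, rfl⟩
    rw [map_zero]
    exact h2 v w
  refine ⟨AlgEquiv.ofAlgHom (RingQuot.liftAlgHom ℂ[X] ⟨RingQuot.mkAlgHom ℂ[X] s, h1⟩)
    (RingQuot.liftAlgHom ℂ[X] ⟨RingQuot.mkAlgHom ℂ[X] r, h3⟩) ?_ ?_⟩
  · refine RingQuot.ringQuot_ext' ℂ[X] _ _ (AlgHom.ext fun x => ?_)
    change RingQuot.liftAlgHom ℂ[X] _ (RingQuot.liftAlgHom ℂ[X] _ (RingQuot.mkAlgHom ℂ[X] s x)) =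
      RingQuot.mkAlgHom ℂ[X] s x
    rw [RingQuot.liftAlgHom_mkAlgHom_apply, RingQuot.liftAlgHom_mkAlgHom_apply]
  · refine RingQuot.ringQuot_ext' ℂ[X] _ _ (AlgHom.ext fun x => ?_)
    change RingQuot.liftAlgHom ℂ[X] _ (RingQuot.liftAlgHom ℂ[X] _ (RingQuot.mkAlgHom ℂ[X] r x)) =
      RingQuot.mkAlgHom ℂ[X] r x
    rw [RingQuot.liftAlgHom_mkAlgHom_apply, RingQuot.liftAlgHom_mkAlgHom_apply]

end GeneratingSets

/-! ### Coordinates on V, alternating forms, and closed formulas for the cochains. -/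

section Coordinates

variable {n : ℕ}

/-- The coefficient of `x_i`. -/
def cx (i : Fin n) : DoubledSpace n →ₗ[ℂ] ℂ :=
  (Module.Dual.eval ℂ (Fin n → ℂ) (Pi.single i 1)).comp (LinearMap.fst ℂ _ _)

/-- The coefficient of `y_i`. -/
def cy (i : Fin n) : DoubledSpace n →ₗ[ℂ] ℂ := (LinearMap.proj i).comp (LinearMap.snd ℂ _ _)

@[simp] theorem cx_xv (i j : Fin n) : cx i (xv j) = if i = j then 1 else 0 := by
  change (Pi.single i (1 : ℂ) : Fin n → ℂ) j = _
  rw [Pi.single_apply]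
  simp only [eq_comm]

@[simp] theorem cx_yv (i j : Fin n) : cx i (yv j) = 0 := rfl

@[simp] theorem cy_xv (i j : Fin n) : cy i (xv j) = 0 := rfl

@[simp] theorem cy_yv (i j : Fin n) : cy i (yv j) = if i = j then 1 else 0 :=
  Pi.single_apply j 1 i

theorem doubled_ext {v w : DoubledSpace n} (hx : ∀ i, cx i v = cx i w)
    (hy : ∀ i, cy i v = cy i w) : v = w :=
  Prod.ext (LinearMap.pi_ext' fun i => LinearMap.ext_ring (hx i)) (funext hy)

theorem doubled_eq_sum (v : DoubledSpace n) :
    v = ∑ i, cx i v • xv i + ∑ i, cy i v • yv i := by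
  refine doubled_ext (fun i => ?_) fun i => ?_ <;> simp [map_sum]

theorem span_basisSet : Submodule.span ℂ (basisSet n) = ⊤ := by
  refine eq_top_iff.2 fun v _ => ?_
  rw [doubled_eq_sum v]
  exact add_mem
    (Submodule.sum_mem _ fun i _ => Submodule.smul_mem _ _ (Submodule.subset_span (.inl ⟨i, rfl⟩)))
    (Submodule.sum_mem _ fun i _ => Submodule.smul_mem _ _ (Submodule.subset_span (.inr ⟨i, rfl⟩)))

@[simp] theorem cx_rep (g : Equiv.Perm (Fin n)) (i : Fin n) (v : DoubledSpace n) :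
    cx i (doubledRep n g v) = cx (g.symm i) v := by
  conv_lhs => rw [doubled_eq_sum v]
  simp [map_sum, doubledRep_xv, doubledRep_yv, ← Equiv.symm_apply_eq]

@[simp] theorem cy_rep (g : Equiv.Perm (Fin n)) (i : Fin n) (v : DoubledSpace n) :
    cy i (doubledRep n g v) = cy (g.symm i) v := by
  conv_lhs => rw [doubled_eq_sum v]
  simp [map_sum, doubledRep_xv, doubledRep_yv, ← Equiv.symm_apply_eq]

theorem alt_ext {N : Type*} [AddCommGroup N] [Module ℂ N]
    {f f' : DoubledSpace n [⋀^Fin 2]→ₗ[ℂ] N}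
    (hxx : ∀ i j, i ≠ j → f ![xv i, xv j] = f' ![xv i, xv j])
    (hyy : ∀ i j, i ≠ j → f ![yv i, yv j] = f' ![yv i, yv j])
    (hxy : ∀ i j, f ![xv i, yv j] = f' ![xv i, yv j]) : f = f' := by
  have h : altBilin f = altBilin f' := by
    refine LinearMap.ext_on span_basisSet ?_
    rintro _ (⟨i, rfl⟩ | ⟨i, rfl⟩) <;> refine LinearMap.ext_on span_basisSet ?_ <;>
      rintro _ (⟨j, rfl⟩ | ⟨j, rfl⟩) <;> simp only [altBilin_apply]
    · by_cases h : i = j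
      · rw [h, alt_self, alt_self]
      · exact hxx i j h
    · exact hxy i j
    · rw [alt_swap f, alt_swap f', hxy]
    · by_cases h : i = j
      · rw [h, alt_self, alt_self]
      · exact hyy i j h
  ext v
  have hv : v = ![v 0, v 1] := by ext i : 1; fin_cases i <;> rfl
  rw [hv]
  exact LinearMap.congr_fun₂ h (v 0) (v 1)

/-! ### Alternating forms -/

/-- The alternating form `(v, w) ↦ f(v) h(w) - f(w) h(v)`. -/
def wedge {V : Type*} [AddCommGroup V] [Module ℂ V] (f h : V →ₗ[ℂ] ℂ) :
    V [⋀^Fin 2]→ₗ[ℂ] ℂ where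
  toFun v := f (v 0) * h (v 1) - f (v 1) * h (v 0)
  map_update_add' v i x y := by
    fin_cases i <;> simp <;> ring
  map_update_smul' v i c x := by
    fin_cases i <;> simp <;> ring
  map_eq_zero_of_eq' v i j h hij := by
    have h' : v 0 = v 1 := by
      fin_cases i <;> fin_cases j <;> first | exact absurd rfl hij | exact h | exact h.symm
    simp [h']

@[simp] theorem wedge_apply {V : Type*} [AddCommGroup V] [Module ℂ V] (f h : V →ₗ[ℂ] ℂ)
    (v w : V) : wedge f h ![v, w] = f v * h w - f w * h v := rfl

/-- Evaluation of alternating maps. -/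
def evalAlt {V N : Type*} [AddCommGroup V] [Module ℂ V] [AddCommGroup N] [Module ℂ N]
    (v w : V) : (V [⋀^Fin 2]→ₗ[ℂ] N) →ₗ[ℂ] N where
  toFun f := f ![v, w]
  map_add' _ _ := rfl
  map_smul' _ _ := rfl

theorem evalAlt_apply {V N : Type*} [AddCommGroup V] [Module ℂ V] [AddCommGroup N] [Module ℂ N]
    (v w : V) (f : V [⋀^Fin 2]→ₗ[ℂ] N) : evalAlt v w f = f ![v, w] := rfl

/-- The form with kernel the fixed space of the transposition `(i j)`. -/
def om (i j : Fin n) : DoubledSpace n [⋀^Fin 2]→ₗ[ℂ] ℂ := wedge (cx i - cx j) (cy i - cy j)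

theorem om_apply (i j : Fin n) (v w : DoubledSpace n) : om i j ![v, w] =
    (cx i v - cx j v) * (cy i w - cy j w) - (cx i w - cx j w) * (cy i v - cy j v) := rfl

theorem om_comm (i j : Fin n) : om i j = om j i := by
  refine alt_ext (fun k l _ => ?_) (fun k l _ => ?_) fun k l => ?_ <;>
    simp only [om_apply] <;> ring

theorem om_self (i : Fin n) : om i i = 0 := by
  rw [om, sub_self, sub_self]
  refine alt_ext (fun k l _ => ?_) (fun k l _ => ?_) fun k l => ?_ <;> simp

/-- The functional `v ↦ (a - a') y_i(v) - (b - b') x_i(v)`. -/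
def ell (a a' b b' : ℂ) (i : Fin n) : DoubledSpace n →ₗ[ℂ] ℂ :=
  (a - a') • cy i - (b - b') • cx i

theorem ell_apply (a a' b b' : ℂ) (i : Fin n) (v : DoubledSpace n) :
    ell a a' b b' i v = (a - a') * cy i v - (b - b') * cx i v := rfl

/-- The component of the constant cochain at the `3`-cycle `(i j k)`. -/
def triForm (a a' b b' : ℂ) (i j k : Fin n) : DoubledSpace n [⋀^Fin 2]→ₗ[ℂ] ℂ :=
  wedge (ell a a' b b' i) (ell a a' b b' j) + wedge (ell a a' b b' j) (ell a a' b b' k) +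
    wedge (ell a a' b b' k) (ell a a' b b' i)

theorem triForm_apply (a a' b b' : ℂ) (i j k : Fin n) (v w : DoubledSpace n) :
    triForm a a' b b' i j k ![v, w] =
      (ell a a' b b' i v * ell a a' b b' j w - ell a a' b b' i w * ell a a' b b' j v) +
      (ell a a' b b' j v * ell a a' b b' k w - ell a a' b b' j w * ell a a' b b' k v) +
      (ell a a' b b' k v * ell a a' b b' i w - ell a a' b b' k w * ell a a' b b' i v) := rfl

/-- The component of the constant cochain at the identity. -/
def diagForm (α β : ℂ) : DoubledSpace n [⋀^Fin 2]→ₗ[ℂ] ℂ :=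
  (α - β) • ∑ i, wedge (cx i) (cy i) + β • wedge (∑ i, cx i) (∑ i, cy i)

theorem diagForm_apply (α β : ℂ) (v w : DoubledSpace n) : diagForm α β ![v, w] =
    (α - β) * ∑ i, (cx i v * cy i w - cx i w * cy i v) +
      β * ((∑ i, cx i v) * (∑ i, cy i w) - (∑ i, cx i w) * (∑ i, cy i v)) := by
  simp only [diagForm, ← evalAlt_apply, map_add, map_smul, map_sum, smul_eq_mul]
  simp only [evalAlt_apply, wedge_apply, LinearMap.sum_apply]

/-! ### Sums over transpositions and `3`-cycles -/

section GroupSums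

variable {N N' : Type*} [AddCommGroup N] [Module ℂ N] [AddCommGroup N'] [Module ℂ N']

/-- The sum of the `r i j` over the transpositions `(i j)` equal to `g`. -/
def swapSum (r : Fin n → Fin n → N) (g : Equiv.Perm (Fin n)) : N :=
  (1 / 2 : ℂ) • ∑ i, ∑ j, if g = Equiv.swap i j then r i j else 0

/-- The sum of the `r i j k` over the triples with `g = (i j k)`. -/
def cycSum (r : Fin n → Fin n → Fin n → N) (g : Equiv.Perm (Fin n)) : N :=
  ∑ i, ∑ j, ∑ k, if g = cyc i j k then r i j k else 0

theorem map_swapSum (L : N →ₗ[ℂ] N') (r : Fin n → Fin n → N) (g : Equiv.Perm (Fin n)) :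
    L (swapSum r g) = swapSum (fun i j => L (r i j)) g := by
  simp only [swapSum, map_smul, map_sum]
  simp only [apply_ite L, map_zero]

theorem map_cycSum (L : N →ₗ[ℂ] N') (r : Fin n → Fin n → Fin n → N)
    (g : Equiv.Perm (Fin n)) : L (cycSum r g) = cycSum (fun i j k => L (r i j k)) g := by
  simp only [cycSum, map_sum]
  simp only [apply_ite L, map_zero]

theorem swap_eq_swap {i j k l : Fin n} (hij : i ≠ j) (h : Equiv.swap i j = Equiv.swap k l) :
    (i = k ∧ j = l) ∨ (i = l ∧ j = k) := by
  have h1 : Equiv.swap k l i = j := by rw [← h, Equiv.swap_apply_left]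
  rcases eq_or_ne i k with rfl | hk
  · rw [Equiv.swap_apply_left] at h1
    exact .inl ⟨rfl, h1.symm⟩
  · rcases eq_or_ne i l with rfl | hl
    · rw [Equiv.swap_apply_right] at h1
      exact .inr ⟨rfl, h1.symm⟩
    · rw [Equiv.swap_apply_of_ne_of_ne hk hl] at h1
      exact absurd h1 hij

/-- A transposition arises from two ordered pairs, which the factor 1/2 in `swapSum` compensates. -/
theorem swapSum_swap {r : Fin n → Fin n → N} (hr : ∀ i j, r i j = r j i) {k l : Fin n}
    (hkl : k ≠ l) : swapSum r (Equiv.swap k l) = r k l := by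
  have h : ∀ i j, (if Equiv.swap k l = Equiv.swap i j then r i j else 0) =
      (if i = k ∧ j = l then r k l else 0) + if i = l ∧ j = k then r k l else 0 := by
    intro i j
    by_cases h1 : Equiv.swap k l = Equiv.swap i j
    · rw [if_pos h1]
      rcases swap_eq_swap hkl h1 with ⟨rfl, rfl⟩ | ⟨rfl, rfl⟩
      · rw [if_pos ⟨rfl, rfl⟩, if_neg (fun h => hkl h.1), add_zero]
      · rw [if_neg (fun h => hkl h.2), if_pos ⟨rfl, rfl⟩, zero_add, hr]
    · rw [if_neg h1, if_neg, if_neg, add_zero]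
      · rintro ⟨rfl, rfl⟩
        exact h1 (Equiv.swap_comm _ _)
      · rintro ⟨rfl, rfl⟩
        exact h1 rfl
  simp only [swapSum, h, Finset.sum_add_distrib, ite_and]
  simp only [Finset.sum_ite_irrel, Finset.sum_const_zero, Finset.sum_ite_eq', Finset.mem_univ,
    if_true]
  rw [← two_smul ℂ (r k l), smul_smul]
  norm_num

/-- Diagonal pairs contribute at the identity, since `swap i i = 1`; hence the condition on the r i
i. -/
theorem swapSum_eq_zero {r : Fin n → Fin n → N} (hr : ∀ i, r i i = 0)
    {g : Equiv.Perm (Fin n)} (hg : ∀ i j, i ≠ j → g ≠ Equiv.swap i j) : swapSum r g = 0 := by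
  rw [swapSum, Finset.sum_eq_zero, smul_zero]
  refine fun i _ => Finset.sum_eq_zero fun j _ => ?_
  split_ifs with h
  · by_cases hij : i = j
    · rw [hij, hr]
    · exact absurd h (hg i j hij)
  · rfl

theorem swapSum_one {r : Fin n → Fin n → N} (hr : ∀ i, r i i = 0) : swapSum r 1 = 0 :=
  swapSum_eq_zero hr fun i j hij h => hij (by
    have := congrArg (fun σ : Equiv.Perm (Fin n) => σ i) h
    simpa using this)

theorem sum_apply_swapSum (r : Fin n → Fin n → N) (F : Equiv.Perm (Fin n) → N →ₗ[ℂ] N') :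
    ∑ g, F g (swapSum r g) = (1 / 2 : ℂ) • ∑ i, ∑ j, F (Equiv.swap i j) (r i j) := by
  simp only [map_swapSum]
  simp only [swapSum]
  rw [← Finset.smul_sum, Finset.sum_comm]
  congr 1
  refine Finset.sum_congr rfl fun i _ => ?_
  rw [Finset.sum_comm]
  refine Finset.sum_congr rfl fun j _ => ?_
  rw [Finset.sum_ite_eq' Finset.univ (Equiv.swap i j) fun g => F g (r i j)]
  exact if_pos (Finset.mem_univ _)

theorem cyc_rotate {i j k : Fin n} (hij : i ≠ j) (hjk : j ≠ k) (hik : i ≠ k) :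
    cyc j k i = cyc i j k := by
  rw [cyc, cyc]
  ext m
  by_cases h1 : m = i
  · subst h1
    simp [Equiv.swap_apply_of_ne_of_ne, hij, hik]
  · by_cases h2 : m = j
    · subst h2
      simp [Equiv.swap_apply_of_ne_of_ne, hjk, hij.symm, hjk.symm, hik.symm]
    · by_cases h3 : m = k
      · subst h3
        simp [Equiv.swap_apply_of_ne_of_ne, hij, hik]
      · simp [Equiv.swap_apply_of_ne_of_ne, h1, h2, h3]

/-- A 3-cycle is represented by three rotated triples, so three reindexed copies of the sum add up
to zero term by term. Triples with repeated entries give transpositions or the identity and must be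
excluded separately. -/
theorem cycSum_eq_zero {r : Fin n → Fin n → Fin n → N}
    (h1 : ∀ i k, r i i k = 0) (h2 : ∀ i k, r i k k = 0) (h3 : ∀ i k, r i k i = 0)
    (h : ∀ i j k, i ≠ j → j ≠ k → i ≠ k → r i j k + r j k i + r k i j = 0)
    (g : Equiv.Perm (Fin n)) : cycSum r g = 0 := by
  have e1 : cycSum r g = ∑ i, ∑ j, ∑ k, if g = cyc j k i then r j k i else 0 := by
    rw [cycSum, Finset.sum_comm_cycle]
  have e2 : cycSum r g = ∑ i, ∑ j, ∑ k, if g = cyc k i j then r k i j else 0 := by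
    rw [e1, Finset.sum_comm_cycle]
  have e3 : cycSum r g + cycSum r g + cycSum r g = 0 := by
    nth_rewrite 2 [e1]
    nth_rewrite 2 [e2]
    rw [cycSum, ← Finset.sum_add_distrib, ← Finset.sum_add_distrib]
    refine Finset.sum_eq_zero fun i _ => ?_
    rw [← Finset.sum_add_distrib, ← Finset.sum_add_distrib]
    refine Finset.sum_eq_zero fun j _ => ?_
    rw [← Finset.sum_add_distrib, ← Finset.sum_add_distrib]
    refine Finset.sum_eq_zero fun k _ => ?_
    by_cases hij : i = j
    · subst hij; simp [h1, h2, h3]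
    by_cases hjk : j = k
    · subst hjk; simp [h1, h2, h3]
    by_cases hik : i = k
    · subst hik; simp [h1, h2, h3]
    rw [cyc_rotate hij hjk hik, ← cyc_rotate (i := k) (j := i) (k := j) (Ne.symm hik) hij
      (Ne.symm hjk)]
    split_ifs
    · exact h i j k hij hjk hik
    · simp
  have e4 : (3 : ℂ) • cycSum r g = 0 := by
    rw [← e3]
    module
  exact (smul_eq_zero.1 e4).resolve_left (by norm_num)

end GroupSums

/-! ### The cochains with given parameters -/

/-- The linear cochain with given parameters. -/
def linPart (a a' b b' : ℂ) : LinCochain (Equiv.Perm (Fin n)) (DoubledSpace n) :=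
  swapSum fun i j => (LinearMap.toSpanSingleton ℂ (DoubledSpace n)
    (reflVec a a' b b' i j)).compAlternatingMap (om i j)

/-- The constant cochain with given parameters. -/
def constPart (a a' b b' c α β : ℂ) : ConstCochain (Equiv.Perm (Fin n)) (DoubledSpace n) :=
  fun g => (if g = 1 then diagForm α β else 0) + c • swapSum om g +
    (1 / 3 : ℂ) • cycSum (triForm a a' b b') g

theorem linPart_apply (a a' b b' : ℂ) (g : Equiv.Perm (Fin n)) (v w : DoubledSpace n) :
    linPart a a' b b' g ![v, w] =
      swapSum (fun i j => om i j ![v, w] • reflVec a a' b b' i j) g := by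
  rw [linPart, ← evalAlt_apply, map_swapSum]
  rfl

theorem constPart_apply (a a' b b' c α β : ℂ) (g : Equiv.Perm (Fin n)) (v w : DoubledSpace n) :
    constPart a a' b b' c α β g ![v, w] = (if g = 1 then diagForm α β ![v, w] else 0) +
      c * swapSum (fun i j => om i j ![v, w]) g +
      1 / 3 * cycSum (fun i j k => triForm a a' b b' i j k ![v, w]) g := by
  rw [constPart, ← evalAlt_apply, map_add, map_add, map_smul, map_smul, map_swapSum, map_cycSum,
    apply_ite (evalAlt v w), map_zero]
  rfl

theorem reflVec_comm (a a' b b' : ℂ) (i k : Fin n) :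
    reflVec a a' b b' i k = reflVec a a' b b' k i := by
  rw [reflVec, reflVec, add_comm (xv i), add_comm (yv i)]

theorem linPart_swap (a a' b b' : ℂ) {i j : Fin n} (hij : i ≠ j) (v w : DoubledSpace n) :
    linPart a a' b b' (Equiv.swap i j) ![v, w] = om i j ![v, w] • reflVec a a' b b' i j := by
  rw [linPart_apply, swapSum_swap _ hij]
  intro k l
  rw [om_comm, reflVec_comm]

theorem linPart_eq_zero (a a' b b' : ℂ) {g : Equiv.Perm (Fin n)}
    (hg : ∀ i j, i ≠ j → g ≠ Equiv.swap i j) : linPart a a' b b' g = 0 := by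
  refine swapSum_eq_zero (fun i => ?_) hg
  rw [om_self]
  exact AlternatingMap.ext fun _ => zero_smul ℂ _

@[simp] theorem cx_reflVec (a a' b b' : ℂ) (i j k : Fin n) : cx k (reflVec a a' b b' i j) =
    (a - a') * ((if k = i then 1 else 0) + if k = j then 1 else 0) + a' := by
  simp [reflVec, map_sum]
  split_ifs <;> ring

@[simp] theorem cy_reflVec (a a' b b' : ℂ) (i j k : Fin n) : cy k (reflVec a a' b b' i j) =
    (b - b') * ((if k = i then 1 else 0) + if k = j then 1 else 0) + b' := by
  simp [reflVec, map_sum]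
  split_ifs <;> ring

end Coordinates

/-! ### Cyclic sums, invariance, and products of two transpositions. -/

section Verification

variable {n : ℕ}

/-- The cyclic sum `∑ ω_{ij}(v₁, v₂) v₃`. -/
def cycVec (i j : Fin n) (v₁ v₂ v₃ : DoubledSpace n) : DoubledSpace n :=
  om i j ![v₁, v₂] • v₃ + om i j ![v₂, v₃] • v₁ + om i j ![v₃, v₁] • v₂

theorem cycVec_comm (i j : Fin n) (v₁ v₂ v₃ : DoubledSpace n) :
    cycVec i j v₁ v₂ v₃ = cycVec j i v₁ v₂ v₃ := by
  rw [cycVec, cycVec, om_comm]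

theorem cycVec_self (i : Fin n) (v₁ v₂ v₃ : DoubledSpace n) : cycVec i i v₁ v₂ v₃ = 0 := by
  rw [cycVec, om_self]
  simp

theorem cx_cycVec (i j k : Fin n) (v₁ v₂ v₃ : DoubledSpace n) : cx k (cycVec i j v₁ v₂ v₃) =
    om i j ![v₁, v₂] * cx k v₃ + om i j ![v₂, v₃] * cx k v₁ + om i j ![v₃, v₁] * cx k v₂ := by
  simp [cycVec]

theorem cy_cycVec (i j k : Fin n) (v₁ v₂ v₃ : DoubledSpace n) : cy k (cycVec i j v₁ v₂ v₃) =
    om i j ![v₁, v₂] * cy k v₃ + om i j ![v₂, v₃] * cy k v₁ + om i j ![v₃, v₁] * cy k v₂ := by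
  simp [cycVec]

/-- The functional f = x_i - x_j in coordinates is a factor of ω_ij, and f(c_ij) is a value of f ∧ f
∧ h = 0. -/
theorem cx_cycVec_eq (i j : Fin n) (v₁ v₂ v₃ : DoubledSpace n) :
    cx i (cycVec i j v₁ v₂ v₃) = cx j (cycVec i j v₁ v₂ v₃) := by
  simp only [cx_cycVec, om_apply]
  ring

theorem cy_cycVec_eq (i j : Fin n) (v₁ v₂ v₃ : DoubledSpace n) :
    cy i (cycVec i j v₁ v₂ v₃) = cy j (cycVec i j v₁ v₂ v₃) := by
  simp only [cy_cycVec, om_apply]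
  ring

theorem rep_swap_cycVec (i j : Fin n) (v₁ v₂ v₃ : DoubledSpace n) :
    doubledRep n (Equiv.swap i j) (cycVec i j v₁ v₂ v₃) = cycVec i j v₁ v₂ v₃ := by
  refine doubled_ext (fun k => ?_) fun k => ?_
  · rw [cx_rep, Equiv.symm_swap]
    rcases eq_or_ne k i with rfl | hi
    · rw [Equiv.swap_apply_left, cx_cycVec_eq]
    · rcases eq_or_ne k j with rfl | hj
      · rw [Equiv.swap_apply_right, cx_cycVec_eq]
      · rw [Equiv.swap_apply_of_ne_of_ne hi hj]
  · rw [cy_rep, Equiv.symm_swap]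
    rcases eq_or_ne k i with rfl | hi
    · rw [Equiv.swap_apply_left, cy_cycVec_eq]
    · rcases eq_or_ne k j with rfl | hj
      · rw [Equiv.swap_apply_right, cy_cycVec_eq]
      · rw [Equiv.swap_apply_of_ne_of_ne hi hj]

/-- Applying (i j) to the vectors, but not inside the forms, does not change the cyclic sum. Terms
with v - (i j)v therefore cancel, and terms with v + (i j)v double. -/
theorem rep_cycVec (i j : Fin n) (v₁ v₂ v₃ : DoubledSpace n) :
    om i j ![v₁, v₂] • doubledRep n (Equiv.swap i j) v₃ +
      om i j ![v₂, v₃] • doubledRep n (Equiv.swap i j) v₁ +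
      om i j ![v₃, v₁] • doubledRep n (Equiv.swap i j) v₂ = cycVec i j v₁ v₂ v₃ := by
  rw [← rep_swap_cycVec]
  simp [cycVec]

/-! ### Invariance -/

theorem om_rep (g : Equiv.Perm (Fin n)) (i j : Fin n) (v w : DoubledSpace n) :
    om (g i) (g j) ![doubledRep n g v, doubledRep n g w] = om i j ![v, w] := by
  simp [om_apply]

theorem triForm_rep (a a' b b' : ℂ) (g : Equiv.Perm (Fin n)) (i j k : Fin n)
    (v w : DoubledSpace n) :
    triForm a a' b b' (g i) (g j) (g k) ![doubledRep n g v, doubledRep n g w] =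
      triForm a a' b b' i j k ![v, w] := by
  simp [triForm_apply, ell_apply]

theorem diagForm_rep (α β : ℂ) (g : Equiv.Perm (Fin n)) (v w : DoubledSpace n) :
    diagForm α β ![doubledRep n g v, doubledRep n g w] = diagForm α β ![v, w] := by
  have h : ∀ f : Fin n → ℂ, ∑ i, f (g.symm i) = ∑ i, f i := fun f => Equiv.sum_comp g.symm f
  simp only [diagForm_apply, cx_rep, cy_rep]
  rw [h (fun i => cx i v * cy i w - cx i w * cy i v), h (fun i => cx i v), h (fun i => cx i w),
    h (fun i => cy i v), h (fun i => cy i w)]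

theorem rep_reflVec (a a' b b' : ℂ) (g : Equiv.Perm (Fin n)) (i j : Fin n) :
    doubledRep n g (reflVec a a' b b' i j) = reflVec a a' b b' (g i) (g j) := by
  refine doubled_ext (fun k => ?_) fun k => ?_ <;> simp [Equiv.symm_apply_eq]

theorem conj_swap (g : Equiv.Perm (Fin n)) (i j : Fin n) :
    g * Equiv.swap i j * g⁻¹ = Equiv.swap (g i) (g j) := by
  rw [Equiv.swap_apply_apply]

theorem conj_cyc (g : Equiv.Perm (Fin n)) (i j k : Fin n) :
    g * cyc i j k * g⁻¹ = cyc (g i) (g j) (g k) := by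
  rw [cyc, cyc, ← conj_swap, ← conj_swap]
  group

theorem swapSum_conj {N : Type*} [AddCommGroup N] [Module ℂ N] (r : Fin n → Fin n → N)
    (g h : Equiv.Perm (Fin n)) :
    swapSum r (g * h * g⁻¹) = swapSum (fun i j => r (g i) (g j)) h := by
  rw [swapSum, swapSum, ← Equiv.sum_comp g]
  congr 1
  refine Finset.sum_congr rfl fun i _ => ?_
  rw [← Equiv.sum_comp g]
  refine Finset.sum_congr rfl fun j _ => ?_
  simp only [← conj_swap, mul_left_inj, mul_right_inj]

theorem cycSum_conj {N : Type*} [AddCommGroup N] [Module ℂ N] (r : Fin n → Fin n → Fin n → N)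
    (g h : Equiv.Perm (Fin n)) :
    cycSum r (g * h * g⁻¹) = cycSum (fun i j k => r (g i) (g j) (g k)) h := by
  rw [cycSum, cycSum, ← Equiv.sum_comp g]
  refine Finset.sum_congr rfl fun i _ => ?_
  rw [← Equiv.sum_comp g]
  refine Finset.sum_congr rfl fun j _ => ?_
  rw [← Equiv.sum_comp g]
  refine Finset.sum_congr rfl fun k _ => ?_
  simp only [← conj_cyc, mul_left_inj, mul_right_inj]

theorem linPart_inv (a a' b b' : ℂ) (g h : Equiv.Perm (Fin n)) (v w : DoubledSpace n) :
    doubledRep n g (linPart a a' b b' h ![v, w]) =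
      linPart a a' b b' (g * h * g⁻¹) ![doubledRep n g v, doubledRep n g w] := by
  rw [linPart_apply, linPart_apply, map_swapSum, swapSum_conj]
  simp only [om_rep, map_smul, rep_reflVec]

theorem constPart_inv (a a' b b' c α β : ℂ) (g h : Equiv.Perm (Fin n)) (v w : DoubledSpace n) :
    constPart a a' b b' c α β h ![v, w] =
      constPart a a' b b' c α β (g * h * g⁻¹) ![doubledRep n g v, doubledRep n g w] := by
  rw [constPart_apply, constPart_apply, swapSum_conj, cycSum_conj, diagForm_rep]
  simp only [om_rep, triForm_rep, conj_eq_one_iff]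

theorem linPart_sym (a a' b b' : ℂ) (g : Equiv.Perm (Fin n)) (v₁ v₂ v₃ : DoubledSpace n) :
    sι (doubledRep n) (linPart a a' b b' g ![v₁, v₂]) *
        (sι (doubledRep n) (doubledRep n g v₃) - sι (doubledRep n) v₃) +
      sι (doubledRep n) (linPart a a' b b' g ![v₂, v₃]) *
        (sι (doubledRep n) (doubledRep n g v₁) - sι (doubledRep n) v₁) +
      sι (doubledRep n) (linPart a a' b b' g ![v₃, v₁]) *
        (sι (doubledRep n) (doubledRep n g v₂) - sι (doubledRep n) v₂) = 0 := by
  by_cases hg : ∃ i j, i ≠ j ∧ g = Equiv.swap i j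
  · obtain ⟨i, j, hij, rfl⟩ := hg
    have h : om i j ![v₁, v₂] • (doubledRep n (Equiv.swap i j) v₃ - v₃) +
        om i j ![v₂, v₃] • (doubledRep n (Equiv.swap i j) v₁ - v₁) +
        om i j ![v₃, v₁] • (doubledRep n (Equiv.swap i j) v₂ - v₂) = 0 := by
      have h1 := rep_cycVec i j v₁ v₂ v₃
      rw [cycVec, ← sub_eq_zero] at h1
      rw [← h1]
      module
    have h2 := congrArg (fun v => sι (doubledRep n) (reflVec a a' b b' i j) *
      sι (doubledRep n) v) h
    simp only [map_zero, mul_zero, map_add, map_smul, map_sub, mul_add, mul_smul_comm] at h2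
    simpa only [linPart_swap _ _ _ _ hij, map_smul, smul_mul_assoc] using h2
  · push Not at hg
    simp [linPart_eq_zero a a' b b' hg]

/-! ### Products of two transpositions -/

theorem ell_reflVec (a a' b b' : ℂ) (i j k : Fin n) : ell a a' b b' k (reflVec a a' b b' i j) =
    (a - a') * b' - (b - b') * a' := by
  rw [ell_apply, cx_reflVec, cy_reflVec]
  ring

/-- The sum vectors in `reflVec` drop out of coordinate differences. The coefficient is nonzero only
when {k, l} and {i, j} share exactly one index, so only products that are 3-cycles survive. -/
theorem om_reflVec (a a' b b' : ℂ) (i j k l : Fin n) (w : DoubledSpace n) :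
    om k l ![reflVec a a' b b' i j, w] =
      ((if k = i then 1 else 0) + (if k = j then 1 else 0) - (if l = i then 1 else 0) -
        if l = j then 1 else 0) * (ell a a' b b' k w - ell a a' b b' l w) := by
  rw [om_apply, ell_apply, ell_apply, cx_reflVec, cy_reflVec, cx_reflVec, cy_reflVec]
  ring

/-- All functionals `ell` take the same value on a reflection vector, and the form `triForm` is
built from their differences. -/
theorem triForm_reflVec (a a' b b' : ℂ) (i j k l m : Fin n) (w : DoubledSpace n) :
    triForm a a' b b' k l m ![reflVec a a' b b' i j, w] = 0 := by
  rw [triForm_apply, ell_reflVec, ell_reflVec, ell_reflVec]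
  ring

variable {N : Type*} [AddCommGroup N] [Module ℂ N]

/-- There are four ways for {k, l} and {i, j} to share an index. The antisymmetry in k, l and
symmetry in i, j identify them all with the overlap pattern (i j)(j k). -/
theorem sum_overlap (f : Fin n → Fin n → Fin n → Fin n → N) (h₁ : ∀ k l i j, f k l i j = -f l k i j)
    (h₂ : ∀ k l i j, f k l i j = f k l j i) :
    ∑ i, ∑ j, ∑ k, ∑ l, ((if k = i then 1 else 0) + (if k = j then 1 else 0) -
      (if l = i then 1 else 0) - if l = j then 1 else 0 : ℂ) • f k l i j =
      (-4 : ℂ) • ∑ i, ∑ j, ∑ k, f i j j k := by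
  have hc : ∀ F : Fin n → Fin n → Fin n → N,
      ∑ i, ∑ j, ∑ l, F l i j = ∑ i, ∑ j, ∑ k, F i j k := fun F => by
    rw [Finset.sum_comm_cycle]
  have s1 : ∑ i, ∑ j, ∑ k, ∑ l, (if k = i then (1 : ℂ) else 0) • f k l i j =
      -∑ i, ∑ j, ∑ k, f i j j k := by
    simp only [ite_smul, one_smul, zero_smul, Finset.sum_ite_irrel, Finset.sum_const_zero,
      Finset.sum_ite_eq', Finset.mem_univ, if_true, ← Finset.sum_neg_distrib]
    rw [← hc fun i j k => -f i j j k]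
    exact Finset.sum_congr rfl fun i _ => Finset.sum_congr rfl fun j _ =>
      Finset.sum_congr rfl fun l _ => h₁ i l i j
  have s2 : ∑ i, ∑ j, ∑ k, ∑ l, (if k = j then (1 : ℂ) else 0) • f k l i j =
      -∑ i, ∑ j, ∑ k, f i j j k := by
    rw [← s1, Finset.sum_comm]
    exact Finset.sum_congr rfl fun i _ => Finset.sum_congr rfl fun j _ =>
      Finset.sum_congr rfl fun k _ => Finset.sum_congr rfl fun l _ => by rw [h₂]
  have s3 : ∑ i, ∑ j, ∑ k, ∑ l, (if l = i then (1 : ℂ) else 0) • f k l i j =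
      ∑ i, ∑ j, ∑ k, f i j j k := by
    simp only [ite_smul, one_smul, zero_smul, Finset.sum_ite_eq', Finset.mem_univ, if_true]
    exact hc fun i j k => f i j j k
  have s4 : ∑ i, ∑ j, ∑ k, ∑ l, (if l = j then (1 : ℂ) else 0) • f k l i j =
      ∑ i, ∑ j, ∑ k, f i j j k := by
    rw [← s3, Finset.sum_comm]
    exact Finset.sum_congr rfl fun i _ => Finset.sum_congr rfl fun j _ =>
      Finset.sum_congr rfl fun k _ => Finset.sum_congr rfl fun l _ => by rw [h₂]
  simp only [add_smul, sub_smul, Finset.sum_add_distrib, Finset.sum_sub_distrib]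
  rw [s1, s2, s3, s4]
  module

end Verification

/-! ### The linear and constant identities for the explicit cochains. -/

section Verification

variable {n : ℕ} {N : Type*} [AddCommGroup N] [Module ℂ N]

/-- Cyclically, ω_ij(v₁,v₂)((i j)v₃ + v₃) sums to 2c_ij, which absorbs the 1/2 of `swapSum`. The
family F is left general so that the same formula serves κᴸ paired with itself and with κᶜ. -/
theorem sum_linPart_pairing (a a' b b' : ℂ)
    (F : Equiv.Perm (Fin n) → DoubledSpace n [⋀^Fin 2]→ₗ[ℂ] N) (g : Equiv.Perm (Fin n))
    (v₁ v₂ v₃ : DoubledSpace n) :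
    ∑ y, F (g * y⁻¹) ![linPart a a' b b' y ![v₁, v₂], doubledRep n y v₃ + v₃] +
      ∑ y, F (g * y⁻¹) ![linPart a a' b b' y ![v₂, v₃], doubledRep n y v₁ + v₁] +
      ∑ y, F (g * y⁻¹) ![linPart a a' b b' y ![v₃, v₁], doubledRep n y v₂ + v₂] =
    ∑ i, ∑ j, F (g * Equiv.swap i j) ![reflVec a a' b b' i j, cycVec i j v₁ v₂ v₃] := by
  have key : ∀ v₁ v₂ v₃ : DoubledSpace n,
      ∑ y, F (g * y⁻¹) ![linPart a a' b b' y ![v₁, v₂], doubledRep n y v₃ + v₃] =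
      (1 / 2 : ℂ) • ∑ i, ∑ j, altBilin (F (g * Equiv.swap i j)) (reflVec a a' b b' i j)
        (om i j ![v₁, v₂] • doubledRep n (Equiv.swap i j) v₃ + om i j ![v₁, v₂] • v₃) := by
    intro v₁ v₂ v₃
    have h := sum_apply_swapSum (fun i j => om i j ![v₁, v₂] • reflVec a a' b b' i j)
      fun y => (altBilin (F (g * y⁻¹))).flip (doubledRep n y v₃ + v₃)
    simp only [LinearMap.flip_apply, ← linPart_apply, altBilin_apply, Equiv.swap_inv] at h
    rw [h]
    simp only [← altBilin_apply, map_smul, LinearMap.smul_apply, ← smul_add]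
  rw [key, key, key, ← smul_add, ← smul_add, ← Finset.sum_add_distrib, ← Finset.sum_add_distrib,
    Finset.smul_sum]
  refine Finset.sum_congr rfl fun i _ => ?_
  rw [← Finset.sum_add_distrib, ← Finset.sum_add_distrib, Finset.smul_sum]
  refine Finset.sum_congr rfl fun j _ => ?_
  rw [← map_add, ← map_add, ← map_smul]
  refine (congrArg _ ?_).trans (altBilin_apply _ _ _)
  have h := rep_cycVec i j v₁ v₂ v₃
  rw [cycVec] at h ⊢
  linear_combination (norm := module) (1 / 2 : ℂ) • h

theorem sum_swapSum_reflVec (a a' b b' : ℂ) (r : Fin n → Fin n → N) (hr : ∀ i j, r i j = r j i)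
    (g : Equiv.Perm (Fin n)) (v₁ v₂ v₃ : DoubledSpace n) :
    ∑ i, ∑ j, swapSum (fun k l => om k l ![reflVec a a' b b' i j, cycVec i j v₁ v₂ v₃] • r k l)
      (g * Equiv.swap i j) =
    (-2 : ℂ) • cycSum (fun i j k => (ell a a' b b' i (cycVec j k v₁ v₂ v₃) -
      ell a a' b b' j (cycVec j k v₁ v₂ v₃)) • r i j) g := by
  have h := sum_overlap (fun k l i j => if g = Equiv.swap k l * Equiv.swap i j then
    (ell a a' b b' k (cycVec i j v₁ v₂ v₃) - ell a a' b b' l (cycVec i j v₁ v₂ v₃)) • r k l else 0)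
    (fun k l i j => by
      rw [Equiv.swap_comm k l, hr k l]
      split_ifs
      · module
      · simp)
    (fun k l i j => by rw [Equiv.swap_comm i j, cycVec_comm])
  have h2 : (-2 : ℂ) • cycSum (fun i j k => (ell a a' b b' i (cycVec j k v₁ v₂ v₃) -
      ell a a' b b' j (cycVec j k v₁ v₂ v₃)) • r i j) g = (1 / 2 : ℂ) • (-4 : ℂ) •
      cycSum (fun i j k => (ell a a' b b' i (cycVec j k v₁ v₂ v₃) -
      ell a a' b b' j (cycVec j k v₁ v₂ v₃)) • r i j) g := by module
  rw [h2]
  unfold cycSum cyc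
  rw [← h, Finset.smul_sum]
  refine Finset.sum_congr rfl fun i _ => ?_
  rw [Finset.smul_sum]
  refine Finset.sum_congr rfl fun j _ => ?_
  rw [swapSum]
  congr 1
  refine Finset.sum_congr rfl fun k _ => Finset.sum_congr rfl fun l _ => ?_
  rw [smul_ite, smul_zero, smul_smul, om_reflVec]
  refine if_congr ?_ rfl rfl
  rw [← eq_mul_inv_iff_mul_eq, Equiv.swap_inv]

/-- For each 3-cycle the three rotated terms cancel identically. Hence the parameter c is
unconstrained by the constant identity. -/
theorem cycSum_ell_eq_zero (a a' b b' : ℂ) (g : Equiv.Perm (Fin n)) (v₁ v₂ v₃ : DoubledSpace n) :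
    cycSum (fun i j k => ell a a' b b' i (cycVec j k v₁ v₂ v₃) -
      ell a a' b b' j (cycVec j k v₁ v₂ v₃)) g = 0 := by
  refine cycSum_eq_zero (fun i k => sub_self _) (fun i k => ?_) (fun i k => ?_)
    (fun i j k _ _ _ => ?_) g
  · simp [cycVec_self]
  · rw [ell_apply, ell_apply, ← cx_cycVec_eq, ← cy_cycVec_eq, sub_self]
  · simp only [ell_apply, cx_cycVec, cy_cycVec, om_apply]
    ring

theorem cycSum_one {M : Type*} [AddCommGroup M] {r : Fin n → Fin n → Fin n → M} (h1 : ∀ i k, r i i k = 0)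
    (h3 : ∀ i k, r i k i = 0) : cycSum r 1 = 0 := by
  refine Finset.sum_eq_zero fun i _ => Finset.sum_eq_zero fun j _ => Finset.sum_eq_zero fun k _ => ?_
  rcases eq_or_ne i j with rfl | hij
  · simp [h1]
  rcases eq_or_ne i k with rfl | hik
  · simp [h3]
  rw [if_neg]
  intro h
  have := congrArg (fun σ : Equiv.Perm (Fin n) => σ k) h
  simp [cyc] at this
  exact hik this.symm

theorem triForm_rotate (a a' b b' : ℂ) (i j k : Fin n) :
    triForm a a' b b' j k i = triForm a a' b b' i j k := by
  rw [triForm, triForm]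
  abel

theorem cyc_symm_fst (i j k : Fin n) : (cyc i j k).symm i = k := by
  rw [Equiv.symm_apply_eq]
  simp [cyc]

theorem cyc_symm_snd {i j k : Fin n} (hik : i ≠ k) (hij : i ≠ j) : (cyc i j k).symm j = i := by
  rw [Equiv.symm_apply_eq]
  simp [cyc, Equiv.swap_apply_of_ne_of_ne hij hik]

theorem cyc_symm_trd {i j k : Fin n} (hik : i ≠ k) (hjk : j ≠ k) : (cyc i j k).symm k = j := by
  rw [Equiv.symm_apply_eq]
  simp [cyc, Equiv.swap_apply_of_ne_of_ne hik.symm hjk.symm]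

theorem cyc_symm_of_ne {i j k m : Fin n} (hi : m ≠ i) (hj : m ≠ j) (hk : m ≠ k) :
    (cyc i j k).symm m = m := by
  rw [Equiv.symm_apply_eq]
  simp [cyc, Equiv.swap_apply_of_ne_of_ne, *]

/-- This balances one 3-cycle: the left side comes from composing κᴸ with itself, the right side
from κᶜ. It explains the shape of `triForm`. The check is coordinatewise, at i, j, k and at a
remaining index. -/
theorem reflVec_triForm (a a' b b' : ℂ) {i j k : Fin n} (hij : i ≠ j) (hjk : j ≠ k) (hik : i ≠ k)
    (v₁ v₂ v₃ : DoubledSpace n) :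
    (ell a a' b b' i (cycVec j k v₁ v₂ v₃) - ell a a' b b' j (cycVec j k v₁ v₂ v₃)) •
        reflVec a a' b b' i j +
      (ell a a' b b' j (cycVec k i v₁ v₂ v₃) - ell a a' b b' k (cycVec k i v₁ v₂ v₃)) •
        reflVec a a' b b' j k +
      (ell a a' b b' k (cycVec i j v₁ v₂ v₃) - ell a a' b b' i (cycVec i j v₁ v₂ v₃)) •
        reflVec a a' b b' k i =
    triForm a a' b b' i j k ![v₁, v₂] • (doubledRep n (cyc i j k) v₃ - v₃) +
      triForm a a' b b' i j k ![v₂, v₃] • (doubledRep n (cyc i j k) v₁ - v₁) +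
      triForm a a' b b' i j k ![v₃, v₁] • (doubledRep n (cyc i j k) v₂ - v₂) := by
  refine doubled_ext (fun m => ?_) fun m => ?_ <;>
  · simp only [map_add, map_smul, map_sub, cx_rep, cy_rep, smul_eq_mul, cx_reflVec, cy_reflVec,
      triForm_apply, ell_apply, cx_cycVec, cy_cycVec, om_apply]
    rcases eq_or_ne m i with rfl | hi
    · rw [cyc_symm_fst, if_pos rfl, if_neg hij, if_neg hik]
      ring
    rcases eq_or_ne m j with rfl | hj
    · rw [cyc_symm_snd hik hij, if_pos rfl, if_neg hij.symm, if_neg hjk]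
      ring
    rcases eq_or_ne m k with rfl | hk
    · rw [cyc_symm_trd hik hjk, if_pos rfl, if_neg hik.symm, if_neg hjk.symm]
      ring
    · rw [cyc_symm_of_ne hi hj hk, if_neg hi, if_neg hj, if_neg hk]
      ring

theorem triForm_left (a a' b b' : ℂ) (i k : Fin n) (v w : DoubledSpace n) :
    triForm a a' b b' i i k ![v, w] = 0 := by
  rw [triForm_apply]
  ring

theorem triForm_right (a a' b b' : ℂ) (i k : Fin n) (v w : DoubledSpace n) :
    triForm a a' b b' i k k ![v, w] = 0 := by
  rw [triForm_apply]
  ring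

theorem triForm_outer (a a' b b' : ℂ) (i k : Fin n) (v w : DoubledSpace n) :
    triForm a a' b b' i k i ![v, w] = 0 := by
  rw [triForm_apply]
  ring

theorem swapSum_zero (g : Equiv.Perm (Fin n)) : swapSum (fun _ _ => (0 : N)) g = 0 := by
  simp [swapSum]

theorem cycSum_zero {M : Type*} [AddCommGroup M] (g : Equiv.Perm (Fin n)) :
    cycSum (fun _ _ _ => (0 : M)) g = 0 := by
  simp [cycSum]

theorem cycSum_add {M : Type*} [AddCommGroup M] (r s : Fin n → Fin n → Fin n → M)
    (g : Equiv.Perm (Fin n)) :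
    cycSum (fun i j k => r i j k + s i j k) g = cycSum r g + cycSum s g := by
  simp only [cycSum, ← Finset.sum_add_distrib]
  refine Finset.sum_congr rfl fun i _ => Finset.sum_congr rfl fun j _ =>
    Finset.sum_congr rfl fun k _ => ?_
  split_ifs <;> simp

theorem swapSum_add (r s : Fin n → Fin n → N) (g : Equiv.Perm (Fin n)) :
    swapSum (fun i j => r i j + s i j) g = swapSum r g + swapSum s g := by
  simp only [swapSum, ← smul_add, ← Finset.sum_add_distrib]
  congr 1
  refine Finset.sum_congr rfl fun i _ => Finset.sum_congr rfl fun j _ => ?_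
  split_ifs <;> simp

/-- The constant cochain moves vectors as if each summand were attached to its own permutation. -/
theorem constPart_smul_sub (a a' b b' c α β : ℂ) (g : Equiv.Perm (Fin n))
    (v₁ v₂ v₃ : DoubledSpace n) :
    constPart a a' b b' c α β g ![v₁, v₂] • (doubledRep n g v₃ - v₃) =
      c • swapSum (fun i j => om i j ![v₁, v₂] • (doubledRep n (Equiv.swap i j) v₃ - v₃)) g +
      (1 / 3 : ℂ) • cycSum (fun i j k => triForm a a' b b' i j k ![v₁, v₂] •
        (doubledRep n (cyc i j k) v₃ - v₃)) g := by
  have h1 : (if g = 1 then diagForm α β ![v₁, v₂] else 0) • (doubledRep n g v₃ - v₃) = 0 := by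
    split_ifs with h
    · simp [h]
    · exact zero_smul _ _
  have h2 := map_swapSum (LinearMap.toSpanSingleton ℂ _ (doubledRep n g v₃ - v₃))
    (fun i j => om i j ![v₁, v₂]) g
  have h3 := map_cycSum (LinearMap.toSpanSingleton ℂ _ (doubledRep n g v₃ - v₃))
    (fun i j k => triForm a a' b b' i j k ![v₁, v₂]) g
  simp only [LinearMap.toSpanSingleton_apply] at h2 h3
  rw [constPart_apply, add_smul, add_smul, h1, zero_add, mul_smul, mul_smul, h2, h3]
  congr 2
  · simp only [swapSum]
    congr 1
    refine Finset.sum_congr rfl fun i _ => Finset.sum_congr rfl fun j _ => ?_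
    split_ifs with h
    · rw [h]
    · rfl
  · refine Finset.sum_congr rfl fun i _ => Finset.sum_congr rfl fun j _ =>
      Finset.sum_congr rfl fun k _ => ?_
    split_ifs with h
    · rw [h]
    · rfl

/-- The identity component does not move vectors, the transposition component cancels by
`rep_cycVec`, and the 3-cycle component cancels the square of κᴸ. No condition on the parameters is
needed. -/
theorem linPart_lin (a a' b b' c α β : ℂ) (g : Equiv.Perm (Fin n)) (v₁ v₂ v₃ : DoubledSpace n) :
    linTerm (doubledRep n) (linPart a a' b b') (constPart a a' b b' c α β) g v₁ v₂ v₃ +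
      linTerm (doubledRep n) (linPart a a' b b') (constPart a a' b b' c α β) g v₂ v₃ v₁ +
      linTerm (doubledRep n) (linPart a a' b b') (constPart a a' b b' c α β) g v₃ v₁ v₂ = 0 := by
  have e1 := sum_linPart_pairing a a' b b' (linPart a a' b b') g v₁ v₂ v₃
  simp only [linPart_apply _ _ _ _ (g * Equiv.swap _ _)] at e1
  rw [sum_swapSum_reflVec a a' b b' _ (reflVec_comm a a' b b')] at e1
  have e2 : swapSum (fun i j => om i j ![v₁, v₂] • (doubledRep n (Equiv.swap i j) v₃ - v₃)) g +
      swapSum (fun i j => om i j ![v₂, v₃] • (doubledRep n (Equiv.swap i j) v₁ - v₁)) g +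
      swapSum (fun i j => om i j ![v₃, v₁] • (doubledRep n (Equiv.swap i j) v₂ - v₂)) g = 0 := by
    rw [← swapSum_add, ← swapSum_add, ← swapSum_zero g]
    congr 1
    funext i j
    have h := rep_cycVec i j v₁ v₂ v₃
    rw [cycVec, ← sub_eq_zero] at h
    rw [← h]
    module
  -- The 1/3 compensates for the three equal rotations of `triForm`. The other term carries a
  -- different summand for each rotation, hence coefficient -1.
  have e3 : (-1 : ℂ) • cycSum (fun i j k => (ell a a' b b' i (cycVec j k v₁ v₂ v₃) -
      ell a a' b b' j (cycVec j k v₁ v₂ v₃)) • reflVec a a' b b' i j) g +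
      (1 / 3 : ℂ) • (cycSum (fun i j k => triForm a a' b b' i j k ![v₁, v₂] •
        (doubledRep n (cyc i j k) v₃ - v₃)) g +
      cycSum (fun i j k => triForm a a' b b' i j k ![v₂, v₃] •
        (doubledRep n (cyc i j k) v₁ - v₁)) g +
      cycSum (fun i j k => triForm a a' b b' i j k ![v₃, v₁] •
        (doubledRep n (cyc i j k) v₂ - v₂)) g) = 0 := by
    rw [← cycSum_add, ← cycSum_add, ← LinearMap.lsmul_apply (R := ℂ),
      ← LinearMap.lsmul_apply (R := ℂ) (1 / 3), map_cycSum, map_cycSum, ← cycSum_add]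
    refine cycSum_eq_zero (fun i k => ?_) (fun i k => ?_) (fun i k => ?_)
      (fun i j k hij hjk hik => ?_) g
    · simp [triForm_left]
    · simp [triForm_right, cycVec_self]
    · simp only [triForm_outer, zero_smul, add_zero, LinearMap.lsmul_apply, smul_zero]
      rw [ell_apply, ell_apply, ← cx_cycVec_eq, ← cy_cycVec_eq, sub_self, zero_smul, smul_zero]
    · have h := reflVec_triForm a a' b b' hij hjk hik v₁ v₂ v₃
      have hr1 := cyc_rotate hij hjk hik
      have hr2 := cyc_rotate hjk hik.symm hij.symm
      simp only [LinearMap.lsmul_apply, hr2, hr1]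
      rw [triForm_rotate a a' b b' j k i, triForm_rotate a a' b b' i j k]
      linear_combination (norm := module) (-1 : ℂ) • h
  simp only [linTerm, constPart_smul_sub]
  -- The 1/2 of `linTerm` times the -2 of `sum_swapSum_reflVec` is the -1 in `e3`.
  linear_combination (norm := module) (1 / 2 : ℂ) • e1 + c • e2 + e3

/-- Of the three parts of κᶜ only the identity component survives, and it is reached from g exactly
through transpositions (i j) equal to g. -/
theorem linPart_const_sum (a a' b b' c α β : ℂ) (g : Equiv.Perm (Fin n))
    (v₁ v₂ v₃ : DoubledSpace n) :
    constTerm (doubledRep n) (linPart a a' b b') (constPart a a' b b' c α β) g v₁ v₂ v₃ +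
      constTerm (doubledRep n) (linPart a a' b b') (constPart a a' b b' c α β) g v₂ v₃ v₁ +
      constTerm (doubledRep n) (linPart a a' b b') (constPart a a' b b' c α β) g v₃ v₁ v₂ =
    swapSum (fun i j => diagForm α β ![reflVec a a' b b' i j, cycVec i j v₁ v₂ v₃]) g := by
  simp only [constTerm]
  rw [← smul_add, ← smul_add, sum_linPart_pairing]
  have h := sum_swapSum_reflVec a a' b b' (fun _ _ => c) (fun _ _ => rfl) g v₁ v₂ v₃
  have h0 := map_cycSum (LinearMap.toSpanSingleton ℂ ℂ c) (fun i j k =>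
    ell a a' b b' i (cycVec j k v₁ v₂ v₃) - ell a a' b b' j (cycVec j k v₁ v₂ v₃)) g
  rw [cycSum_ell_eq_zero, map_zero] at h0
  simp only [LinearMap.toSpanSingleton_apply] at h0
  rw [← h0, smul_zero] at h
  rw [swapSum]
  congr 1
  refine Eq.trans ?_ ((congrArg _ h).trans (add_zero _))
  rw [← Finset.sum_add_distrib]
  refine Finset.sum_congr rfl fun i _ => ?_
  rw [← Finset.sum_add_distrib]
  refine Finset.sum_congr rfl fun j _ => ?_
  simp only [constPart_apply, triForm_reflVec, cycSum_zero, mul_zero, add_zero]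
  congr 1
  · refine if_congr ?_ rfl rfl
    rw [mul_eq_one_iff_eq_inv, Equiv.swap_inv]
  · have h1 := map_swapSum (LinearMap.toSpanSingleton ℂ ℂ c)
      (fun k l => om k l ![reflVec a a' b b' i j, cycVec i j v₁ v₂ v₃]) (g * Equiv.swap i j)
    simp only [LinearMap.toSpanSingleton_apply] at h1
    rw [← h1, smul_eq_mul, mul_comm]

end Verification

/-! ### The parameter conditions, and the values on basis vectors. -/

section Values

variable {n : ℕ}

/-- For v fixed by (i j) the value depends only on the coordinates at i and on the coordinate sums;
their coefficients become the parameter conditions. -/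
theorem diagForm_reflVec (a a' b b' α β : ℂ) (i j : Fin n) {v : DoubledSpace n}
    (hx : cx i v = cx j v) (hy : cy i v = cy j v) :
    diagForm α β ![reflVec a a' b b' i j, v] =
      2 * (α - β) * ((a - a') * cy i v - (b - b') * cx i v) +
      (α * a' + β * (2 * a + (n - 3) * a')) * (∑ k, cy k v) -
      (α * b' + β * (2 * b + (n - 3) * b')) * ∑ k, cx k v := by
  have h1 : ∀ (p q : ℂ) (f : Fin n → ℂ), ∑ k, (p * ((if k = i then 1 else 0) +
      if k = j then 1 else 0) + q) * f k = p * (f i + f j) + q * ∑ k, f k := by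
    intro p q f
    simp only [add_mul, mul_add, mul_assoc, Finset.sum_add_distrib, ← Finset.mul_sum, ite_mul,
      one_mul, zero_mul, Finset.sum_ite_eq', Finset.mem_univ, if_true]
  have h2 : ∀ p q : ℂ, ∑ k, (p * ((if k = i then 1 else 0) + if k = j then 1 else 0) + q) =
      p * 2 + q * n := by
    intro p q
    have := h1 p q fun _ => 1
    simp only [mul_one] at this
    rw [this]
    simp
    norm_num
  rw [diagForm_apply, Finset.sum_sub_distrib]
  simp only [cx_reflVec, cy_reflVec, mul_comm (cx _ v)]
  rw [h1, h1, h2, h2, ← hx, ← hy]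
  ring

theorem diagForm_reflVec_cycVec {a a' b b' α β : ℂ} (h : ParamConditions n a a' b b' α β)
    (i j : Fin n) (v₁ v₂ v₃ : DoubledSpace n) :
    diagForm α β ![reflVec a a' b b' i j, cycVec i j v₁ v₂ v₃] = 0 := by
  rw [diagForm_reflVec a a' b b' α β i j (cx_cycVec_eq i j v₁ v₂ v₃) (cy_cycVec_eq i j v₁ v₂ v₃),
    h.a_second, h.b_second]
  -- The difference of the two conditions on a is (α - β)(a - a') = 0, and similarly for b.
  linear_combination (2 * cy i (cycVec i j v₁ v₂ v₃)) * (h.a_first - h.a_second) -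
    (2 * cx i (cycVec i j v₁ v₂ v₃)) * (h.b_first - h.b_second)

theorem pbwConditions {a a' b b' c α β : ℂ} (h : ParamConditions n a a' b b' α β) :
    PBWConditions (doubledRep n) (linPart a a' b b') (constPart a a' b b' c α β) where
  lin_inv := linPart_inv a a' b b'
  const_inv := constPart_inv a a' b b' c α β
  sym := linPart_sym a a' b b'
  lin := linPart_lin a a' b b' c α β
  const g v₁ v₂ v₃ := by
    rw [linPart_const_sum]
    simp only [diagForm_reflVec_cycVec h, swapSum_zero]

/-! ### Values on basis vectors -/

section

variable {N : Type*} [AddCommGroup N] [Module ℂ N]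

theorem swapSum_om_xx (r : Fin n → Fin n → N) (i j : Fin n) (g : Equiv.Perm (Fin n)) :
    swapSum (fun k l => om k l ![xv i, xv j] • r k l) g = 0 := by
  simp [swapSum, om_apply]

theorem swapSum_om_yy (r : Fin n → Fin n → N) (i j : Fin n) (g : Equiv.Perm (Fin n)) :
    swapSum (fun k l => om k l ![yv i, yv j] • r k l) g = 0 := by
  simp [swapSum, om_apply]

/-- Here ω_kl(x_i, y_i) = (δ_ki - δ_li)², which is 1 when exactly one of k, l equals i. -/
theorem swapSum_om_xy_same (r : Fin n → Fin n → N) (hr : ∀ i j, r i j = r j i) (i : Fin n)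
    (g : Equiv.Perm (Fin n)) : swapSum (fun k l => om k l ![xv i, yv i] • r k l) g =
      (∑ k ∈ Finset.univ.erase i, Pi.single (Equiv.swap i k) (r i k) : _ → N) g := by
  have h : ∀ k l, (if g = Equiv.swap k l then om k l ![xv i, yv i] • r k l else 0) =
      ((if k = i then (1 : ℂ) else 0) + (if l = i then 1 else 0) -
        2 * if k = i then if l = i then 1 else 0 else 0) •
      if g = Equiv.swap k l then r k l else 0 := by
    intro k l
    rw [← smul_ite_zero]
    congr 1
    simp only [om_apply, cx_xv, cy_yv, cx_yv, cy_xv]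
    split_ifs <;> norm_num
  have h2 : ∀ k, (if g = Equiv.swap k i then r k i else 0) =
      if g = Equiv.swap i k then r i k else 0 := fun k => by rw [Equiv.swap_comm, hr]
  simp only [swapSum, h, add_smul, sub_smul, Finset.sum_add_distrib, Finset.sum_sub_distrib,
    ite_smul, zero_smul, one_smul, mul_smul, ← Finset.smul_sum, Finset.sum_ite_irrel,
    Finset.sum_const_zero, Finset.sum_ite_eq', Finset.mem_univ, if_true]
  rw [Finset.sum_congr rfl fun k _ => h2 k, Finset.sum_apply, ← Finset.add_sum_erase
    Finset.univ _ (Finset.mem_univ i)]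
  simp only [Pi.single_apply]
  module

/-- For i ≠ j the value (δ_ki - δ_li)(δ_kj - δ_lj) is -1 when {k, l} = {i, j} and 0 otherwise. -/
theorem swapSum_om_xy_ne (r : Fin n → Fin n → N) (hr : ∀ i j, r i j = r j i) {i j : Fin n}
    (hij : i ≠ j) (g : Equiv.Perm (Fin n)) :
    swapSum (fun k l => om k l ![xv i, yv j] • r k l) g =
      -(Pi.single (Equiv.swap i j) (r i j) : _ → N) g := by
  have h : ∀ k l, (if g = Equiv.swap k l then om k l ![xv i, yv j] • r k l else 0) =
      (-(if k = i then if l = j then (1 : ℂ) else 0 else 0) -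
        if k = j then if l = i then 1 else 0 else 0) •
      if g = Equiv.swap k l then r k l else 0 := by
    intro k l
    rw [← smul_ite_zero]
    congr 1
    simp only [om_apply, cx_xv, cy_yv, cx_yv, cy_xv]
    have : j ≠ i := hij.symm
    split_ifs <;> first | (norm_num; done) | simp_all
  simp only [swapSum, h, neg_smul, sub_smul, Finset.sum_neg_distrib, Finset.sum_sub_distrib,
    ite_smul, zero_smul, one_smul, Finset.sum_ite_irrel,
    Finset.sum_const_zero, Finset.sum_ite_eq', Finset.mem_univ, if_true]
  rw [Equiv.swap_comm j i, hr j i]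
  simp only [Pi.single_apply]
  module

end

/-- The coefficient of a triple in the alternating sum over `3`-cycles through `i` and `j`. -/
def triCoeff (i j k l m : Fin n) : ℂ :=
  (if k = i then if l = j then 1 else 0 else 0) - (if k = j then if l = i then 1 else 0 else 0) +
  ((if l = i then if m = j then 1 else 0 else 0) - (if l = j then if m = i then 1 else 0 else 0)) +
  ((if m = i then if k = j then 1 else 0 else 0) - (if m = j then if k = i then 1 else 0 else 0))

theorem triForm_eq_triCoeff (a a' b b' : ℂ) (k l m : Fin n) {v w : DoubledSpace n} {p q : ℂ}
    {i j : Fin n} (hv : ∀ k, ell a a' b b' k v = if k = i then p else 0)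
    (hw : ∀ k, ell a a' b b' k w = if k = j then q else 0) :
    triForm a a' b b' k l m ![v, w] = (p * q) * triCoeff i j k l m := by
  simp only [triForm_apply, hv, hw, triCoeff, ← ite_and, mul_ite, ite_mul, zero_mul, mul_zero,
    mul_add, mul_sub, mul_one, and_comm, mul_comm q p]

theorem cycSum_triCoeff_self (i : Fin n) (g : Equiv.Perm (Fin n)) :
    cycSum (triCoeff i i) g = 0 := by
  have : triCoeff i i = fun _ _ _ => 0 := by
    funext k l m
    rw [triCoeff]
    split_ifs <;> norm_num
  rw [this, cycSum_zero]

/-- Each 3-cycle appears through its three rotations, which is the factor 3; the degenerate triples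
with third index i or j cancel. -/
theorem cycSum_triCoeff {i j : Fin n} (hij : i ≠ j) (g : Equiv.Perm (Fin n)) :
    cycSum (triCoeff i j) g = 3 * triSum i j g := by
  have h : ∀ k l m, (if g = cyc k l m then triCoeff i j k l m else 0) =
      triCoeff i j k l m * if g = cyc k l m then 1 else 0 := fun k l m => by
    rw [mul_ite, mul_one, mul_zero]
  have e : cycSum (triCoeff i j) g = ∑ m, ((if g = cyc i j m then (1 : ℂ) else 0) -
      (if g = cyc j i m then 1 else 0) + ((if g = cyc m i j then 1 else 0) -
      (if g = cyc m j i then 1 else 0)) + ((if g = cyc j m i then 1 else 0) -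
      (if g = cyc i m j then 1 else 0))) := by
    simp only [cycSum, h]
    simp only [triCoeff, add_mul, sub_mul, Finset.sum_add_distrib, Finset.sum_sub_distrib,
      ite_mul, zero_mul, one_mul, Finset.sum_ite_irrel, Finset.sum_const_zero, Finset.sum_ite_eq',
      Finset.mem_univ, if_true]
  have hs : ∀ k l : Fin n, cyc k l l = Equiv.swap k l := fun k l => by
    rw [cyc, Equiv.swap_self]; rfl
  have hs' : ∀ k l : Fin n, cyc k k l = Equiv.swap k l := fun k l => by
    rw [cyc, Equiv.swap_self]; rfl
  have hs'' : ∀ k l : Fin n, cyc k l k = 1 := fun k l => by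
    rw [cyc, Equiv.swap_comm, Equiv.swap_mul_self]
  rw [e, ← Finset.sum_sdiff (Finset.subset_univ {i, j}), Finset.sum_pair hij]
  simp only [hs, hs', hs'', Equiv.swap_comm j i]
  rw [triSum, Finset.sum_apply, Finset.mul_sum]
  ring_nf
  refine Finset.sum_congr rfl fun m hm => ?_
  simp only [Finset.mem_sdiff, Finset.mem_univ, true_and, Finset.mem_insert,
    Finset.mem_singleton, not_or] at hm
  rw [cyc_rotate hij (Ne.symm hm.2) (Ne.symm hm.1), ← cyc_rotate hm.1 hij hm.2,
    cyc_rotate hm.2 hij.symm hm.1, ← cyc_rotate hm.2 hij.symm hm.1,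
    cyc_rotate hij.symm (Ne.symm hm.1) (Ne.symm hm.2)]
  simp only [Pi.sub_apply, Pi.single_apply]
  ring

/-- Each basis vector is seen by `ell` at a single index, with value -(b - b') for x and a - a' for
y. The product pq therefore gives the xx, yy and xy coefficients at once. -/
theorem cycSum_triForm (a a' b b' : ℂ) {v w : DoubledSpace n} {p q : ℂ} {i j : Fin n}
    (hv : ∀ k, ell a a' b b' k v = if k = i then p else 0)
    (hw : ∀ k, ell a a' b b' k w = if k = j then q else 0) (g : Equiv.Perm (Fin n)) :
    1 / 3 * cycSum (fun k l m => triForm a a' b b' k l m ![v, w]) g =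
      if i = j then 0 else p * q * triSum i j g := by
  simp only [triForm_eq_triCoeff a a' b b' _ _ _ hv hw, ← smul_eq_mul (a := p * q)]
  have h := map_cycSum (LinearMap.lsmul ℂ ℂ (p * q)) (triCoeff i j) g
  simp only [LinearMap.lsmul_apply] at h
  rw [← h]
  split_ifs with hij
  · rw [hij, cycSum_triCoeff_self, smul_zero, mul_zero]
  · rw [cycSum_triCoeff hij, smul_eq_mul]
    ring

theorem ell_xv (a a' b b' : ℂ) (i k : Fin n) :
    ell a a' b b' k (xv i) = if k = i then -(b - b') else 0 := by
  rw [ell_apply, cx_xv, cy_xv]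
  split_ifs <;> ring

theorem ell_yv (a a' b b' : ℂ) (i k : Fin n) :
    ell a a' b b' k (yv i) = if k = i then a - a' else 0 := by
  rw [ell_apply, cx_yv, cy_yv]
  split_ifs <;> ring

theorem isLinPart_linPart (a a' b b' : ℂ) :
    IsLinPart a a' b b' (linPart a a' b b' : LinCochain (Equiv.Perm (Fin n)) (DoubledSpace n)) where
  xx i j _ := funext fun g => by rw [linPart_apply, swapSum_om_xx]; rfl
  yy i j _ := funext fun g => by rw [linPart_apply, swapSum_om_yy]; rfl
  xy_same i := funext fun g => by
    rw [linPart_apply, swapSum_om_xy_same _ (reflVec_comm a a' b b')]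
  xy_ne i j hij := funext fun g => by
    rw [linPart_apply, swapSum_om_xy_ne _ (reflVec_comm a a' b b') hij]
    rfl

theorem diagForm_xx (α β : ℂ) (i j : Fin n) : diagForm α β ![xv i, xv j] = 0 := by
  simp [diagForm_apply]

theorem diagForm_yy (α β : ℂ) (i j : Fin n) : diagForm α β ![yv i, yv j] = 0 := by
  simp [diagForm_apply]

theorem diagForm_xy (α β : ℂ) (i j : Fin n) :
    diagForm α β ![xv i, yv j] = if i = j then α else β := by
  simp only [diagForm_apply, cx_xv, cx_yv, cy_xv, cy_yv]
  split_ifs with h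
  · subst h; simp
  · have : j ≠ i := Ne.symm h
    simp [this]

theorem isConstPart_constPart (a a' b b' c α β : ℂ) :
    IsConstPart a a' b b' c α β
      (constPart a a' b b' c α β : ConstCochain (Equiv.Perm (Fin n)) (DoubledSpace n)) where
  xx i j hij := funext fun g => by
    have h := swapSum_om_xx (fun _ _ => (1 : ℂ)) i j g
    simp only [smul_eq_mul, mul_one] at h
    rw [constPart_apply, h, cycSum_triForm _ _ _ _ (ell_xv a a' b b' i) (ell_xv a a' b b' j),
      if_neg hij, diagForm_xx]
    simp only [ite_self, Pi.smul_apply, smul_eq_mul]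
    ring
  yy i j hij := funext fun g => by
    have h := swapSum_om_yy (fun _ _ => (1 : ℂ)) i j g
    simp only [smul_eq_mul, mul_one] at h
    rw [constPart_apply, h, cycSum_triForm _ _ _ _ (ell_yv a a' b b' i) (ell_yv a a' b b' j),
      if_neg hij, diagForm_yy]
    simp only [ite_self, Pi.smul_apply, smul_eq_mul]
    ring
  xy_same i := funext fun g => by
    have h := swapSum_om_xy_same (fun _ _ => (1 : ℂ)) (fun _ _ => rfl) i g
    simp only [smul_eq_mul, mul_one] at h
    rw [constPart_apply, h, cycSum_triForm _ _ _ _ (ell_xv a a' b b' i) (ell_yv a a' b b' i),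
      if_pos rfl, diagForm_xy, if_pos rfl, add_zero]
    simp only [Pi.add_apply, Pi.smul_apply, smul_eq_mul, Pi.single_apply]
  xy_ne i j hij := funext fun g => by
    have h := swapSum_om_xy_ne (fun _ _ => (1 : ℂ)) (fun _ _ => rfl) hij g
    simp only [smul_eq_mul, mul_one] at h
    rw [constPart_apply, h, cycSum_triForm _ _ _ _ (ell_xv a a' b b' i) (ell_yv a a' b b' j),
      if_neg hij, diagForm_xy, if_neg hij]
    simp only [Pi.sub_apply, Pi.smul_apply, smul_eq_mul, Pi.single_apply]
    ring

theorem IsLinPart.eq_linPart {a a' b b' : ℂ}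
    {κL : LinCochain (Equiv.Perm (Fin n)) (DoubledSpace n)} (h : IsLinPart a a' b b' κL) :
    κL = linPart a a' b b' := by
  have h' := isLinPart_linPart (n := n) a a' b b'
  refine funext fun g => alt_ext (fun i j hij => ?_) (fun i j hij => ?_) fun i j => ?_
  · exact congrFun ((h.xx i j hij).trans (h'.xx i j hij).symm) g
  · exact congrFun ((h.yy i j hij).trans (h'.yy i j hij).symm) g
  · rcases eq_or_ne i j with rfl | hij
    · exact congrFun ((h.xy_same i).trans (h'.xy_same i).symm) g
    · exact congrFun ((h.xy_ne i j hij).trans (h'.xy_ne i j hij).symm) g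

theorem IsConstPart.eq_constPart {a a' b b' c α β : ℂ}
    {κC : ConstCochain (Equiv.Perm (Fin n)) (DoubledSpace n)}
    (h : IsConstPart a a' b b' c α β κC) : κC = constPart a a' b b' c α β := by
  have h' := isConstPart_constPart (n := n) a a' b b' c α β
  refine funext fun g => alt_ext (fun i j hij => ?_) (fun i j hij => ?_) fun i j => ?_
  · exact congrFun ((h.xx i j hij).trans (h'.xx i j hij).symm) g
  · exact congrFun ((h.yy i j hij).trans (h'.yy i j hij).symm) g
  · rcases eq_or_ne i j with rfl | hij
    · exact congrFun ((h.xy_same i).trans (h'.xy_same i).symm) g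
    · exact congrFun ((h.xy_ne i j hij).trans (h'.xy_ne i j hij).symm) g

theorem rep_swap_reflVec (a a' b b' : ℂ) (i j : Fin n) :
    doubledRep n (Equiv.swap i j) (reflVec a a' b b' i j) = reflVec a a' b b' i j := by
  rw [rep_reflVec, Equiv.swap_apply_left, Equiv.swap_apply_right, reflVec_comm]

theorem rep_linPart (a a' b b' : ℂ) (g : Equiv.Perm (Fin n)) (u : Fin 2 → DoubledSpace n) :
    doubledRep n g (linPart a a' b b' g u) = linPart a a' b b' g u := by
  by_cases hg : ∃ i j, i ≠ j ∧ g = Equiv.swap i j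
  · obtain ⟨i, j, hij, rfl⟩ := hg
    have hu : u = ![u 0, u 1] := by ext i : 1; fin_cases i <;> rfl
    rw [hu, linPart_swap _ _ _ _ hij, map_smul, rep_swap_reflVec]
  · push Not at hg
    simp [linPart_eq_zero a a' b b' hg]

theorem linPart_one (a a' b b' : ℂ) :
    (linPart a a' b b' : LinCochain (Equiv.Perm (Fin n)) (DoubledSpace n)) 1 = 0 :=
  linPart_eq_zero a a' b b' fun i j hij h => hij (by
    simpa using congrArg (fun σ : Equiv.Perm (Fin n) => σ i) h)

end Values

/-! ### Every solution has the stated form. -/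

section Classification

variable {n : ℕ}

/-! ### Alternating forms with vanishing cyclic sums -/

section CyclicForms

variable {φ : DoubledSpace n [⋀^Fin 2]→ₗ[ℂ] ℂ} {g : Equiv.Perm (Fin n)}

theorem exists_apply_ne (hg : g ≠ 1) : ∃ k, g k ≠ k := by
  by_contra! h
  exact hg (Equiv.ext h)

/-- For a moved index k, the y_{g k}-coordinate of the cyclic sum at (x_i, x_j, y_k) sees only
φ(x_i, x_j). -/
theorem alt_xx_eq_zero (hg : g ≠ 1) (H : ∀ v₁ v₂ v₃, φ ![v₁, v₂] • (doubledRep n g v₃ - v₃) +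
    φ ![v₂, v₃] • (doubledRep n g v₁ - v₁) + φ ![v₃, v₁] • (doubledRep n g v₂ - v₂) = 0)
    (i j : Fin n) : φ ![xv i, xv j] = 0 := by
  obtain ⟨k, hk⟩ := exists_apply_ne hg
  simpa [doubledRep_xv, doubledRep_yv, hk] using congrArg (cy (g k)) (H (xv i) (xv j) (yv k))

theorem alt_yy_eq_zero (hg : g ≠ 1) (H : ∀ v₁ v₂ v₃, φ ![v₁, v₂] • (doubledRep n g v₃ - v₃) +
    φ ![v₂, v₃] • (doubledRep n g v₁ - v₁) + φ ![v₃, v₁] • (doubledRep n g v₂ - v₂) = 0)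
    (i j : Fin n) : φ ![yv i, yv j] = 0 := by
  obtain ⟨k, hk⟩ := exists_apply_ne hg
  simpa [doubledRep_xv, doubledRep_yv, hk] using congrArg (cx (g k)) (H (yv i) (yv j) (xv k))

/-- Read off the x_{g k}-coordinate at (x_i, y_j, x_k). Thus φ(x_i, ·) vanishes on the y's unless i
is k or g k, for every moved k. -/
theorem alt_xy_left (H : ∀ v₁ v₂ v₃, φ ![v₁, v₂] • (doubledRep n g v₃ - v₃) +
    φ ![v₂, v₃] • (doubledRep n g v₁ - v₁) + φ ![v₃, v₁] • (doubledRep n g v₂ - v₂) = 0)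
    (i j : Fin n) {k : Fin n} (hk : g k ≠ k) : φ ![xv i, yv j] =
      φ ![xv k, yv j] * ((if g k = g i then 1 else 0) - if g k = i then 1 else 0) := by
  have h := congrArg (cx (g k)) (H (xv i) (yv j) (xv k))
  rw [alt_swap φ (yv j) (xv k)] at h
  simp only [map_add, map_smul, map_sub, cx_xv, cx_yv, doubledRep_xv, doubledRep_yv, if_neg hk,
    map_zero, smul_eq_mul, if_true] at h
  linear_combination h

theorem alt_xy_right (H : ∀ v₁ v₂ v₃, φ ![v₁, v₂] • (doubledRep n g v₃ - v₃) +
    φ ![v₂, v₃] • (doubledRep n g v₁ - v₁) + φ ![v₃, v₁] • (doubledRep n g v₂ - v₂) = 0)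
    (i j : Fin n) {k : Fin n} (hk : g k ≠ k) : φ ![xv i, yv j] =
      φ ![xv i, yv k] * ((if g k = g j then 1 else 0) - if g k = j then 1 else 0) := by
  have h := congrArg (cy (g k)) (H (xv i) (yv j) (yv k))
  rw [alt_swap φ (yv k) (xv i)] at h
  simp only [map_add, map_smul, map_sub, cy_xv, cy_yv, doubledRep_xv, doubledRep_yv, if_neg hk,
    map_zero, smul_eq_mul, if_true] at h
  linear_combination h

/-- If g is neither the identity nor a transposition, then each i avoids {k, g k} for some moved k,
so every row of φ vanishes. -/
theorem alt_eq_zero_of_cyclic (hg : g ≠ 1) (hs : ∀ i j, i ≠ j → g ≠ Equiv.swap i j)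
    (H : ∀ v₁ v₂ v₃, φ ![v₁, v₂] • (doubledRep n g v₃ - v₃) +
    φ ![v₂, v₃] • (doubledRep n g v₁ - v₁) + φ ![v₃, v₁] • (doubledRep n g v₂ - v₂) = 0) :
    φ = 0 := by
  refine alt_ext (fun i j _ => alt_xx_eq_zero hg H i j) (fun i j _ => alt_yy_eq_zero hg H i j)
    fun i j => ?_
  have key : ∃ k, g k ≠ k ∧ k ≠ i ∧ g k ≠ i := by
    by_cases hi : g i = i
    · obtain ⟨k, hk⟩ := exists_apply_ne hg
      refine ⟨k, hk, ?_, ?_⟩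
      · rintro rfl
        exact hk hi
      · intro h
        rw [← hi] at h
        exact hk (by rw [g.injective h, hi])
    · by_cases hii : g (g i) = i
      -- If every moved point other than i were sent to i, then g would be the transposition of i
      -- and g i.
      · by_contra! h
        refine hs i (g i) (Ne.symm hi) (Equiv.ext fun m => ?_)
        rcases eq_or_ne m i with rfl | h1
        · rw [Equiv.swap_apply_left]
        rcases eq_or_ne m (g i) with rfl | h2
        · rw [hii, Equiv.swap_apply_right]
        rw [Equiv.swap_apply_of_ne_of_ne h1 h2]
        by_contra h3
        exact h2 (g.injective ((h m h3 h1).trans hii.symm))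
      · exact ⟨g i, fun h => hi (g.injective h), hi, hii⟩
  obtain ⟨k, hk, hki, hgk⟩ := key
  rw [alt_xy_left H i j hk, if_neg hgk, if_neg fun h => hki (g.injective h)]
  simp

/-- The row and column relations at the moved index p express every φ(x_i, y_j) through φ(x_p, y_p),
with exactly the signs of ω_pq. -/
theorem alt_eq_om_of_cyclic {p q : Fin n} (hpq : p ≠ q) (hg : g = Equiv.swap p q)
    (H : ∀ v₁ v₂ v₃, φ ![v₁, v₂] • (doubledRep n g v₃ - v₃) +
    φ ![v₂, v₃] • (doubledRep n g v₁ - v₁) + φ ![v₃, v₁] • (doubledRep n g v₂ - v₂) = 0) :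
    φ = φ ![xv p, yv p] • om p q := by
  have hp : g p = q := by rw [hg, Equiv.swap_apply_left]
  have h1 : g ≠ 1 := fun h => hpq (by rw [← hp, h]; rfl)
  have hp' : g p ≠ p := hp ▸ hpq.symm
  have hl : ∀ i j, φ ![xv i, yv j] = φ ![xv p, yv j] *
      ((if i = p then 1 else 0) - if i = q then 1 else 0) := fun i j => by
    rw [alt_xy_left H i j hp']
    simp only [g.injective.eq_iff]
    simp only [hp, eq_comm]
  have hr : ∀ i j, φ ![xv i, yv j] = φ ![xv i, yv p] *
      ((if j = p then 1 else 0) - if j = q then 1 else 0) := fun i j => by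
    rw [alt_xy_right H i j hp']
    simp only [g.injective.eq_iff]
    simp only [hp, eq_comm]
  refine alt_ext (fun i j _ => ?_) (fun i j _ => ?_) fun i j => ?_
  · rw [alt_xx_eq_zero h1 H]
    simp [om_apply]
  · rw [alt_yy_eq_zero h1 H]
    simp [om_apply]
  · rw [hl, hr p j, AlternatingMap.smul_apply, om_apply, smul_eq_mul]
    simp only [cx_xv, cx_yv, cy_yv, cy_xv, eq_comm]
    ring

end CyclicForms

/-! ### The linear cochain -/

variable {κL : LinCochain (Equiv.Perm (Fin n)) (DoubledSpace n)}
  {κC : ConstCochain (Equiv.Perm (Fin n)) (DoubledSpace n)}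

/-- Linear functionals on V extend to characters of the symmetric algebra. Evaluating the quadratic
identity at f + φ and at φ and subtracting isolates f(κᴸ), because f vanishes on g v - v. -/
theorem PBWConditions.cyclic_functional (h : PBWConditions (doubledRep n) κL κC)
    (g : Equiv.Perm (Fin n)) (f : DoubledSpace n →ₗ[ℂ] ℂ) (hf : ∀ v, f (doubledRep n g v) = f v)
    (v₁ v₂ v₃ : DoubledSpace n) : f (κL g ![v₁, v₂]) • (doubledRep n g v₃ - v₃) +
      f (κL g ![v₂, v₃]) • (doubledRep n g v₁ - v₁) +
      f (κL g ![v₃, v₁]) • (doubledRep n g v₂ - v₂) = 0 := by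
  have key : ∀ φ : DoubledSpace n →ₗ[ℂ] ℂ, φ (f (κL g ![v₁, v₂]) • (doubledRep n g v₃ - v₃) +
      f (κL g ![v₂, v₃]) • (doubledRep n g v₁ - v₁) +
      f (κL g ![v₃, v₁]) • (doubledRep n g v₂ - v₂)) = 0 := by
    intro φ
    have ev : ∀ ψ : DoubledSpace n →ₗ[ℂ] ℂ,
        ψ (κL g ![v₁, v₂]) * (ψ (doubledRep n g v₃) - ψ v₃) +
        ψ (κL g ![v₂, v₃]) * (ψ (doubledRep n g v₁) - ψ v₁) +
        ψ (κL g ![v₃, v₁]) * (ψ (doubledRep n g v₂) - ψ v₂) = 0 := by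
      intro ψ
      let Ψ : SymAlg (doubledRep n) →ₐ[ℂ] ℂ := SymmetricAlgebra.lift ψ
      have hΨ : ∀ v, Ψ (sι (doubledRep n) v) = ψ v := SymmetricAlgebra.lift_ι_apply ψ
      simpa only [map_add, map_mul, map_sub, hΨ, map_zero] using congrArg Ψ (h.sym g v₁ v₂ v₃)
    have h1 := ev (f + φ)
    simp only [LinearMap.add_apply, hf] at h1
    simp only [map_add, map_smul, map_sub, smul_eq_mul]
    linear_combination h1 - ev φ
  exact doubled_ext (fun i => (key (cx i)).trans (map_zero _).symm)
    fun i => (key (cy i)).trans (map_zero _).symm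

/-- A fixed vector killed by all invariant functionals is zero. -/
theorem eq_zero_of_fixed {g : Equiv.Perm (Fin n)} {w : DoubledSpace n}
    (hw : doubledRep n g w = w)
    (H : ∀ f : DoubledSpace n →ₗ[ℂ] ℂ, (∀ v, f (doubledRep n g v) = f v) → f w = 0) : w = 0 := by
  have key : ∀ φ : DoubledSpace n →ₗ[ℂ] ℂ, φ w = 0 := by
    intro φ
    have hpow : ∀ k : ℕ, doubledRep n (g ^ k) w = w := by
      intro k
      induction k with
      | zero => simp
      | succ k ih => rw [pow_succ, map_mul, Module.End.mul_apply, hw, ih]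
    -- Summing φ over the powers of g gives an invariant functional, whose value at the fixed vector
    -- w is the order of g times φ w.
    have h := H (∑ k ∈ Finset.range (orderOf g), φ ∘ₗ doubledRep n (g ^ k)) (by
      intro v
      simp only [LinearMap.sum_apply, LinearMap.comp_apply]
      simp only [← Module.End.mul_apply, ← map_mul, ← pow_succ]
      have e := (Finset.sum_range_succ (fun k => φ (doubledRep n (g ^ k) v)) (orderOf g)).symm.trans
        (Finset.sum_range_succ' _ _)
      rw [pow_orderOf_eq_one, pow_zero] at e
      exact (add_right_cancel e).symm)
    simp only [LinearMap.sum_apply, LinearMap.comp_apply, hpow, Finset.sum_const,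
      Finset.card_range, smul_eq_zero] at h
    exact h.resolve_left (orderOf_pos g).ne'
  exact doubled_ext (fun i => (key (cx i)).trans (map_zero _).symm)
    fun i => (key (cy i)).trans (map_zero _).symm

theorem PBWConditions.linCochain_eq_zero (h : PBWConditions (doubledRep n) κL κC)
    (hfix : ∀ g u, doubledRep n g (κL g u) = κL g u) {g : Equiv.Perm (Fin n)} (hg : g ≠ 1)
    (hs : ∀ i j, i ≠ j → g ≠ Equiv.swap i j) : κL g = 0 :=
  AlternatingMap.ext fun u => eq_zero_of_fixed (hfix g u) fun f hf =>
    DFunLike.congr_fun (alt_eq_zero_of_cyclic (φ := f.compAlternatingMap (κL g)) hg hs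
      (h.cyclic_functional g f hf)) u

theorem PBWConditions.linCochain_swap (h : PBWConditions (doubledRep n) κL κC)
    (hfix : ∀ g u, doubledRep n g (κL g u) = κL g u) {i j : Fin n} (hij : i ≠ j)
    (v w : DoubledSpace n) : κL (Equiv.swap i j) ![v, w] =
      om i j ![v, w] • κL (Equiv.swap i j) ![xv i, yv i] := by
  rw [← sub_eq_zero]
  refine eq_zero_of_fixed (g := Equiv.swap i j) (by rw [map_sub, map_smul, hfix, hfix])
    fun f hf => ?_
  have := DFunLike.congr_fun (alt_eq_om_of_cyclic
    (φ := f.compAlternatingMap (κL (Equiv.swap i j))) hij rfl (h.cyclic_functional _ f hf)) ![v, w]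
  simp only [LinearMap.compAlternatingMap_apply, AlternatingMap.smul_apply, smul_eq_mul] at this
  rw [map_sub, map_smul, this, smul_eq_mul, mul_comm, sub_self]

theorem exists_perm_apply_eq {p q i j : Fin n} (hpq : p ≠ q) (hij : i ≠ j) :
    ∃ g : Equiv.Perm (Fin n), g p = i ∧ g q = j := by
  refine ⟨Equiv.swap (Equiv.swap p i q) j * Equiv.swap p i, ?_, ?_⟩
  · rw [Equiv.Perm.mul_apply, Equiv.swap_apply_left, Equiv.swap_apply_of_ne_of_ne _ hij]
    rw [ne_eq, eq_comm, Equiv.swap_apply_eq_iff, Equiv.swap_apply_right]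
    exact hpq.symm
  · rw [Equiv.Perm.mul_apply, Equiv.swap_apply_left]

/-- Double transitivity reduces everything to the single vector U p q. It is invariant under (p q)
and under permutations of the other indices, hence a reflection vector; r supplies the coordinates
outside {p, q}. -/
theorem PBWConditions.exists_linPart (h : PBWConditions (doubledRep n) κL κC)
    (hfix : ∀ g u, doubledRep n g (κL g u) = κL g u) (h1 : κL 1 = 0) {p q r : Fin n}
    (hpq : p ≠ q) (hpr : p ≠ r) (hqr : q ≠ r) : ∃ a a' b b' : ℂ, κL = linPart a a' b b' := by
  set U : Fin n → Fin n → DoubledSpace n := fun i j => κL (Equiv.swap i j) ![xv i, yv i] with hU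
  have hrep : ∀ (g : Equiv.Perm (Fin n)) i j, doubledRep n g (U i j) = U (g i) (g j) := by
    intro g i j
    rw [hU]
    simp only [h.lin_inv, conj_swap, doubledRep_xv, doubledRep_yv]
  have hcomm : ∀ i j, i ≠ j → U j i = U i j := by
    intro i j hij
    change κL (Equiv.swap j i) ![xv j, yv j] = U i j
    rw [Equiv.swap_comm, h.linCochain_swap hfix hij, om_apply]
    simp [hij, U]
  set a := cx p (U p q)
  set a' := cx r (U p q)
  set b := cy p (U p q)
  set b' := cy r (U p q)
  have hq : doubledRep n (Equiv.swap p q) (U p q) = U p q := by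
    rw [hrep, Equiv.swap_apply_left, Equiv.swap_apply_right, hcomm p q hpq]
  have hm : ∀ m, m ≠ p → m ≠ q → doubledRep n (Equiv.swap r m) (U p q) = U p q := by
    intro m hp hq
    rw [hrep, Equiv.swap_apply_of_ne_of_ne hpr hp.symm, Equiv.swap_apply_of_ne_of_ne hqr hq.symm]
  have hpq_eq : U p q = reflVec a a' b b' p q := by
    refine doubled_ext (fun m => ?_) fun m => ?_
    · rw [cx_reflVec]
      rcases eq_or_ne m p with rfl | h1
      · rw [if_pos rfl, if_neg hpq]
        ring
      rcases eq_or_ne m q with rfl | h2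
      · rw [← hq, cx_rep, Equiv.symm_swap, Equiv.swap_apply_right, if_neg h1, if_pos rfl]
        ring
      · rw [← hm m h1 h2, cx_rep, Equiv.symm_swap, Equiv.swap_apply_right, if_neg h1, if_neg h2]
        ring
    · rw [cy_reflVec]
      rcases eq_or_ne m p with rfl | h1
      · rw [if_pos rfl, if_neg hpq]
        ring
      rcases eq_or_ne m q with rfl | h2
      · rw [← hq, cy_rep, Equiv.symm_swap, Equiv.swap_apply_right, if_neg h1, if_pos rfl]
        ring
      · rw [← hm m h1 h2, cy_rep, Equiv.symm_swap, Equiv.swap_apply_right, if_neg h1, if_neg h2]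
        ring
  refine ⟨a, a', b, b', funext fun g => ?_⟩
  by_cases hg : ∃ i j, i ≠ j ∧ g = Equiv.swap i j
  · obtain ⟨i, j, hij, rfl⟩ := hg
    obtain ⟨g, rfl, rfl⟩ := exists_perm_apply_eq hpq hij
    refine AlternatingMap.ext fun u => ?_
    have hu : u = ![u 0, u 1] := by ext i : 1; fin_cases i <;> rfl
    rw [hu, h.linCochain_swap hfix hij, linPart_swap _ _ _ _ hij, ← rep_reflVec, ← hpq_eq, hrep]
  · push Not at hg
    rw [linPart_eq_zero _ _ _ _ hg]
    by_cases hg1 : g = 1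
    · rw [hg1, h1]
    · exact h.linCochain_eq_zero hfix hg1 hg

/-! ### The constant cochain -/

theorem constPart_split (a a' b b' c α β : ℂ) (g : Equiv.Perm (Fin n)) :
    constPart a a' b b' c α β g = (if g = 1 then diagForm α β else 0) + c • swapSum om g +
      constPart a a' b b' 0 0 0 g := by
  have : (diagForm 0 0 : DoubledSpace n [⋀^Fin 2]→ₗ[ℂ] ℂ) = 0 := by simp [diagForm]
  simp [constPart, this]

/-- Subtracting the explicit 3-cycle part leaves an invariant family φ with vanishing cyclic sums,
to which the classification of such forms applies away from the identity. -/
theorem PBWConditions.exists_constPart {a a' b b' : ℂ}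
    (h : PBWConditions (doubledRep n) (linPart a a' b b') κC) {p q : Fin n} (hpq : p ≠ q) :
    ∃ c α β : ℂ, κC = constPart a a' b b' c α β := by
  set φ : ConstCochain (Equiv.Perm (Fin n)) (DoubledSpace n) :=
    fun g => κC g - constPart a a' b b' 0 0 0 g with hφ
  have hinv : ∀ g h v w, φ h ![v, w] =
      φ (g * h * g⁻¹) ![doubledRep n g v, doubledRep n g w] := by
    intro g y v w
    simp only [hφ, AlternatingMap.sub_apply]
    rw [h.const_inv g, constPart_inv a a' b b' 0 0 0 g]
  have hcyc : ∀ g v₁ v₂ v₃, φ g ![v₁, v₂] • (doubledRep n g v₃ - v₃) +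
      φ g ![v₂, v₃] • (doubledRep n g v₁ - v₁) + φ g ![v₃, v₁] • (doubledRep n g v₂ - v₂) = 0 := by
    intro g v₁ v₂ v₃
    have e1 := h.lin g v₁ v₂ v₃
    have e2 := linPart_lin a a' b b' 0 0 0 g v₁ v₂ v₃
    simp only [linTerm] at e1 e2
    simp only [hφ, AlternatingMap.sub_apply]
    -- The terms quadratic in κᴸ are the same in both identities and cancel.
    linear_combination (norm := module) e1 - e2
  have hone : φ 1 = κC 1 := by
    have : constPart a a' b b' 0 0 0 (1 : Equiv.Perm (Fin n)) = 0 := by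
      refine alt_ext (fun i j _ => ?_) (fun i j _ => ?_) fun i j => ?_ <;>
      · rw [constPart_apply, cycSum_one (fun i k => triForm_left ..) (fun i k => triForm_outer ..)]
        simp [diagForm_apply]
    rw [hφ]
    simp only [this, sub_zero]
  have hinv1 : ∀ g v w, κC 1 ![v, w] = κC 1 ![doubledRep n g v, doubledRep n g w] := by
    intro g v w
    simpa using h.const_inv g 1 v w
  refine ⟨φ (Equiv.swap p q) ![xv p, yv p], κC 1 ![xv p, yv p], κC 1 ![xv p, yv q],
    funext fun g => ?_⟩
  rw [constPart_split, ← sub_eq_iff_eq_add]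
  change φ g = _
  by_cases hg1 : g = 1
  · rw [hg1, if_pos rfl, swapSum_one (fun i => om_self i), smul_zero, add_zero, hone]
    refine alt_ext (fun i j _ => ?_) (fun i j _ => ?_) fun i j => ?_
    -- Invariance under (i j) makes the form symmetric on the pair, while it is alternating, so the
    -- value is zero.
    · have := hinv1 (Equiv.swap i j) (xv i) (xv j)
      rw [doubledRep_xv, doubledRep_xv, Equiv.swap_apply_left, Equiv.swap_apply_right,
        alt_swap (κC 1) (xv j)] at this
      rw [diagForm_xx]
      linear_combination this / 2
    · have := hinv1 (Equiv.swap i j) (yv i) (yv j)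
      rw [doubledRep_yv, doubledRep_yv, Equiv.swap_apply_left, Equiv.swap_apply_right,
        alt_swap (κC 1) (yv j)] at this
      rw [diagForm_yy]
      linear_combination this / 2
    · rw [diagForm_xy]
      split_ifs with hij
      · rw [← hij, hinv1 (Equiv.swap p i) (xv p), doubledRep_xv, doubledRep_yv,
          Equiv.swap_apply_left]
      · obtain ⟨g, rfl, rfl⟩ := exists_perm_apply_eq hpq hij
        rw [hinv1 g (xv p), doubledRep_xv, doubledRep_yv]
  rw [if_neg hg1, zero_add]
  by_cases hg : ∃ i j, i ≠ j ∧ g = Equiv.swap i j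
  · obtain ⟨i, j, hij, rfl⟩ := hg
    rw [swapSum_swap om_comm hij]
    obtain ⟨g, rfl, rfl⟩ := exists_perm_apply_eq hpq hij
    rw [hinv g (Equiv.swap p q), conj_swap, doubledRep_xv, doubledRep_yv]
    exact alt_eq_om_of_cyclic hij rfl (hcyc _)
  · push Not at hg
    rw [swapSum_eq_zero (fun i => om_self i) hg, smul_zero]
    exact alt_eq_zero_of_cyclic hg1 hg (hcyc g)

/-- Starting from x_p, y_p, the vectors x_r, y_r, x_p + x_q and y_p + y_q all occur as cyclic sums.
The first two isolate the conditions on the sums of coordinates, the last two give the remaining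
ones. -/
theorem PBWConditions.paramConditions {a a' b b' c α β : ℂ}
    (h : PBWConditions (doubledRep n) (linPart a a' b b') (constPart a a' b b' c α β))
    {p q r : Fin n} (hpq : p ≠ q) (hpr : p ≠ r) (hqr : q ≠ r) :
    ParamConditions n a a' b b' α β := by
  have key : ∀ v₁ v₂ v₃, diagForm α β ![reflVec a a' b b' p q, cycVec p q v₁ v₂ v₃] = 0 := by
    intro v₁ v₂ v₃
    have e := h.const (Equiv.swap p q) v₁ v₂ v₃
    rw [linPart_const_sum, swapSum_swap (fun i j => by rw [reflVec_comm, cycVec_comm]) hpq] at e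
    exact e
  have hx : cycVec p q (xv p) (yv p) (xv r) = xv r := by
    simp [cycVec, om_apply, hpr, hqr, hpq.symm]
  have hy : cycVec p q (xv p) (yv p) (yv r) = yv r := by
    simp [cycVec, om_apply, hpr, hqr, hpq.symm]
  have hx' : cycVec p q (xv p) (yv p) (xv q) = xv q + xv p := by
    simp [cycVec, om_apply, hpq, hpq.symm]
  have hy' : cycVec p q (xv p) (yv p) (yv q) = yv q + yv p := by
    simp [cycVec, om_apply, hpq, hpq.symm]
  have e1 := key (xv p) (yv p) (xv r)
  have e2 := key (xv p) (yv p) (yv r)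
  have e3 := key (xv p) (yv p) (xv q)
  have e4 := key (xv p) (yv p) (yv q)
  rw [diagForm_reflVec a a' b b' α β p q (cx_cycVec_eq ..) (cy_cycVec_eq ..)] at e1 e2 e3 e4
  rw [hx] at e1
  rw [hy] at e2
  rw [hx'] at e3
  rw [hy'] at e4
  simp [hpr, hpq, Finset.sum_add_distrib] at e1 e2 e3 e4
  exact
    { a_first := by linear_combination e4 / 2
      a_second := e2
      b_first := by linear_combination -e3 / 2
      b_second := by linear_combination -e1 }

end Classification

end DrinfeldOrbifold

end

/-- `a'`, `b'` stand for the parameters written `a^⊥`, `b^⊥`. -/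
theorem mainTheorem5 (n : ℕ) (hn : 4 ≤ n) :
    (∀ a a' b b' c α β : ℂ,
      (∃! κL : DrinfeldOrbifold.LinCochain (Equiv.Perm (Fin n)) (DrinfeldOrbifold.DoubledSpace n),
        DrinfeldOrbifold.IsLinPart a a' b b' κL) ∧
      (∃! κC : DrinfeldOrbifold.ConstCochain (Equiv.Perm (Fin n)) (DrinfeldOrbifold.DoubledSpace n),
        DrinfeldOrbifold.IsConstPart a a' b b' c α β κC)) ∧
    (∀ (a a' b b' c α β : ℂ)
      (κL : DrinfeldOrbifold.LinCochain (Equiv.Perm (Fin n)) (DrinfeldOrbifold.DoubledSpace n))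
      (κC : DrinfeldOrbifold.ConstCochain (Equiv.Perm (Fin n)) (DrinfeldOrbifold.DoubledSpace n)),
      DrinfeldOrbifold.ParamConditions n a a' b b' α β →
      DrinfeldOrbifold.IsLinPart a a' b b' κL →
      DrinfeldOrbifold.IsConstPart a a' b b' c α β κC →
      DrinfeldOrbifold.IsDrinfeldOrbifoldAlgebraOver (DrinfeldOrbifold.doubledRep n) κL κC
        (DrinfeldOrbifold.HPolyOn (DrinfeldOrbifold.doubledRep n) κL κC
          (DrinfeldOrbifold.basisSet n))) ∧
    (∀ (κL : DrinfeldOrbifold.LinCochain (Equiv.Perm (Fin n)) (DrinfeldOrbifold.DoubledSpace n))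
      (κC : DrinfeldOrbifold.ConstCochain (Equiv.Perm (Fin n)) (DrinfeldOrbifold.DoubledSpace n)),
      (DrinfeldOrbifold.IsDrinfeldOrbifoldAlgebra (DrinfeldOrbifold.doubledRep n) κL κC ∧
        (∀ g u, DrinfeldOrbifold.doubledRep n g (κL g u) = κL g u) ∧
        κL 1 = 0) ↔
      ∃ a a' b b' c α β : ℂ,
        DrinfeldOrbifold.ParamConditions n a a' b b' α β ∧
        DrinfeldOrbifold.IsLinPart a a' b b' κL ∧
        DrinfeldOrbifold.IsConstPart a a' b b' c α β κC) := by
  refine ⟨fun a a' b b' c α β => ⟨⟨_, DrinfeldOrbifold.isLinPart_linPart a a' b b',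
      fun _ h => h.eq_linPart⟩, ⟨_, DrinfeldOrbifold.isConstPart_constPart a a' b b' c α β,
      fun _ h => h.eq_constPart⟩⟩, ?_, ?_⟩
  · rintro a a' b b' c α β _ _ h hL hC
    obtain rfl := hL.eq_linPart
    obtain rfl := hC.eq_constPart
    exact ⟨(DrinfeldOrbifold.isDrinfeldOrbifoldAlgebra_iff).2
      (DrinfeldOrbifold.pbwConditions h),
      DrinfeldOrbifold.nonempty_algEquiv_HPoly _ _ _ DrinfeldOrbifold.span_basisSet⟩
  · intro κL κC
    constructor
    · rintro ⟨h, hfix, h1⟩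
      have h := (DrinfeldOrbifold.isDrinfeldOrbifoldAlgebra_iff).1 h
      -- Two indices carry a reference transposition, and the third is an index it fixes.
      have h01 : (⟨0, by omega⟩ : Fin n) ≠ ⟨1, by omega⟩ := by simp
      have h02 : (⟨0, by omega⟩ : Fin n) ≠ ⟨2, by omega⟩ := by simp
      have h12 : (⟨1, by omega⟩ : Fin n) ≠ ⟨2, by omega⟩ := by simp
      obtain ⟨a, a', b, b', rfl⟩ := h.exists_linPart hfix h1 h01 h02 h12
      obtain ⟨c, α, β, rfl⟩ := h.exists_constPart h01
      exact ⟨a, a', b, b', c, α, β, h.paramConditions h01 h02 h12,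
        DrinfeldOrbifold.isLinPart_linPart a a' b b',
        DrinfeldOrbifold.isConstPart_constPart a a' b b' c α β⟩
    · rintro ⟨a, a', b, b', c, α, β, h, hL, hC⟩
      obtain rfl := hL.eq_linPart
      obtain rfl := hC.eq_constPart
      exact ⟨(DrinfeldOrbifold.isDrinfeldOrbifoldAlgebra_iff).2
        (DrinfeldOrbifold.pbwConditions h), DrinfeldOrbifold.rep_linPart a a' b b',
        DrinfeldOrbifold.linPart_one a a' b b'⟩
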